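/- **Theorem 3.1.** Let $N\ge 1$ and $M\ge 0$ be integers. Let $z=re^{i\theta}\neq 0$, where $r=|z|>0$ and the argument $\theta\in\mathbb R$ is not restricted to $(-\pi,\pi]$; put $\ln z=\ln r+i\theta$. Let $\psi=\Gamma'/\Gamma$ be the digamma function. Let $c_k=2(1-2^{1-2k})\zeta(2k)/\pi^{2k}$ be the cosecant numbers and $c_k(x)=\sum_{j=0}^{k}\frac{(-1)^j}{(2j)!}c_{k-j}x^j$ the cosecant polynomials. (a) *Stokes sectors.* Suppose that $(M-\tfrac12)\pi<\theta<(M+\tfrac12)\pi$ (upper signs below) or $-(M+\tfrac12)\pi<\theta<-(M-\tfrac12)\pi$ (lower signs below), and that $z\notin\{0,-1,-2,\dots\}$. Then $$\psi(z)=\ln z-\frac1{2z}-\sum_{k=1}^{N-1}\frac{(-1)^k}{(2z)^{2k}}\Gamma(2k)\,c_k(1)+R\psi_N^{SS}(z)+SD\psi_M^{SS}(z),$$ where $$R\psi_N^{SS}(z)=\frac{3-2N}{z}R_N^{SS}(z)+\frac{4(-1)^N}{(2\pi z)^{2N-4}}\int_0^\infty y^{2N-2}e^{-y}\sum_{n=1}^\infty\frac{1}{n^{2N-4}(y^2+4\pi^2n^2z^2)^2}\,dy,$$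 $$R_N^{SS}(z)=\frac{2(-1)^{N+1}z}{(2\pi z)^{2N}}\int_0^\infty y^{2N-2}e^{-y}\sum_{n=1}^\infty\frac{1}{n^{2N-2}\left((y/2\pi z)^2+n^2\right)}\,dy,$$ $$SD\psi_M^{SS}(z)=\Bigl(\mp2\lfloor M/2\rfloor\mp\frac{1-(-1)^M}{1-e^{\mp2i\pi z}}\Bigr)\pi i,$$ the last quotient being read as $0$ if $M$ is even. The series over $n$ converge for every $y>0$, and both integrals converge absolutely. (b) *Stokes lines.* Suppose that $\theta=\pm(M+\tfrac12)\pi$. Then $$\psi(z)=\ln z-\frac1{2z}-\sum_{k=1}^{N-1}\frac{(-1)^k}{(2z)^{2k}}\Gamma(2k)\,c_k(1)+R\psi_N^{SL}(z)+SD\psi_M^{SL}(z),$$ where $$R\psi_N^{SL}(z)=\frac{3-2N}{z}R_N^{SL}(z)+\frac{4}{(2\pi|z|)^{2N-4}}\;\mathrm{f.p.}\!\int_0^\infty y^{2N-2}e^{-y}\sum_{n=1}^\infty\frac{1}{n^{2N-4}(y^2-4n^2\pi^2|z|^2)^2}\,dy,$$ $$R_N^{SL}(z)=\frac{2z}{(2\pi|z|)^{2N-2}}\;P\!\int_0^\infty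 y^{2N-2}e^{-y}\sum_{n=1}^\infty\frac{1}{n^{2N-2}(y^2-4n^2\pi^2|z|^2)}\,dy,$$ $$SD\psi_M^{SL}(z)=\pm\Bigl((-1)^M-1-2\lfloor M/2\rfloor+\frac{(-1)^M}{e^{2\pi|z|}-1}\Bigr)\pi i,$$ with the upper sign for $\theta=(M+\tfrac12)\pi$ and the lower sign for $\theta=-(M+\tfrac12)\pi$. Let $I(\varepsilon)$ denote the integral of the respective integrand over those $y>0$ that have distance greater than $\varepsilon$ from all the poles $2\pi n|z|$, $n\ge1$; it converges absolutely for every $\varepsilon>0$. The Cauchy principal value $P\!\int$ is $\lim_{\varepsilon\to0+}I(\varepsilon)$. The finite part $\mathrm{f.p.}\!\int$ is the principal value continued to double poles in the sense of Hadamard: the number $L$ such that $I(\varepsilon)=A/\varepsilon+L+o(1)$ as $\varepsilon\to0+$ for some constant $A$. Both values exist, and the series over $n$ converge at every $y>0$ that is not a pole. -/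

import Mathlib

open Set Filter Topology MeasureTheory

namespace StirlingDigamma

noncomputable section

/-- The point `r e^{iθ}`; the pair `(r, θ)` with `r > 0` is a point of the Riemann surface of the
logarithm, `θ` being its (not necessarily principal) argument. -/
def point (r θ : ℝ) : ℂ := (r : ℂ) * Complex.exp ((θ : ℂ) * Complex.I)

/-- `ln z = ln r + iθ` at the point `(r, θ)` of the Riemann surface of the logarithm. -/
def surfaceLog (r θ : ℝ) : ℂ := (Real.log r : ℂ) + (θ : ℂ) * Complex.I

/-- The cosecant numbers `c_k = 2 (1 - 2^{1-2k}) ζ(2k) / π^{2k}`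
(so that `x / sin x = ∑ c_k x^{2k}`; in particular `c_0 = 1`). -/
def cosecantNumber (k : ℕ) : ℂ :=
  2 * (1 - (2 : ℂ) ^ (1 - 2 * (k : ℤ))) * riemannZeta (2 * (k : ℂ)) / (Real.pi : ℂ) ^ (2 * k)

/-- The cosecant polynomials `c_k(x) = ∑_{j=0}^k (-1)^j c_{k-j} x^j / (2j)!`. -/
def cosecantPoly (k : ℕ) (x : ℂ) : ℂ :=
  ∑ j ∈ Finset.range (k + 1),
    (-1 : ℂ) ^ j / (Nat.factorial (2 * j) : ℂ) * cosecantNumber (k - j) * x ^ j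

/-- The truncated series `∑_{k=1}^{N-1} (-1)^k Γ(2k) c_k(1) / (2z)^{2k}`. -/
def truncatedSeries (N : ℕ) (z : ℂ) : ℂ :=
  ∑ k ∈ Finset.Ico 1 N,
    (-1 : ℂ) ^ k / (2 * z) ^ (2 * k) * Complex.Gamma (2 * (k : ℂ)) * cosecantPoly k 1

/-! In the series below the summation variable `n ≥ 1` of the text is `n + 1` with `n : ℕ`. -/

/-- `n`-th term of `∑_{n ≥ 1} 1 / (n^{2N-2} ((y/2πz)² + n²))`. -/
def termSS (N : ℕ) (z : ℂ) (y : ℝ) (n : ℕ) : ℂ :=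
  1 / (((n : ℂ) + 1) ^ (2 * (N : ℤ) - 2) *
    (((y : ℂ) / (2 * (Real.pi : ℂ) * z)) ^ 2 + ((n : ℂ) + 1) ^ 2))

/-- `n`-th term of `∑_{n ≥ 1} 1 / (n^{2N-4} (y² + 4π²n²z²)²)`. -/
def termSqSS (N : ℕ) (z : ℂ) (y : ℝ) (n : ℕ) : ℂ :=
  1 / (((n : ℂ) + 1) ^ (2 * (N : ℤ) - 4) *
    ((y : ℂ) ^ 2 + 4 * (Real.pi : ℂ) ^ 2 * ((n : ℂ) + 1) ^ 2 * z ^ 2) ^ 2)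

/-- The integrand `y^{2N-2} e^{-y} ∑_{n ≥ 1} 1 / (n^{2N-2} ((y/2πz)² + n²))`. -/
def integrandSS (N : ℕ) (z : ℂ) (y : ℝ) : ℂ :=
  (y : ℂ) ^ (2 * (N : ℤ) - 2) * Complex.exp (-(y : ℂ)) * ∑' n : ℕ, termSS N z y n

/-- The integrand `y^{2N-2} e^{-y} ∑_{n ≥ 1} 1 / (n^{2N-4} (y² + 4π²n²z²)²)`. -/
def integrandSqSS (N : ℕ) (z : ℂ) (y : ℝ) : ℂ :=
  (y : ℂ) ^ (2 * (N : ℤ) - 2) * Complex.exp (-(y : ℂ)) * ∑' n : ℕ, termSqSS N z y n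

/-- The remainder `R_N^{SS}(z)` of `ln Γ` in a Stokes sector. -/
def remainderSS (N : ℕ) (z : ℂ) : ℂ :=
  2 * (-1 : ℂ) ^ (N + 1) * z / (2 * (Real.pi : ℂ) * z) ^ (2 * N) *
    ∫ y in Ioi (0 : ℝ), integrandSS N z y

/-- The remainder `Rψ_N^{SS}(z)` of `ψ` in a Stokes sector. -/
def remainderPsiSS (N : ℕ) (z : ℂ) : ℂ :=
  (3 - 2 * (N : ℂ)) / z * remainderSS N z +
    4 * (-1 : ℂ) ^ N / (2 * (Real.pi : ℂ) * z) ^ (2 * (N : ℤ) - 4) *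
      ∫ y in Ioi (0 : ℝ), integrandSqSS N z y

/-- The Stokes discontinuity term `SDψ_M^{SS}(z)`; `s = 1` is the upper-signed version and `s = -1`
the lower-signed one. -/
def discontinuityPsiSS (M : ℕ) (s : ℝ) (z : ℂ) : ℂ :=
  (-(s : ℂ) * 2 * ((M / 2 : ℕ) : ℂ) -
    (s : ℂ) * (1 - (-1 : ℂ) ^ M) /
      (1 - Complex.exp (-(s : ℂ) * (2 * Complex.I * (Real.pi : ℂ) * z)))) *
    (Real.pi : ℂ) * Complex.I

/-- `n`-th term of `∑_{n ≥ 1} 1 / (n^{2N-2} (y² - 4n²π²ρ²))`. -/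
def termSL (N : ℕ) (ρ y : ℝ) (n : ℕ) : ℝ :=
  1 / (((n : ℝ) + 1) ^ (2 * (N : ℤ) - 2) *
    (y ^ 2 - 4 * ((n : ℝ) + 1) ^ 2 * Real.pi ^ 2 * ρ ^ 2))

/-- `n`-th term of `∑_{n ≥ 1} 1 / (n^{2N-4} (y² - 4n²π²ρ²)²)`. -/
def termSqSL (N : ℕ) (ρ y : ℝ) (n : ℕ) : ℝ :=
  1 / (((n : ℝ) + 1) ^ (2 * (N : ℤ) - 4) *
    (y ^ 2 - 4 * ((n : ℝ) + 1) ^ 2 * Real.pi ^ 2 * ρ ^ 2) ^ 2)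

/-- The integrand `y^{2N-2} e^{-y} ∑_{n ≥ 1} 1 / (n^{2N-2} (y² - 4n²π²ρ²))`. -/
def integrandSL (N : ℕ) (ρ y : ℝ) : ℝ :=
  y ^ (2 * (N : ℤ) - 2) * Real.exp (-y) * ∑' n : ℕ, termSL N ρ y n

/-- The integrand `y^{2N-2} e^{-y} ∑_{n ≥ 1} 1 / (n^{2N-4} (y² - 4n²π²ρ²)²)`. -/
def integrandSqSL (N : ℕ) (ρ y : ℝ) : ℝ :=
  y ^ (2 * (N : ℤ) - 2) * Real.exp (-y) * ∑' n : ℕ, termSqSL N ρ y n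

/-- The poles `2πnρ`, `n ≥ 1`, of the two integrands above on the half-line `y > 0`. -/
def poles (ρ : ℝ) : Set ℝ := {p | ∃ n : ℕ, p = 2 * Real.pi * ((n : ℝ) + 1) * ρ}

/-- The half-line `(0, ∞)` with the closed `ε`-neighbourhoods of the points of `S` removed. -/
def excised (S : Set ℝ) (ε : ℝ) : Set ℝ := {y | 0 < y ∧ ∀ p ∈ S, ε < |y - p|}

/-- `L` is the Cauchy principal value of `∫_0^∞ F(y) dy`, where `F` is singular on `S`:
the integrals outside the symmetric `ε`-neighbourhoods of the singularities exist and
converge to `L` as `ε → 0+`. -/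
def HasPrincipalValue (F : ℝ → ℝ) (S : Set ℝ) (L : ℝ) : Prop :=
  (∀ ε : ℝ, 0 < ε → IntegrableOn F (excised S ε)) ∧
    Tendsto (fun ε : ℝ => ∫ y in excised S ε, F y) (𝓝[>] 0) (𝓝 L)

/-- `L` is the Hadamard finite part of `∫_0^∞ F(y) dy`, where `F` has at most double poles on `S`:
the integrals outside the symmetric `ε`-neighbourhoods of the singularities exist and
equal `A / ε + L + o(1)` as `ε → 0+`, for some constant `A`. The number `L` is unique, and it is
the Cauchy principal value if `A = 0`. -/
def HasFinitePart (F : ℝ → ℝ) (S : Set ℝ) (L : ℝ) : Prop :=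
  (∀ ε : ℝ, 0 < ε → IntegrableOn F (excised S ε)) ∧
    ∃ A : ℝ, Tendsto (fun ε : ℝ => (∫ y in excised S ε, F y) - A / ε) (𝓝[>] 0) (𝓝 L)

/-- The remainder `R_N^{SL}(z)` of `ln Γ` on a Stokes line, in terms of the value `I` of its
principal value integral. -/
def remainderSL (N : ℕ) (z : ℂ) (I : ℝ) : ℂ :=
  2 * z / (2 * (Real.pi : ℂ) * (‖z‖ : ℂ)) ^ (2 * (N : ℤ) - 2) * (I : ℂ)

/-- The remainder `Rψ_N^{SL}(z)` of `ψ` on a Stokes line, in terms of the value `I` of the principal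
value integral in `R_N^{SL}(z)` and the finite part `J` of the integral with squared
denominators. -/
def remainderPsiSL (N : ℕ) (z : ℂ) (I J : ℝ) : ℂ :=
  (3 - 2 * (N : ℂ)) / z * remainderSL N z I +
    4 / (2 * (Real.pi : ℂ) * (‖z‖ : ℂ)) ^ (2 * (N : ℤ) - 4) * (J : ℂ)

/-- The Stokes discontinuity term `SDψ_M^{SL}(z)`; `s = ±1` is the sign in front. -/
def discontinuityPsiSL (M : ℕ) (s : ℝ) (z : ℂ) : ℂ :=
  (s : ℂ) * ((-1 : ℂ) ^ M - 1 - 2 * ((M / 2 : ℕ) : ℂ) +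
    (-1 : ℂ) ^ M / (Complex.exp (2 * (Real.pi : ℂ) * (‖z‖ : ℂ)) - 1)) *
    (Real.pi : ℂ) * Complex.I

end

end StirlingDigamma

namespace StirlingDigamma

/-! Everything comes from Binet's formula `ψ(z) = ln z - 1/(2z) - ∑ B(2πnz)`, `n ≥ 1`, where `B =
binetTerm` is the Laplace transform of `2t/(1+t²)`. On the positive reals this is Binet's first
formula with its kernel expanded in partial fractions. There both sides obey the same recurrence
under `x ↦ x + 1`, and their difference, being periodic and `O(1/x)`, vanishes
(`realDigamma_eq_binet`). The identity theorem carries the formula to `Re z > 0`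
(`digamma_eq_binet`). Two integrations by parts make `B(w)` continuous and `O(|w|⁻²)` on the closed
half-plane without the origin, so the formula persists on the imaginary axis.

Stokes sectors: one integration by parts in `B(w) = ∫ 2y e^{-y}/(y²+w²) dy` produces the remainder
with `N = 1`. The identity `y² = (y² + (2πnz)²) - (2πnz)²` leads from `N` to `N + 1` and frees
exactly one term of the asymptotic series, because `c_k(1) = -2ζ(2k)/π^{2k}` (`cosecantPoly_one`).
The remainder is even in `z`, so the reflection formula gives the left half-plane with the same
remainder and an extra cotangent. A point of the `M`-th sector is `(-1)^M` times a point of the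
right half-plane whose principal logarithm differs from `ln z` by `±Mπi`; this shift and the
cotangent make up the Stokes term.

Stokes lines: in the form `B(w) = ∫ e^{-y} log(1 + y²/w²) dy` the limit `w → iW` is explicit. Beyond
`y = W` the argument of the logarithm reaches the negative axis from below, so the limit is `∫
e^{-y} log|1 - y²/W²| dy - πi e^{-W}` (`binetTerm_mul_I`). Summed over `n`, Euler's sine product
turns the real parts into `∫ e^{-y} L(y) dy` with `L(y) = log|sin(y/2ρ)/(y/2ρ)|`, `ρ = |z|`, and the
geometric series turns the rest into the exponentially small Stokes term. For `N = 1` the series in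
the two integrands are combinations of `L'` and `L''`. Integration by parts outside the
`ε`-neighbourhoods of the poles therefore evaluates the principal value and the finite part
(`hasExpansion_logSincDeriv`, `hasExpansion_logSincDeriv₂`), and in the resulting remainder only `-∫
e^{-y} L` survives. The recurrence in `N` is that of the sectors up to signs
(`exists_hasExpansion`). -/

/-! ### Cosecant polynomials at `1` and even zeta values -/

/-- The Taylor expansion of the Bernoulli polynomials at `1 / 2`. -/
theorem bernoulliFun_half_add (n : ℕ) : ∀ x : ℝ, bernoulliFun n (2⁻¹ + x) =
    ∑ j ∈ Finset.range (n + 1), (n.choose j : ℝ) * bernoulliFun (n - j) 2⁻¹ * x ^ j := by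
  induction n with
  | zero => intro x; simp
  | succ n ih =>
    -- As `B_{n+1}' = (n+1) B_n`, the induction hypothesis makes the difference of the two sides
    -- constant; at `x = 0` only the summand `j = 0` is left and the difference is zero.
    have key : ∀ x : ℝ, HasDerivAt (fun x : ℝ => bernoulliFun (n + 1) (2⁻¹ + x) -
        ∑ j ∈ Finset.range (n + 1 + 1),
          ((n + 1).choose j : ℝ) * bernoulliFun (n + 1 - j) 2⁻¹ * x ^ j) 0 x := by
      intro x
      have h1 : HasDerivAt (fun x : ℝ => bernoulliFun (n + 1) (2⁻¹ + x))
          (((n + 1 : ℕ) : ℝ) * bernoulliFun n (2⁻¹ + x)) x := by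
        have := (hasDerivAt_bernoulliFun (n + 1) (2⁻¹ + x)).comp_const_add 2⁻¹ x
        simpa using this
      have h2 : HasDerivAt (fun x : ℝ => ∑ j ∈ Finset.range (n + 1 + 1),
          ((n + 1).choose j : ℝ) * bernoulliFun (n + 1 - j) 2⁻¹ * x ^ j)
          (∑ j ∈ Finset.range (n + 1 + 1),
          ((n + 1).choose j : ℝ) * bernoulliFun (n + 1 - j) 2⁻¹ * ((j : ℝ) * x ^ (j - 1))) x :=
        HasDerivAt.fun_sum fun j _ => (hasDerivAt_pow j x).const_mul _
      have h3 := h1.sub h2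
      convert! h3 using 1
      rw [ih, Finset.sum_range_succ' _ (n + 1), Finset.mul_sum]
      simp only [CharP.cast_eq_zero, zero_mul, mul_zero, add_zero]
      rw [eq_comm, sub_eq_zero]
      refine Finset.sum_congr rfl fun j _ => ?_
      have h4 : ((n + 1 : ℕ) : ℝ) * (n.choose j : ℝ) =
          ((n + 1).choose (j + 1) : ℝ) * ((j + 1 : ℕ) : ℝ) := by
        exact_mod_cast Nat.add_one_mul_choose_eq n j
      simp only [Nat.add_sub_add_right, Nat.add_sub_cancel]
      linear_combination (bernoulliFun (n - j) 2⁻¹ * x ^ j) * h4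
    intro x
    have hc := is_const_of_deriv_eq_zero (fun y => (key y).differentiableAt)
      (fun y => (key y).deriv) x 0
    simp only [add_zero] at hc
    rw [Finset.sum_range_succ' _ (n + 1)] at hc
    rw [Finset.sum_range_succ' _ (n + 1)] at hc
    rw [Finset.sum_range_succ' _ (n + 1)]
    simp at hc
    simp
    linarith

theorem sum_range_two_mul_add_one {R : Type*} [AddCommMonoid R] (g : ℕ → R) (k : ℕ) :
    ∑ j ∈ Finset.range (2 * k + 1), g j =
      ∑ i ∈ Finset.range (k + 1), g (2 * i) + ∑ i ∈ Finset.range k, g (2 * i + 1) := by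
  induction k with
  | zero => simp
  | succ k ih =>
    rw [show 2 * (k + 1) + 1 = 2 * k + 1 + 1 + 1 by ring, Finset.sum_range_succ,
      Finset.sum_range_succ, ih, Finset.sum_range_succ (fun i => g (2 * i)) (k + 1),
      Finset.sum_range_succ (fun i => g (2 * i + 1)) k, show 2 * (k + 1) = 2 * k + 1 + 1 by ring]
    abel

/-- The Taylor expansion about `1/2`, evaluated at distance `1/2`, gives `B_{2k}(1) = B_{2k}`. The
odd powers drop out because Bernoulli polynomials of odd degree vanish at `1/2`. -/
theorem sum_choose_mul_bernoulliFun_half {k : ℕ} :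
    ∑ i ∈ Finset.range (k + 1),
      ((2 * k).choose (2 * i) : ℝ) * bernoulliFun (2 * (k - i)) 2⁻¹ * 2⁻¹ ^ (2 * i) =
      bernoulli (2 * k) := by
  have h := bernoulliFun_half_add (2 * k) 2⁻¹
  rw [sum_range_two_mul_add_one, show (2⁻¹ + 2⁻¹ : ℝ) = 1 by norm_num,
    bernoulliFun_eval_one, if_neg (by omega), bernoulliFun_eval_zero, add_zero] at h
  rw [h]
  have h0 : ∑ i ∈ Finset.range k, ((2 * k).choose (2 * i + 1) : ℝ) *
      bernoulliFun (2 * k - (2 * i + 1)) 2⁻¹ * 2⁻¹ ^ (2 * i + 1) = 0 := by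
    refine Finset.sum_eq_zero fun i hi => ?_
    have hi' := Finset.mem_range.mp hi
    rw [show 2 * k - (2 * i + 1) = 2 * (k - i - 1) + 1 by omega, bernoulliFun_eval_half_eq_zero]
    simp
  rw [h0, add_zero]
  refine Finset.sum_congr rfl fun i _ => ?_
  rw [Nat.mul_sub]

/-- Euler's formula for `ζ(2m)` together with `B_{2m}(1/2) = (2^{1-2m} - 1) B_{2m}`, which absorbs
the factor `1 - 2^{1-2m}`. In this form the sum defining `c_k(1)` is a Taylor sum about `1/2`. -/
theorem cosecantNumber_eq_bernoulliFun (m : ℕ) :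
    cosecantNumber m =
      (-1) ^ m * 2 ^ (2 * m) * (bernoulliFun (2 * m) 2⁻¹ : ℂ) / ((2 * m).factorial : ℂ) := by
  rw [cosecantNumber, riemannZeta_two_mul_nat', bernoulliFun_eval_half]
  have hpi : (Real.pi : ℂ) ≠ 0 := by exact_mod_cast Real.pi_ne_zero
  have h1 : (2 : ℂ) ^ (1 - 2 * (m : ℤ)) = 2 / 2 ^ (2 * m) := by
    rw [zpow_sub₀ two_ne_zero, zpow_one]; norm_cast
  have h2 : (2 : ℂ) ^ (2 * (m : ℤ) - 1) = 2 ^ (2 * m) / 2 := by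
    rw [zpow_sub₀ two_ne_zero, zpow_one]; norm_cast
  rw [h1, h2]
  push_cast
  field_simp
  ring

/-- `c_k(1)` is an even zeta value: `∑ c_k(1) x^{2k} = x cot x`. -/
theorem cosecantPoly_one (k : ℕ) :
    cosecantPoly k 1 = -2 * riemannZeta (2 * k) / (Real.pi : ℂ) ^ (2 * k) := by
  have hpi : (Real.pi : ℂ) ≠ 0 := by exact_mod_cast Real.pi_ne_zero
  have h2 : (2 : ℂ) ^ (2 * (k : ℤ) - 1) = 2 ^ (2 * k) / 2 := by
    rw [zpow_sub₀ two_ne_zero, zpow_one]; norm_cast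
  have hs := congrArg (fun x : ℝ => (x : ℂ)) (sum_choose_mul_bernoulliFun_half (k := k))
  push_cast at hs
  rw [riemannZeta_two_mul_nat', h2]
  rw [← hs, cosecantPoly, Finset.mul_sum, Finset.sum_div, Finset.mul_sum, Finset.sum_div]
  refine Finset.sum_congr rfl fun j hj => ?_
  have hj' : j ≤ k := Nat.lt_succ_iff.mp (Finset.mem_range.mp hj)
  obtain ⟨m, rfl⟩ := Nat.exists_eq_add_of_le hj'
  rw [cosecantNumber_eq_bernoulliFun, Nat.add_sub_cancel_left]
  have hc : ((2 * (j + m)).choose (2 * j) : ℂ) =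
      ((2 * (j + m)).factorial : ℂ) / (((2 * j).factorial : ℂ) * ((2 * m).factorial : ℂ)) := by
    rw [Nat.cast_choose ℂ (by omega : 2 * j ≤ 2 * (j + m)),
      show 2 * (j + m) - 2 * j = 2 * m by omega]
  rw [hc]
  have f1 : ((2 * j).factorial : ℂ) ≠ 0 := by exact_mod_cast Nat.factorial_ne_zero _
  have f2 : ((2 * m).factorial : ℂ) ≠ 0 := by exact_mod_cast Nat.factorial_ne_zero _
  have f3 : ((2 * (j + m)).factorial : ℂ) ≠ 0 := by exact_mod_cast Nat.factorial_ne_zero _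
  have e1 : ((-1 : ℂ) ^ j) * (-1) ^ m = (-1) ^ (j + m) := by rw [pow_add]
  rw [inv_pow]
  field_simp
  rw [show 2 * (j + m) = 2 * j + 2 * m by ring]
  simp only [pow_add]
  ring

/-! ### Binet's first formula on the positive reals -/

/-- The kernel `1 / (e^t - 1) - 1 / t + 1 / 2` of Binet's first formula. -/
noncomputable def binetKernel (t : ℝ) : ℝ := 1 / (Real.exp t - 1) - 1 / t + 1 / 2

/-- The partial fraction expansion of the kernel of Binet's first formula. -/
theorem hasSum_binetKernel {t : ℝ} (ht : 0 < t) :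
    HasSum (fun n : ℕ => 2 * t / (t ^ 2 + (2 * Real.pi * ((n : ℝ) + 1)) ^ 2)) (binetKernel t) := by
  have hpi : (Real.pi : ℂ) ≠ 0 := by exact_mod_cast Real.pi_ne_zero
  have htc : (t : ℂ) ≠ 0 := by exact_mod_cast ht.ne'
  -- The Mittag-Leffler series of the cotangent at this purely imaginary point, multiplied by
  -- `i/2π`, is the wanted expansion.
  set x : ℂ := Complex.I * t / (2 * Real.pi) with hx
  have him : x.im = t / (2 * Real.pi) := by
    have : x = ((t / (2 * Real.pi) : ℝ) : ℂ) * Complex.I := by rw [hx]; push_cast; ring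
    rw [this, Complex.im_ofReal_mul, Complex.I_im, mul_one]
  have hxm : x ∈ Complex.integerComplement := by
    rintro ⟨m, hm⟩
    have : x.im = 0 := by rw [← hm]; simp
    rw [him] at this
    have := Real.pi_pos
    have : 0 < t / (2 * Real.pi) := by positivity
    linarith
  have hs := (summable_cotTerm hxm).hasSum
  have hcot := cot_series_rep' hxm
  have h2 : HasSum (fun n : ℕ => Complex.I / (2 * Real.pi) * cotTerm x n)
      (Complex.I / (2 * Real.pi) * (Real.pi * Complex.cot (Real.pi * x) - 1 / x)) := by
    rw [hcot]; exact hs.mul_left _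
  rw [← Complex.hasSum_ofReal]
  convert! h2 using 1
  · funext n
    rw [cotTerm_identity hxm]
    have hne : (t : ℂ) ^ 2 + (2 * Real.pi * ((n : ℂ) + 1)) ^ 2 ≠ 0 := by
      have : (0 : ℝ) < t ^ 2 + (2 * Real.pi * ((n : ℝ) + 1)) ^ 2 := by positivity
      exact_mod_cast this.ne'
    have e : (x + (n + 1)) * (x - (n + 1)) =
        -((t : ℂ) ^ 2 + (2 * Real.pi * ((n : ℂ) + 1)) ^ 2) / (2 * Real.pi) ^ 2 := by
      rw [hx]; field_simp; ring_nf; rw [Complex.I_sq]; ring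
    rw [e]
    push_cast
    rw [hx]
    field_simp
    rw [Complex.I_sq]; ring
  · rw [Complex.cot_pi_eq_exp_ratio]
    have e1 : 2 * Real.pi * Complex.I * x = -(t : ℂ) := by
      rw [hx]; field_simp; rw [Complex.I_sq]
    rw [e1, Complex.exp_neg]
    have he : Complex.exp t ≠ 0 := Complex.exp_ne_zero _
    have he1 : Complex.exp t - 1 ≠ 0 := by
      have : Real.exp t - 1 ≠ 0 := by
        have := Real.add_one_lt_exp ht.ne'
        linarith
      rw [← Complex.ofReal_exp]
      exact_mod_cast this
    have he2 : 1 - (Complex.exp t)⁻¹ ≠ 0 := by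
      intro h
      apply he1
      have := congrArg (fun u => u * Complex.exp t) h
      simp only [sub_mul, one_mul, inv_mul_cancel₀ he, zero_mul] at this
      exact this
    rw [binetKernel, hx]
    push_cast
    have e3 : 1 - (Complex.exp t)⁻¹ = (Complex.exp t - 1) / Complex.exp t := by field_simp
    rw [e3]
    field_simp
    ring_nf
    try simp only [Complex.I_sq]
    try ring

theorem binetKernel_nonneg {t : ℝ} (ht : 0 < t) : 0 ≤ binetKernel t :=
  (hasSum_binetKernel ht).nonneg fun n => by positivity

theorem binetKernel_le {t : ℝ} (ht : 0 < t) : binetKernel t ≤ 1 / 2 := by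
  have h1 : t ≤ Real.exp t - 1 := by linarith [Real.add_one_le_exp t]
  have := one_div_le_one_div_of_le ht h1
  rw [binetKernel]; linarith

theorem measurable_binetKernel : Measurable binetKernel := by
  unfold binetKernel; fun_prop

theorem integrableOn_exp_neg_mul {x : ℝ} (hx : 0 < x) :
    IntegrableOn (fun t : ℝ => Real.exp (-(x * t))) (Ioi 0) := by
  have := exp_neg_integrableOn_Ioi 0 hx
  simpa [neg_mul] using this

theorem integral_exp_neg_mul {x : ℝ} (hx : 0 < x) :
    ∫ t in Ioi (0 : ℝ), Real.exp (-(x * t)) = 1 / x := by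
  have := integral_exp_mul_Ioi (a := -x) (by linarith) 0
  simp [neg_mul] at this
  rw [this]; simp

theorem integrableOn_binetKernel_mul_exp {x : ℝ} (hx : 0 < x) :
    IntegrableOn (fun t : ℝ => binetKernel t * Real.exp (-(x * t))) (Ioi 0) := by
  refine Integrable.mono' ((integrableOn_exp_neg_mul hx).const_mul (1 / 2)) ?_ ?_
  · exact (measurable_binetKernel.mul (by fun_prop)).aestronglyMeasurable
  · refine (ae_restrict_mem measurableSet_Ioi).mono fun t ht => ?_
    rw [Real.norm_of_nonneg (mul_nonneg (binetKernel_nonneg ht) (Real.exp_nonneg _))]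
    exact mul_le_mul_of_nonneg_right (binetKernel_le ht) (Real.exp_nonneg _)

/-- The integral in Binet's first formula. -/
noncomputable def binetIntegral (x : ℝ) : ℝ :=
  ∫ t in Ioi (0 : ℝ), binetKernel t * Real.exp (-(x * t))

theorem abs_binetIntegral_le {x : ℝ} (hx : 0 < x) : |binetIntegral x| ≤ 1 / (2 * x) := by
  have h0 : 0 ≤ binetIntegral x := setIntegral_nonneg measurableSet_Ioi fun t ht =>
    mul_nonneg (binetKernel_nonneg ht) (Real.exp_nonneg _)
  rw [abs_of_nonneg h0]
  calc binetIntegral x ≤ ∫ t in Ioi (0 : ℝ), 1 / 2 * Real.exp (-(x * t)) := by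
        refine setIntegral_mono_on (integrableOn_binetKernel_mul_exp hx)
          ((integrableOn_exp_neg_mul hx).const_mul _) measurableSet_Ioi fun t ht => ?_
        exact mul_le_mul_of_nonneg_right (binetKernel_le ht) (Real.exp_nonneg _)
    _ = 1 / (2 * x) := by
        rw [integral_const_mul, integral_exp_neg_mul hx]; field_simp

/-- In `K(t)(1 - e^{-t})e^{-xt}` the pole term of `K` gives a Frullani integral, hence the
logarithm, and what is left is a combination of exponentials. This is the recurrence matching
`ψ(x+1) = ψ(x) + 1/x`. -/
theorem binetIntegral_sub {x : ℝ} (hx : 0 < x) :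
    binetIntegral x - binetIntegral (x + 1) =
      1 / (2 * x) + 1 / (2 * (x + 1)) - Real.log ((x + 1) / x) := by
  have hx1 : 0 < x + 1 := by linarith
  have i0 := integrableOn_exp_neg_mul hx
  have i1 := integrableOn_exp_neg_mul hx1
  have k0 := integrableOn_binetKernel_mul_exp hx
  have k1 := integrableOn_binetKernel_mul_exp hx1
  have heq : EqOn (fun t : ℝ => t⁻¹ • (Real.exp (-(x * t)) - Real.exp (-((x + 1) * t))))
      (fun t => ((1 / 2) * Real.exp (-(x * t)) + (1 / 2) * Real.exp (-((x + 1) * t))) -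
        (binetKernel t * Real.exp (-(x * t)) - binetKernel t * Real.exp (-((x + 1) * t))))
      (Ioi 0) := by
    intro t ht
    have ht' : (0 : ℝ) < t := ht
    have he : Real.exp t - 1 ≠ 0 := by
      have := Real.add_one_lt_exp ht'.ne'
      linarith
    have e1 : Real.exp (-(x * t)) = Real.exp (-((x + 1) * t)) * Real.exp t := by
      rw [← Real.exp_add]; congr 1; ring
    simp only [smul_eq_mul, binetKernel]
    rw [e1]
    field_simp
    ring
  have hint : IntegrableOn (fun t : ℝ => t⁻¹ • (Real.exp (-(x * t)) - Real.exp (-((x + 1) * t))))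
      (Ioi 0) :=
    IntegrableOn.congr_fun (((i0.const_mul (1 / 2)).add (i1.const_mul (1 / 2))).sub (k0.sub k1))
      heq.symm measurableSet_Ioi
  have hF := Frullani.integral_Ioi_eq (f := fun t : ℝ => Real.exp (-t)) (L := 1) (R := 0)
    (Continuous.locallyIntegrable (by fun_prop) |>.locallyIntegrableOn _) hx hx1
    (by
      have : Tendsto (fun t : ℝ => Real.exp (-t)) (𝓝 0) (𝓝 (Real.exp (-0))) :=
        (by fun_prop : Continuous fun t : ℝ => Real.exp (-t)).tendsto 0
      rw [neg_zero, Real.exp_zero] at this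
      exact this.mono_left nhdsWithin_le_nhds)
    Real.tendsto_exp_neg_atTop_nhds_zero hint
  rw [setIntegral_congr_fun measurableSet_Ioi heq,
    integral_sub, integral_add (i0.const_mul (1 / 2)) (i1.const_mul (1 / 2)), integral_sub k0 k1,
    integral_const_mul, integral_const_mul, integral_exp_neg_mul hx, integral_exp_neg_mul hx1] at hF
  rotate_left
  · exact (i0.const_mul (1 / 2)).add (i1.const_mul (1 / 2))
  · exact k0.sub k1
  simp only [smul_eq_mul, sub_zero, mul_one] at hF
  rw [← hF, binetIntegral, binetIntegral]
  field_simp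
  ring

/-- The real digamma function. -/
noncomputable def realDigamma (x : ℝ) : ℝ := deriv Real.Gamma x / Real.Gamma x

theorem ne_neg_natCast_of_pos {x : ℝ} (hx : 0 < x) (m : ℕ) : x ≠ -(m : ℝ) := by
  have : (0 : ℝ) ≤ m := Nat.cast_nonneg m
  intro h; linarith

theorem digamma_ofReal {x : ℝ} (hx : 0 < x) : Complex.digamma (x : ℂ) = (realDigamma x : ℂ) := by
  have h1 : HasDerivAt (fun y : ℝ => Complex.Gamma (y : ℂ)) (deriv Complex.Gamma (x : ℂ)) x := by
    refine HasDerivAt.comp_ofReal (DifferentiableAt.hasDerivAt ?_)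
    refine Complex.differentiableAt_Gamma _ fun m => ?_
    exact_mod_cast ne_neg_natCast_of_pos hx m
  have h2 : HasDerivAt (fun y : ℝ => (Real.Gamma y : ℂ)) ((deriv Real.Gamma x : ℝ) : ℂ) x :=
    (Real.differentiableAt_Gamma (ne_neg_natCast_of_pos hx)).hasDerivAt.ofReal_comp
  have h3 : deriv Complex.Gamma (x : ℂ) = ((deriv Real.Gamma x : ℝ) : ℂ) := by
    refine h1.unique ?_
    simpa [Complex.Gamma_ofReal] using h2
  rw [Complex.digamma_def, logDeriv_apply, h3, Complex.Gamma_ofReal, realDigamma]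
  push_cast; rfl

theorem realDigamma_add_one {x : ℝ} (hx : 0 < x) : realDigamma (x + 1) = realDigamma x + 1 / x := by
  have h := Complex.digamma_apply_add_one (x : ℂ) fun m => by
    exact_mod_cast ne_neg_natCast_of_pos hx m
  rw [digamma_ofReal hx, show (x : ℂ) + 1 = ((x + 1 : ℝ) : ℂ) by push_cast; rfl,
    digamma_ofReal (by linarith)] at h
  rw [one_div]
  exact_mod_cast h

theorem hasDerivAt_log_Gamma {x : ℝ} (hx : 0 < x) :
    HasDerivAt (Real.log ∘ Real.Gamma) (realDigamma x) x :=
  (Real.differentiableAt_Gamma (ne_neg_natCast_of_pos hx)).hasDerivAt.log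
    (Real.Gamma_pos_of_pos hx).ne'

theorem slope_log_Gamma {x : ℝ} (hx : 0 < x) :
    slope (Real.log ∘ Real.Gamma) x (x + 1) = Real.log x := by
  rw [slope_def_field]
  simp only [Function.comp_apply, add_sub_cancel_left, div_one]
  rw [Real.Gamma_add_one hx.ne', Real.log_mul hx.ne' (Real.Gamma_pos_of_pos hx).ne']
  ring

/-- Convexity of `log Γ`: its slope over `[x, x+1]`, which is `log x`, lies between `ψ(x)` and
`ψ(x+1) = ψ(x) + 1/x`. -/
theorem abs_realDigamma_sub_log_le {x : ℝ} (hx : 0 < x) :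
    |realDigamma x - Real.log x| ≤ 1 / x := by
  have hx1 : 0 < x + 1 := by linarith
  have h1 := Real.convexOn_log_Gamma.le_slope_of_hasDerivAt (x := x) (y := x + 1) hx hx1
    (by linarith) (hasDerivAt_log_Gamma hx)
  have h2 := Real.convexOn_log_Gamma.slope_le_of_hasDerivAt (x := x) (y := x + 1) hx hx1
    (by linarith) (hasDerivAt_log_Gamma hx1)
  rw [slope_log_Gamma hx] at h1 h2
  rw [realDigamma_add_one hx] at h2
  rw [abs_le]
  constructor
  · linarith
  · have : 0 < 1 / x := by positivity
    linarith

/-- **Binet's first formula** for the digamma function on the positive reals. -/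
theorem realDigamma_eq_binet {x : ℝ} (hx : 0 < x) :
    realDigamma x = Real.log x - 1 / (2 * x) - binetIntegral x := by
  -- `D` has period `1` and is bounded by `2/y`; following it along `x + n` forces `D x = 0`.
  set D : ℝ → ℝ := fun x => realDigamma x - (Real.log x - 1 / (2 * x) - binetIntegral x) with hD
  have hper : ∀ y : ℝ, 0 < y → D (y + 1) = D y := by
    intro y hy
    have h1 := binetIntegral_sub hy
    rw [Real.log_div (by linarith) hy.ne'] at h1
    simp only [hD]
    rw [realDigamma_add_one hy]
    have : 1 / y = 1 / (2 * y) + 1 / (2 * y) := by field_simp; norm_num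
    linarith
  have hpern : ∀ n : ℕ, D (x + n) = D x := by
    intro n
    induction n with
    | zero => simp
    | succ n ih =>
      have : (0 : ℝ) < x + n := by positivity
      rw [← ih, ← hper _ this]; push_cast; ring_nf
  have hbd : ∀ y : ℝ, 0 < y → |D y| ≤ 2 / y := by
    intro y hy
    have h1 := abs_le.mp (abs_realDigamma_sub_log_le hy)
    have h2 := abs_le.mp (abs_binetIntegral_le hy)
    have h3 : 1 / y = 1 / (2 * y) + 1 / (2 * y) := by field_simp; norm_num
    have h4 : 2 / y = 1 / y + 1 / (2 * y) + 1 / (2 * y) := by field_simp; norm_num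
    have h5 : 0 < 1 / (2 * y) := by positivity
    rw [abs_le]
    simp only [hD]
    constructor <;> linarith [h1.1, h1.2, h2.1, h2.2]
  have hlim : Tendsto (fun n : ℕ => 2 / (x + n)) atTop (𝓝 0) :=
    tendsto_const_nhds.div_atTop
      (tendsto_atTop_add_const_left _ _ tendsto_natCast_atTop_atTop)
  have h0 : |D x| ≤ 0 := ge_of_tendsto' hlim fun n => by
    rw [← hpern n]; exact hbd _ (by positivity)
  have := abs_eq_zero.mp (le_antisymm h0 (abs_nonneg _))
  simp only [hD] at this
  linarith

/-! ### The Laplace transform `binetTerm` on the closed right half-plane -/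

/-- The second derivative of `t ↦ 2t / (1 + t²)`. -/
noncomputable def lorentzDeriv₂ (t : ℝ) : ℝ := 4 * t * (t ^ 2 - 3) / (1 + t ^ 2) ^ 3

theorem continuous_lorentzDeriv₂ : Continuous lorentzDeriv₂ := by
  unfold lorentzDeriv₂
  refine Continuous.div (by fun_prop) (by fun_prop) fun t => ?_
  positivity

theorem abs_lorentzDeriv₂_le (t : ℝ) : |lorentzDeriv₂ t| ≤ 12 * (1 + t ^ 2)⁻¹ := by
  have h0 : 0 < 1 + t ^ 2 := by positivity
  rw [lorentzDeriv₂, abs_div, abs_of_pos (pow_pos h0 3), ← div_eq_mul_inv,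
    div_le_div_iff₀ (pow_pos h0 3) h0, abs_mul, abs_mul, abs_of_pos (by norm_num : (0 : ℝ) < 4)]
  have h1 : |t| ≤ 1 + t ^ 2 := by rw [abs_le]; constructor <;> nlinarith
  have h2 : |t ^ 2 - 3| ≤ 3 * (1 + t ^ 2) := by rw [abs_le]; constructor <;> nlinarith
  calc 4 * |t| * |t ^ 2 - 3| * (1 + t ^ 2) ≤ 4 * (1 + t ^ 2) * (3 * (1 + t ^ 2)) * (1 + t ^ 2) := by
        gcongr
    _ = 12 * (1 + t ^ 2) ^ 3 := by ring

/-- Differentiating the Laplace integral in `w` brings down a factor `t`, which this bound absorbs.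
-/
theorem abs_mul_lorentzDeriv₂_le (t : ℝ) : |t * lorentzDeriv₂ t| ≤ 12 := by
  have h0 : 0 < 1 + t ^ 2 := by positivity
  rw [lorentzDeriv₂, ← mul_div_assoc, abs_div, abs_of_pos (pow_pos h0 3),
    div_le_iff₀ (pow_pos h0 3)]
  rw [abs_le]
  constructor <;> nlinarith [sq_nonneg t, sq_nonneg (t ^ 2),
    mul_nonneg (sq_nonneg t) (sq_nonneg (t ^ 2))]

theorem integrable_lorentzDeriv₂ : Integrable lorentzDeriv₂ :=
  (integrable_inv_one_add_sq.const_mul 12).mono' continuous_lorentzDeriv₂.aestronglyMeasurable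
    (Eventually.of_forall fun t => by rw [Real.norm_eq_abs]; exact abs_lorentzDeriv₂_le t)

/-- The analytic function `∫_0^∞ 2y e^{-y} / (y² + w²) dy` of `w`, `Re w > 0`, in a form that makes
sense up to the imaginary axis. -/
noncomputable def binetTerm (w : ℂ) : ℂ :=
  (2 + ∫ t in Ioi (0 : ℝ), (lorentzDeriv₂ t : ℂ) * Complex.exp (-(w * t))) / w ^ 2

theorem norm_exp_neg_mul_le {w : ℂ} (hw : 0 ≤ w.re) {t : ℝ} (ht : 0 ≤ t) :
    ‖Complex.exp (-(w * t))‖ ≤ 1 := by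
  rw [Complex.norm_exp, Real.exp_le_one_iff]
  simp
  positivity

/-- A constant `C` with `|binetTerm w| ≤ C / |w|²` on the closed right half-plane. -/
noncomputable def binetConst : ℝ := 2 + ∫ t in Ioi (0 : ℝ), |lorentzDeriv₂ t|

theorem binetConst_nonneg : 0 ≤ binetConst := by
  have : 0 ≤ ∫ t in Ioi (0 : ℝ), |lorentzDeriv₂ t| := integral_nonneg fun t => abs_nonneg _
  rw [binetConst]; linarith

/-- The two integrations by parts have gained `w⁻²`, and `|e^{-wt}| ≤ 1` holds up to the imaginary
axis. Hence `∑ binetTerm (2πnz)` converges there as well. -/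
theorem norm_binetTerm_le {w : ℂ} (hw : 0 ≤ w.re) : ‖binetTerm w‖ ≤ binetConst / ‖w‖ ^ 2 := by
  rw [binetTerm, norm_div, norm_pow]
  gcongr
  refine (norm_add_le _ _).trans ?_
  rw [binetConst]
  gcongr
  · simp
  · refine norm_integral_le_of_norm_le integrable_lorentzDeriv₂.abs.integrableOn ?_
    refine (ae_restrict_mem measurableSet_Ioi).mono fun t ht => ?_
    rw [norm_mul, Complex.norm_real, Real.norm_eq_abs]
    exact mul_le_of_le_one_right (abs_nonneg _) (norm_exp_neg_mul_le hw (le_of_lt ht))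

/-- Dominated convergence with a majorant that does not depend on `w`. Including the boundary is
what allows limits onto the imaginary axis. -/
theorem continuousOn_binetTerm : ContinuousOn binetTerm {w | 0 ≤ w.re ∧ w ≠ 0} := by
  refine ContinuousOn.div (continuousOn_const.add ?_) (by fun_prop)
    fun w hw => pow_ne_zero 2 hw.2
  refine continuousOn_of_dominated (bound := fun t => |lorentzDeriv₂ t|) (fun w _ => ?_)
    (fun w hw => ?_) integrable_lorentzDeriv₂.abs.integrableOn ?_
  · have := continuous_lorentzDeriv₂
    exact Continuous.aestronglyMeasurable (by fun_prop)
  · refine (ae_restrict_mem measurableSet_Ioi).mono fun t ht => ?_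
    rw [norm_mul, Complex.norm_real, Real.norm_eq_abs]
    exact mul_le_of_le_one_right (abs_nonneg _) (norm_exp_neg_mul_le hw.1 (le_of_lt ht))
  · exact Eventually.of_forall fun t => by fun_prop

/-- The open right half-plane. -/
def rightHalfPlane : Set ℂ := {w | 0 < w.re}

theorem isOpen_rightHalfPlane : IsOpen rightHalfPlane :=
  isOpen_lt continuous_const Complex.continuous_re

theorem differentiableOn_binetTerm : DifferentiableOn ℂ binetTerm rightHalfPlane := by
  intro w₀ hw₀
  have hw₀' : 0 < w₀.re := hw₀
  refine DifferentiableAt.differentiableWithinAt ?_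
  have hne : w₀ ≠ 0 := by rintro rfl; simp at hw₀'
  refine DifferentiableAt.div (DifferentiableAt.const_add _ ?_) (by fun_prop) (pow_ne_zero 2 hne)
  have hs : {w : ℂ | w₀.re / 2 < w.re} ∈ 𝓝 w₀ :=
    (isOpen_lt continuous_const Complex.continuous_re).mem_nhds (by simp; linarith)
  have hcont := continuous_lorentzDeriv₂
  refine (hasDerivAt_integral_of_dominated_loc_of_deriv_le (𝕜 := ℂ)
    (F := fun w t => (lorentzDeriv₂ t : ℂ) * Complex.exp (-(w * t)))
    (F' := fun w t => (lorentzDeriv₂ t : ℂ) * (Complex.exp (-(w * t)) * (-(t : ℂ))))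
    (bound := fun t => 12 * Real.exp (-(w₀.re / 2 * t))) hs ?_ ?_ ?_ ?_ ?_ ?_).2.differentiableAt
  · exact Eventually.of_forall fun w => Continuous.aestronglyMeasurable (by fun_prop)
  · refine Integrable.mono' integrable_lorentzDeriv₂.abs.integrableOn
      (Continuous.aestronglyMeasurable (by fun_prop)) ?_
    refine (ae_restrict_mem measurableSet_Ioi).mono fun t ht => ?_
    rw [norm_mul, Complex.norm_real, Real.norm_eq_abs]
    exact mul_le_of_le_one_right (abs_nonneg _) (norm_exp_neg_mul_le hw₀'.le (le_of_lt ht))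
  · exact Continuous.aestronglyMeasurable (by fun_prop)
  · refine (ae_restrict_mem measurableSet_Ioi).mono fun t ht w hw => ?_
    have ht' : (0 : ℝ) < t := ht
    have hw' : w₀.re / 2 < w.re := hw
    have e : ‖(lorentzDeriv₂ t : ℂ) * (Complex.exp (-(w * t)) * (-(t : ℂ)))‖ =
        |t * lorentzDeriv₂ t| * Real.exp (-(w.re * t)) := by
      rw [norm_mul, norm_mul, norm_neg, Complex.norm_real, Complex.norm_real, Complex.norm_exp,
        abs_mul, Real.norm_eq_abs, Real.norm_eq_abs]
      simp
      ring
    rw [e]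
    gcongr
    exact abs_mul_lorentzDeriv₂_le t
  · exact (integrableOn_exp_neg_mul (by linarith : 0 < w₀.re / 2)).const_mul 12
  · refine Eventually.of_forall fun t w _ => ?_
    refine HasDerivAt.const_mul _ ?_
    have : HasDerivAt (fun w : ℂ => -(w * t)) (-(t : ℂ)) w := by
      simpa using ((hasDerivAt_id w).mul_const (t : ℂ)).fun_neg
    exact this.cexp

/-- Two functions that are holomorphic on the right half-plane and agree on the positive reals
are equal. -/
theorem eqOn_rightHalfPlane {f g : ℂ → ℂ} (hf : DifferentiableOn ℂ f rightHalfPlane)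
    (hg : DifferentiableOn ℂ g rightHalfPlane) (hfg : ∀ x : ℝ, 0 < x → f x = g x) :
    EqOn f g rightHalfPlane := by
  have hconv : Convex ℝ rightHalfPlane := convex_halfSpace_re_gt 0
  refine (hf.analyticOnNhd isOpen_rightHalfPlane).eqOn_of_preconnected_of_frequently_eq
    (hg.analyticOnNhd isOpen_rightHalfPlane) hconv.isPreconnected (z₀ := 1)
    (by simp [rightHalfPlane]) ?_
  have ht : Tendsto (fun x : ℝ => (x : ℂ)) (𝓝[≠] 1) (𝓝[≠] 1) := by
    refine tendsto_nhdsWithin_iff.mpr ⟨?_, ?_⟩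
    · have : Tendsto (fun x : ℝ => (x : ℂ)) (𝓝 1) (𝓝 ((1 : ℝ) : ℂ)) :=
        Complex.continuous_ofReal.tendsto 1
      rw [Complex.ofReal_one] at this
      exact this.mono_left nhdsWithin_le_nhds
    · filter_upwards [self_mem_nhdsWithin] with x hx
      simpa using hx
  refine ht.frequently (Eventually.frequently ?_)
  have : ∀ᶠ x : ℝ in 𝓝[≠] 1, 0 < x := nhdsWithin_le_nhds (lt_mem_nhds one_pos)
  exact this.mono hfg

theorem lorentz_le_one (t : ℝ) : |2 * t / (1 + t ^ 2)| ≤ 1 := by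
  have h0 : 0 < 1 + t ^ 2 := by positivity
  rw [abs_div, abs_of_pos h0, div_le_one h0, abs_le]
  constructor <;> nlinarith [sq_nonneg (t - 1), sq_nonneg (t + 1)]

theorem integrableOn_lorentz_mul_exp {x : ℝ} (hx : 0 < x) :
    IntegrableOn (fun t : ℝ => 2 * t / (1 + t ^ 2) * Real.exp (-(x * t))) (Ioi 0) := by
  refine Integrable.mono' (integrableOn_exp_neg_mul hx) ?_ (Eventually.of_forall fun t => ?_)
  · exact Measurable.aestronglyMeasurable (by fun_prop)
  · rw [norm_mul, Real.norm_eq_abs, Real.norm_of_nonneg (Real.exp_nonneg _)]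
    exact mul_le_of_le_one_left (Real.exp_nonneg _) (lorentz_le_one t)

theorem hasDerivAt_lorentz (t : ℝ) :
    HasDerivAt (fun t : ℝ => 2 * t / (1 + t ^ 2)) (2 * (1 - t ^ 2) / (1 + t ^ 2) ^ 2) t := by
  have h0 : 1 + t ^ 2 ≠ 0 := by positivity
  have h1 : HasDerivAt (fun t : ℝ => 2 * t) 2 t := by simpa using (hasDerivAt_id t).const_mul 2
  have h2 : HasDerivAt (fun t : ℝ => 1 + t ^ 2) (2 * t) t := by
    simpa using (hasDerivAt_pow 2 t).const_add 1
  convert! h1.div h2 h0 using 1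
  ring

theorem hasDerivAt_lorentzDeriv (t : ℝ) :
    HasDerivAt (fun t : ℝ => 2 * (1 - t ^ 2) / (1 + t ^ 2) ^ 2) (lorentzDeriv₂ t) t := by
  have h0 : (1 + t ^ 2) ^ 2 ≠ 0 := by positivity
  have h1 : HasDerivAt (fun t : ℝ => 2 * (1 - t ^ 2)) (2 * (-(2 * t))) t := by
    simpa using ((hasDerivAt_pow 2 t).const_sub 1).const_mul 2
  have h2 : HasDerivAt (fun t : ℝ => 1 + t ^ 2) (2 * t) t := by
    simpa using (hasDerivAt_pow 2 t).const_add 1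
  convert! h1.div (h2.fun_pow 2) h0 using 1
  rw [lorentzDeriv₂]
  field_simp
  push_cast
  ring

theorem abs_lorentzDeriv_le (t : ℝ) : |2 * (1 - t ^ 2) / (1 + t ^ 2) ^ 2| ≤ 2 := by
  have h0 : 0 < 1 + t ^ 2 := by positivity
  rw [abs_div, abs_of_pos (pow_pos h0 2), div_le_iff₀ (pow_pos h0 2), abs_le]
  constructor <;> nlinarith [sq_nonneg t, sq_nonneg (t ^ 2)]

/-- The Laplace transform form of `binetTerm` on the positive reals. -/
theorem binetTerm_ofReal {x : ℝ} (hx : 0 < x) :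
    binetTerm x = ((∫ t in Ioi (0 : ℝ), 2 * t / (1 + t ^ 2) * Real.exp (-(x * t)) : ℝ) : ℂ) := by
  have hint2 : IntegrableOn (fun t : ℝ => lorentzDeriv₂ t * Real.exp (-(x * t))) (Ioi 0) := by
    refine Integrable.mono' integrable_lorentzDeriv₂.abs.integrableOn
      (Continuous.aestronglyMeasurable (continuous_lorentzDeriv₂.mul (by fun_prop))) ?_
    refine (ae_restrict_mem measurableSet_Ioi).mono fun t ht => ?_
    have ht' : (0 : ℝ) < t := ht
    rw [norm_mul, Real.norm_eq_abs, Real.norm_of_nonneg (Real.exp_nonneg _)]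
    refine mul_le_of_le_one_right (abs_nonneg _) (Real.exp_le_one_iff.mpr ?_)
    have := mul_pos hx ht'
    linarith
  -- One primitive merges both integrations by parts. With `f(t) = 2t/(1+t²)` the values `f(0) = 0`
  -- and `f'(0) = 2` leave the boundary term `2/x²`.
  have hftc := integral_Ioi_of_hasDerivAt_of_tendsto' (a := 0) (m := 0)
    (f := fun t : ℝ => -((2 * t / (1 + t ^ 2) / x + 2 * (1 - t ^ 2) / (1 + t ^ 2) ^ 2 / x ^ 2) *
      Real.exp (-(x * t))))
    (f' := fun t : ℝ => 2 * t / (1 + t ^ 2) * Real.exp (-(x * t)) -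
      1 / x ^ 2 * (lorentzDeriv₂ t * Real.exp (-(x * t)))) ?_ ?_ ?_
  · rw [integral_sub (integrableOn_lorentz_mul_exp hx) (hint2.const_mul _),
      integral_const_mul] at hftc
    have e : (∫ t in Ioi (0 : ℝ), (lorentzDeriv₂ t : ℂ) * Complex.exp (-((x : ℂ) * t))) =
        ((∫ t in Ioi (0 : ℝ), lorentzDeriv₂ t * Real.exp (-(x * t)) : ℝ) : ℂ) := by
      rw [← integral_complex_ofReal]
      congr 1
      funext t
      push_cast
      rfl
    rw [binetTerm, e]
    norm_cast
    norm_num at hftc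
    have hx2 : x ^ 2 ≠ 0 := by positivity
    rw [div_eq_iff hx2]
    generalize ∫ t in Ioi (0 : ℝ), 2 * t / (1 + t ^ 2) * Real.exp (-(x * t)) = A at *
    generalize ∫ t in Ioi (0 : ℝ), lorentzDeriv₂ t * Real.exp (-(x * t)) = B at *
    field_simp at hftc
    linarith
  · intro t _
    have h1 : HasDerivAt (fun t : ℝ => Real.exp (-(x * t))) (Real.exp (-(x * t)) * (-x)) t := by
      have : HasDerivAt (fun t : ℝ => -(x * t)) (-x) t := by
        simpa using ((hasDerivAt_id t).const_mul x).fun_neg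
      exact this.exp
    have h2 := ((((hasDerivAt_lorentz t).div_const x).add
      ((hasDerivAt_lorentzDeriv t).div_const (x ^ 2))).mul h1).neg
    convert! h2 using 1
    simp only [Pi.add_apply]
    field_simp
    ring
  · exact (integrableOn_lorentz_mul_exp hx).sub (hint2.const_mul _)
  · refine squeeze_zero_norm (a := fun t : ℝ => (1 / x + 2 / x ^ 2) * Real.exp (-(x * t)))
      (fun t => ?_) ?_
    · rw [norm_neg, norm_mul, Real.norm_eq_abs, Real.norm_of_nonneg (Real.exp_nonneg _)]
      refine mul_le_mul_of_nonneg_right ((abs_add_le _ _).trans ?_) (Real.exp_nonneg _)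
      rw [abs_div, abs_div _ (x ^ 2), abs_of_pos hx, abs_of_pos (by positivity : 0 < x ^ 2)]
      gcongr
      · exact lorentz_le_one t
      · exact abs_lorentzDeriv_le t
    · have : Tendsto (fun t : ℝ => Real.exp (-(x * t))) atTop (𝓝 0) :=
        Real.tendsto_exp_neg_atTop_nhds_zero.comp (tendsto_id.const_mul_atTop hx)
      simpa using this.const_mul (1 / x + 2 / x ^ 2)

/-! ### Binet's formula on the right half-plane -/

theorem summable_const_div_sq (C : ℝ) : Summable fun n : ℕ => C / ((n : ℝ) + 1) ^ 2 := by
  have := (summable_nat_add_iff 1).mpr (Real.summable_one_div_nat_pow.mpr one_lt_two)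
  simpa [div_eq_mul_inv] using this.mul_left C

/-- The summands `binetTerm (2π(n+1)z)` of Binet's formula at `z`. -/
noncomputable def binetSeriesTerm (z : ℂ) (n : ℕ) : ℂ :=
  binetTerm (2 * Real.pi * ((n : ℂ) + 1) * z)

theorem re_scaled (z : ℂ) (n : ℕ) :
    (2 * Real.pi * ((n : ℂ) + 1) * z).re = 2 * Real.pi * ((n : ℝ) + 1) * z.re := by
  have : (2 * Real.pi * ((n : ℂ) + 1) * z) = ((2 * Real.pi * ((n : ℝ) + 1) : ℝ) : ℂ) * z := by
    push_cast; ring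
  rw [this, Complex.re_ofReal_mul]

theorem norm_scaled (z : ℂ) (n : ℕ) :
    ‖2 * Real.pi * ((n : ℂ) + 1) * z‖ = 2 * Real.pi * ((n : ℝ) + 1) * ‖z‖ := by
  have : (2 * Real.pi * ((n : ℂ) + 1) * z) = ((2 * Real.pi * ((n : ℝ) + 1) : ℝ) : ℂ) * z := by
    push_cast; ring
  have hp := Real.pi_pos
  rw [this, norm_mul, Complex.norm_real, Real.norm_of_nonneg (by positivity)]

theorem norm_binetSeriesTerm_le {z : ℂ} (hz : 0 ≤ z.re) (n : ℕ) :
    ‖binetSeriesTerm z n‖ ≤ binetConst / (2 * Real.pi * ‖z‖) ^ 2 / ((n : ℝ) + 1) ^ 2 := by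
  have hp := Real.pi_pos
  refine (norm_binetTerm_le ?_).trans (le_of_eq ?_)
  · rw [re_scaled]; positivity
  · rw [norm_scaled, div_div]; ring_nf

theorem summable_binetSeriesTerm {z : ℂ} (hz : 0 ≤ z.re) : Summable (binetSeriesTerm z) :=
  Summable.of_norm_bounded (summable_const_div_sq _) (norm_binetSeriesTerm_le hz)

/-- The substitution `t ↦ c_n t` with `c_n = 2π(n+1)` turns the terms into integrals of
`2t/(t²+c_n²) e^{-xt}`, whose sum under the integral is the expanded Binet kernel. The integrands
are nonnegative, so the summability needed for the exchange is that of the terms themselves. -/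
theorem hasSum_binetSeriesTerm_ofReal {x : ℝ} (hx : 0 < x) :
    HasSum (binetSeriesTerm x) (binetIntegral x : ℂ) := by
  have hpi := Real.pi_pos
  set c : ℕ → ℝ := fun n => 2 * Real.pi * ((n : ℝ) + 1) with hc
  have hcpos : ∀ n, 0 < c n := fun n => by simp only [hc]; positivity
  set f : ℕ → ℝ → ℝ := fun n t => 2 * t / (t ^ 2 + c n ^ 2) * Real.exp (-(x * t)) with hf
  have hscale : ∀ n (t : ℝ), 2 * t / (1 + t ^ 2) * Real.exp (-(c n * x * t)) =
      c n * f n (c n * t) := by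
    intro n t
    have h1 := hcpos n
    have h2 : (0 : ℝ) < 1 + t ^ 2 := by positivity
    simp only [hf]
    rw [show x * (c n * t) = c n * x * t by ring,
      show (c n * t) ^ 2 + c n ^ 2 = c n ^ 2 * (1 + t ^ 2) by ring]
    field_simp
  have hint : ∀ n, IntegrableOn (f n) (Ioi 0) := by
    intro n
    have h := integrableOn_lorentz_mul_exp (mul_pos (hcpos n) hx)
    simp only [hscale] at h
    have h' := (integrableOn_Ioi_comp_mul_left_iff (f n) 0 (hcpos n)).mp
      (IntegrableOn.congr_fun (h.const_mul (c n)⁻¹) (fun t _ =>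
        inv_mul_cancel_left₀ (hcpos n).ne' _) measurableSet_Ioi)
    simpa using h'
  have hval : ∀ n, binetSeriesTerm x n = ((∫ t in Ioi (0 : ℝ), f n t : ℝ) : ℂ) := by
    intro n
    have e : (2 * Real.pi * ((n : ℂ) + 1) * x : ℂ) = ((c n * x : ℝ) : ℂ) := by
      simp only [hc]; push_cast; ring
    rw [binetSeriesTerm, e, binetTerm_ofReal (mul_pos (hcpos n) hx)]
    simp only [hscale]
    rw [integral_const_mul, integral_comp_mul_left_Ioi _ _ (hcpos n), mul_zero, smul_eq_mul,
      mul_inv_cancel_left₀ (hcpos n).ne']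
  have hnn : ∀ n, ∀ t ∈ Ioi (0 : ℝ), 0 ≤ f n t := fun n t ht => by
    have : (0 : ℝ) < t := ht
    simp only [hf]; positivity
  have hnorm : ∀ n, ∫ t in Ioi (0 : ℝ), ‖f n t‖ = ∫ t in Ioi (0 : ℝ), f n t := fun n =>
    setIntegral_congr_fun measurableSet_Ioi fun t ht => Real.norm_of_nonneg (hnn n t ht)
  have hsum : Summable fun n => ∫ t in Ioi (0 : ℝ), ‖f n t‖ := by
    simp only [hnorm]
    have := summable_binetSeriesTerm (z := (x : ℂ)) (by simpa using hx.le)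
    rw [funext hval] at this
    exact Complex.summable_ofReal.mp this
  have h := hasSum_integral_of_summable_integral_norm (fun n => hint n) hsum
  rw [funext hval, Complex.hasSum_ofReal]
  convert! h using 1
  rw [binetIntegral]
  refine setIntegral_congr_fun measurableSet_Ioi fun t ht => ?_
  simp only [hf, tsum_mul_right]
  rw [(hasSum_binetKernel ht).tsum_eq]

/-- **Binet's formula** for the digamma function on the right half-plane. -/
theorem digamma_eq_binet {z : ℂ} (hz : 0 < z.re) :
    Complex.digamma z = Complex.log z - 1 / (2 * z) - ∑' n, binetSeriesTerm z n := by
  have hne : ∀ w ∈ rightHalfPlane, w ≠ 0 := by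
    rintro w hw rfl
    simp [rightHalfPlane] at hw
  have hU := isOpen_rightHalfPlane
  refine eqOn_rightHalfPlane (f := Complex.digamma)
    (g := fun z => Complex.log z - 1 / (2 * z) - ∑' n, binetSeriesTerm z n) ?_ ?_ ?_ hz
  · have hG : DifferentiableOn ℂ Complex.Gamma rightHalfPlane := fun w hw =>
      (Complex.differentiableAt_Gamma w fun m h => by
        have : (0 : ℝ) < w.re := hw
        rw [h] at this
        simp at this
        have h0 : (0 : ℝ) ≤ m := Nat.cast_nonneg m
        linarith).differentiableWithinAt
    have : DifferentiableOn ℂ (fun w => deriv Complex.Gamma w / Complex.Gamma w)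
        rightHalfPlane :=
      (hG.deriv hU).div hG fun w hw => Complex.Gamma_ne_zero_of_re_pos hw
    exact this
  · refine DifferentiableOn.sub (DifferentiableOn.sub ?_ ?_) ?_
    · exact fun w hw => (Complex.differentiableAt_log (Or.inl hw)).differentiableWithinAt
    · refine DifferentiableOn.div (by fun_prop) (by fun_prop) fun w hw => ?_
      exact mul_ne_zero two_ne_zero (hne w hw)
    · intro w₀ hw₀
      have hw₀' : 0 < w₀.re := hw₀
      have hV : IsOpen {w : ℂ | w₀.re / 2 < w.re} :=
        isOpen_lt continuous_const Complex.continuous_re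
      have hmem : {w : ℂ | w₀.re / 2 < w.re} ∈ 𝓝 w₀ := hV.mem_nhds (by simp; linarith)
      refine DifferentiableAt.differentiableWithinAt (DifferentiableOn.differentiableAt ?_ hmem)
      -- Weierstrass test on a half-plane around `w₀`: there `‖w‖` stays above `w₀.re / 2`.
      refine Complex.differentiableOn_tsum_of_summable_norm (F := fun n z => binetSeriesTerm z n)
        (u := fun n : ℕ => binetConst / (2 * Real.pi * (w₀.re / 2)) ^ 2 / ((n : ℝ) + 1) ^ 2)
        (summable_const_div_sq _) (fun n => ?_) hV fun n w hw => ?_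
      · refine differentiableOn_binetTerm.comp (by fun_prop) fun w hw => ?_
        have hw' : w₀.re / 2 < w.re := hw
        have hp := Real.pi_pos
        change 0 < (2 * Real.pi * ((n : ℂ) + 1) * w).re
        rw [re_scaled]
        have : 0 < w.re := by linarith
        positivity
      · have hw' : w₀.re / 2 < w.re := hw
        have hp := Real.pi_pos
        refine (norm_binetSeriesTerm_le (by linarith) n).trans ?_
        have h1 : w₀.re / 2 ≤ ‖w‖ := hw'.le.trans (Complex.re_le_norm w)
        have := binetConst_nonneg
        gcongr
  · intro x hx
    rw [(hasSum_binetSeriesTerm_ofReal hx).tsum_eq, digamma_ofReal hx, realDigamma_eq_binet hx,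
      Complex.ofReal_sub, Complex.ofReal_sub, Complex.ofReal_log hx.le]
    push_cast
    rfl

/-! ### Integral representations of `binetTerm` -/

theorem integrableOn_pow_mul_exp_neg (k : ℕ) :
    IntegrableOn (fun y : ℝ => y ^ k * Real.exp (-y)) (Ioi 0) := by
  have := Real.GammaIntegral_convergent (s := k + 1) (by positivity)
  refine this.congr_fun (fun y _ => ?_) measurableSet_Ioi
  simp [mul_comm]

theorem integral_pow_mul_exp_neg (k : ℕ) :
    ∫ y in Ioi (0 : ℝ), y ^ k * Real.exp (-y) = (k.factorial : ℝ) := by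
  rw [← Real.Gamma_nat_eq_factorial, Real.Gamma_eq_integral (by positivity)]
  refine setIntegral_congr_fun measurableSet_Ioi fun y _ => ?_
  simp [mul_comm]

theorem tendsto_pow_mul_exp_neg (k : ℕ) :
    Tendsto (fun y : ℝ => y ^ k * Real.exp (-y)) atTop (𝓝 0) :=
  Real.tendsto_pow_mul_exp_neg_atTop_nhds_zero k

theorem norm_ofReal_exp_neg (y : ℝ) : ‖Complex.exp (-(y : ℂ))‖ = Real.exp (-y) := by
  rw [Complex.norm_exp]; simp

/-- Both factors of `y² + w² = (w + iy)(w - iy)` have real part `Re w`. The denominators thus stay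
away from zero uniformly in `y`. -/
theorem sq_re_le_norm_sq_add_sq (w : ℂ) (y : ℝ) : w.re ^ 2 ≤ ‖(y : ℂ) ^ 2 + w ^ 2‖ := by
  have e : (y : ℂ) ^ 2 + w ^ 2 = (w + y * Complex.I) * (w - y * Complex.I) := by
    ring_nf; rw [Complex.I_sq]; ring
  have h1 : |w.re| ≤ ‖w + y * Complex.I‖ := by
    simpa using Complex.abs_re_le_norm (w + y * Complex.I)
  have h2 : |w.re| ≤ ‖w - y * Complex.I‖ := by
    simpa using Complex.abs_re_le_norm (w - y * Complex.I)
  rw [e, norm_mul, ← sq_abs, sq]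
  exact mul_le_mul h1 h2 (abs_nonneg _) (norm_nonneg _)

theorem sq_add_sq_ne_zero {w : ℂ} (hw : w.re ≠ 0) (y : ℝ) : (y : ℂ) ^ 2 + w ^ 2 ≠ 0 := by
  have h := sq_re_le_norm_sq_add_sq w y
  have h2 : 0 < w.re ^ 2 := by positivity
  exact norm_pos_iff.mp (h2.trans_le h)

theorem continuous_inv_sq_add_sq {w : ℂ} (hw : w.re ≠ 0) :
    Continuous fun y : ℝ => ((y : ℂ) ^ 2 + w ^ 2)⁻¹ :=
  Continuous.inv₀ (by fun_prop) fun y => sq_add_sq_ne_zero hw y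

theorem norm_inv_sq_add_sq_le {w : ℂ} (hw : w.re ≠ 0) (y : ℝ) :
    ‖((y : ℂ) ^ 2 + w ^ 2)⁻¹‖ ≤ (w.re ^ 2)⁻¹ := by
  rw [norm_inv]
  have h2 : 0 < w.re ^ 2 := by positivity
  exact inv_anti₀ h2 (sq_re_le_norm_sq_add_sq w y)

theorem norm_ofReal_of_pos {y : ℝ} (hy : 0 < y) : ‖(y : ℂ)‖ = y := by
  rw [Complex.norm_real, Real.norm_of_nonneg hy.le]

theorem integrableOn_binet_kernel {w : ℂ} (hw : w.re ≠ 0) :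
    IntegrableOn (fun y : ℝ => 2 * (y : ℂ) * Complex.exp (-(y : ℂ)) * ((y : ℂ) ^ 2 + w ^ 2)⁻¹)
      (Ioi 0) := by
  have hc := continuous_inv_sq_add_sq hw
  refine Integrable.mono' ((integrableOn_pow_mul_exp_neg 1).const_mul (2 * (w.re ^ 2)⁻¹))
    (Continuous.aestronglyMeasurable (by fun_prop)) ?_
  refine (ae_restrict_mem measurableSet_Ioi).mono fun y hy => ?_
  rw [norm_mul, norm_mul, norm_mul, norm_ofReal_of_pos hy, norm_ofReal_exp_neg]
  have h1 := norm_inv_sq_add_sq_le hw y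
  have hy' : (0 : ℝ) < y := hy
  calc ‖(2 : ℂ)‖ * y * Real.exp (-y) * ‖((y : ℂ) ^ 2 + w ^ 2)⁻¹‖
      ≤ ‖(2 : ℂ)‖ * y * Real.exp (-y) * (w.re ^ 2)⁻¹ := by gcongr
    _ = 2 * (w.re ^ 2)⁻¹ * (y ^ 1 * Real.exp (-y)) := by simp; ring

/-- `binetTerm` as the integral `∫_0^∞ 2y e^{-y} / (y² + w²) dy`. -/
theorem binetTerm_eq_integral {w : ℂ} (hw : 0 < w.re) : binetTerm w =
    ∫ y in Ioi (0 : ℝ), 2 * (y : ℂ) * Complex.exp (-(y : ℂ)) * ((y : ℂ) ^ 2 + w ^ 2)⁻¹ := by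
  -- Both sides are holomorphic in `w`, so the rescaling `y = xt` is needed for real `w = x` only
  -- and no contour is rotated.
  refine eqOn_rightHalfPlane (f := binetTerm) (g := fun w => ∫ y in Ioi (0 : ℝ),
    2 * (y : ℂ) * Complex.exp (-(y : ℂ)) * ((y : ℂ) ^ 2 + w ^ 2)⁻¹)
    differentiableOn_binetTerm ?_ ?_ hw
  · intro w₀ hw₀
    have hw₀' : 0 < w₀.re := hw₀
    refine DifferentiableAt.differentiableWithinAt ?_
    have hs : {w : ℂ | w₀.re / 2 < w.re} ∩ Metric.ball w₀ 1 ∈ 𝓝 w₀ :=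
      inter_mem ((isOpen_lt continuous_const Complex.continuous_re).mem_nhds (by simp; linarith))
        (Metric.ball_mem_nhds _ one_pos)
    have hre : ∀ᶠ w in 𝓝 w₀, w.re ≠ 0 := by
      filter_upwards [hs] with w hw
      have : w₀.re / 2 < w.re := hw.1
      linarith
    have hc0 := continuous_inv_sq_add_sq hw₀'.ne'
    refine (hasDerivAt_integral_of_dominated_loc_of_deriv_le (𝕜 := ℂ)
      (F := fun w (y : ℝ) => 2 * (y : ℂ) * Complex.exp (-(y : ℂ)) * ((y : ℂ) ^ 2 + w ^ 2)⁻¹)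
      (F' := fun w (y : ℝ) => 2 * (y : ℂ) * Complex.exp (-(y : ℂ)) *
        (-(2 * w) * (((y : ℂ) ^ 2 + w ^ 2)⁻¹) ^ 2))
      (bound := fun y => 2 * (2 * (‖w₀‖ + 1) * (((w₀.re / 2) ^ 2)⁻¹) ^ 2) *
        (y ^ 1 * Real.exp (-y)))
      hs ?_ ?_ ?_ ?_ ?_ ?_).2.differentiableAt
    · filter_upwards [hre] with w hw
      have hc := continuous_inv_sq_add_sq hw
      exact Continuous.aestronglyMeasurable (by fun_prop)
    · exact integrableOn_binet_kernel hw₀'.ne'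
    · exact Continuous.aestronglyMeasurable (by fun_prop)
    · refine (ae_restrict_mem measurableSet_Ioi).mono fun y hy w hw => ?_
      have h1 : w₀.re / 2 < w.re := hw.1
      have h2 : ‖w‖ ≤ ‖w₀‖ + 1 := by
        have := norm_sub_norm_le w w₀
        have h3 : ‖w - w₀‖ < 1 := by simpa [dist_eq_norm] using hw.2
        linarith
      have hwre : w.re ≠ 0 := by linarith
      have h4 : ‖((y : ℂ) ^ 2 + w ^ 2)⁻¹‖ ≤ ((w₀.re / 2) ^ 2)⁻¹ := by
        refine (norm_inv_sq_add_sq_le hwre y).trans ?_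
        gcongr
      have hy' : (0 : ℝ) < y := hy
      rw [norm_mul, norm_mul, norm_mul, norm_mul, norm_neg, norm_mul, norm_pow,
        norm_ofReal_of_pos hy, norm_ofReal_exp_neg]
      have h5 : ‖(2 : ℂ)‖ = 2 := by simp
      rw [h5]
      calc 2 * y * Real.exp (-y) * (2 * ‖w‖ * ‖((y : ℂ) ^ 2 + w ^ 2)⁻¹‖ ^ 2)
          ≤ 2 * y * Real.exp (-y) * (2 * (‖w₀‖ + 1) * (((w₀.re / 2) ^ 2)⁻¹) ^ 2) := by gcongr
        _ = _ := by ring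
    · exact (integrableOn_pow_mul_exp_neg 1).const_mul _
    · refine Eventually.of_forall fun y w hw => ?_
      have h1 : w₀.re / 2 < w.re := hw.1
      have hwre : w.re ≠ 0 := by linarith
      refine HasDerivAt.const_mul _ ?_
      have h2 : HasDerivAt (fun w : ℂ => (y : ℂ) ^ 2 + w ^ 2) (2 * w) w := by
        simpa using (hasDerivAt_pow 2 w).const_add ((y : ℂ) ^ 2)
      convert! h2.fun_inv (sq_add_sq_ne_zero hwre y) using 1
      rw [inv_pow, div_eq_mul_inv]
  · intro x hx
    rw [binetTerm_ofReal hx]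
    have h1 := integral_comp_mul_left_Ioi
      (fun y : ℝ => 2 * y * Real.exp (-y) * (y ^ 2 + x ^ 2)⁻¹) 0 hx
    have h2 : ∫ t in Ioi (0 : ℝ), 2 * t / (1 + t ^ 2) * Real.exp (-(x * t)) =
        ∫ y in Ioi (0 : ℝ), 2 * y * Real.exp (-y) * (y ^ 2 + x ^ 2)⁻¹ := by
      rw [mul_zero, smul_eq_mul, eq_inv_mul_iff_mul_eq₀ hx.ne'] at h1
      rw [← h1, ← integral_const_mul]
      refine setIntegral_congr_fun measurableSet_Ioi fun t _ => ?_
      have h3 : 1 + t ^ 2 ≠ 0 := by positivity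
      have h4 : (x * t) ^ 2 + x ^ 2 = x ^ 2 * (1 + t ^ 2) := by ring
      rw [h4]
      field_simp
    rw [h2, ← integral_complex_ofReal]
    simp

theorem hasDerivAt_ofReal_exp_neg (y : ℝ) :
    HasDerivAt (fun y : ℝ => Complex.exp (-(y : ℂ))) (-Complex.exp (-(y : ℂ))) y := by
  have h : HasDerivAt (fun y : ℂ => Complex.exp (-y)) (-Complex.exp (-(y : ℂ))) (y : ℂ) := by
    simpa using (hasDerivAt_id (y : ℂ)).fun_neg.cexp
  exact h.comp_ofReal

theorem hasDerivAt_ofReal_sq (y : ℝ) :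
    HasDerivAt (fun y : ℝ => (y : ℂ) ^ 2) (2 * (y : ℂ)) y := by
  have h : HasDerivAt (fun y : ℂ => y ^ 2) (2 * (y : ℂ)) (y : ℂ) := by
    simpa using hasDerivAt_pow 2 (y : ℂ)
  exact h.comp_ofReal

/-- The integrand of `binetTerm` after one integration by parts. -/
noncomputable def binetKernelDeriv (w : ℂ) (y : ℝ) : ℂ :=
  2 * (w ^ 2 - (y : ℂ) ^ 2) * ((y : ℂ) ^ 2 + w ^ 2)⁻¹ ^ 2

theorem norm_binetKernelDeriv_le {w : ℂ} (hw : w.re ≠ 0) (y : ℝ) :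
    ‖binetKernelDeriv w y‖ ≤ 4 * ‖w‖ ^ 2 * ((w.re ^ 2)⁻¹) ^ 2 + 2 * (w.re ^ 2)⁻¹ := by
  have h0 := sq_add_sq_ne_zero hw y
  have e : binetKernelDeriv w y = 4 * w ^ 2 * ((y : ℂ) ^ 2 + w ^ 2)⁻¹ ^ 2
      - 2 * ((y : ℂ) ^ 2 + w ^ 2)⁻¹ := by
    rw [binetKernelDeriv]; field_simp; ring
  rw [e]
  refine (norm_sub_le _ _).trans ?_
  rw [norm_mul, norm_mul, norm_mul, norm_pow, norm_pow]
  have h1 := norm_inv_sq_add_sq_le hw y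
  have h4 : ‖(4 : ℂ)‖ = 4 := by simp
  have h2 : ‖(2 : ℂ)‖ = 2 := by simp
  rw [h4, h2]
  gcongr

theorem continuous_binetKernelDeriv {w : ℂ} (hw : w.re ≠ 0) :
    Continuous (binetKernelDeriv w) := by
  have hc := continuous_inv_sq_add_sq hw
  unfold binetKernelDeriv
  fun_prop

theorem integrableOn_exp_neg_mul_of_bounded {f : ℝ → ℂ} (hf : Continuous f) {C : ℝ}
    (hC : ∀ y, ‖f y‖ ≤ C) : IntegrableOn (fun y : ℝ => Complex.exp (-(y : ℂ)) * f y) (Ioi 0) := by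
  refine Integrable.mono' ((integrableOn_pow_mul_exp_neg 0).const_mul C)
    (Continuous.aestronglyMeasurable (by fun_prop)) (Eventually.of_forall fun y => ?_)
  rw [norm_mul, norm_ofReal_exp_neg, pow_zero, one_mul, mul_comm]
  exact mul_le_mul_of_nonneg_right (hC y) (Real.exp_nonneg _)

theorem integrableOn_binetKernelDeriv {w : ℂ} (hw : w.re ≠ 0) :
    IntegrableOn (fun y : ℝ => Complex.exp (-(y : ℂ)) * binetKernelDeriv w y) (Ioi 0) :=
  integrableOn_exp_neg_mul_of_bounded (continuous_binetKernelDeriv hw)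
    (norm_binetKernelDeriv_le hw)

/-- Integration by parts without boundary terms, since `2y/(y²+w²)` vanishes at `0` and the
exponential kills it at infinity. The new kernel is a combination of `(y²+w²)⁻¹` and `(y²+w²)⁻²`
with constant coefficients, the shape of the remainder for `N = 1`. -/
theorem binetTerm_eq_integral_deriv {w : ℂ} (hw : 0 < w.re) : binetTerm w =
    ∫ y in Ioi (0 : ℝ), Complex.exp (-(y : ℂ)) * binetKernelDeriv w y := by
  have hne := hw.ne'
  have hftc := integral_Ioi_of_hasDerivAt_of_tendsto' (a := 0) (m := 0)
    (f := fun y : ℝ => Complex.exp (-(y : ℂ)) * (2 * (y : ℂ) * ((y : ℂ) ^ 2 + w ^ 2)⁻¹))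
    (f' := fun y : ℝ => Complex.exp (-(y : ℂ)) * binetKernelDeriv w y -
      2 * (y : ℂ) * Complex.exp (-(y : ℂ)) * ((y : ℂ) ^ 2 + w ^ 2)⁻¹) ?_ ?_ ?_
  · rw [integral_sub (integrableOn_binetKernelDeriv hne) (integrableOn_binet_kernel hne),
      ← binetTerm_eq_integral hw] at hftc
    simp at hftc
    exact (sub_eq_zero.mp hftc).symm
  · intro y _
    have h0 := sq_add_sq_ne_zero hne y
    have h1 : HasDerivAt (fun y : ℝ => (y : ℂ) ^ 2 + w ^ 2) (2 * (y : ℂ)) y :=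
      (hasDerivAt_ofReal_sq y).add_const _
    have h2 : HasDerivAt (fun y : ℝ => 2 * (y : ℂ)) 2 y := by
      simpa using (hasDerivAt_id (y : ℂ)).comp_ofReal.const_mul 2
    convert! (hasDerivAt_ofReal_exp_neg y).mul (h2.mul (h1.fun_inv h0)) using 1
    rw [binetKernelDeriv]
    simp only [Pi.mul_apply]
    field_simp
    ring
  · exact (integrableOn_binetKernelDeriv hne).sub (integrableOn_binet_kernel hne)
  · refine squeeze_zero_norm' (a := fun y : ℝ => 2 * (w.re ^ 2)⁻¹ * (y ^ 1 * Real.exp (-y)))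
      ?_ (by simpa using (tendsto_pow_mul_exp_neg 1).const_mul (2 * (w.re ^ 2)⁻¹))
    filter_upwards [eventually_gt_atTop 0] with y hy
    rw [norm_mul, norm_mul, norm_mul, norm_ofReal_of_pos hy, norm_ofReal_exp_neg]
    have h1 := norm_inv_sq_add_sq_le hne y
    have h2 : ‖(2 : ℂ)‖ = 2 := by simp
    rw [h2]
    calc Real.exp (-y) * (2 * y * ‖((y : ℂ) ^ 2 + w ^ 2)⁻¹‖)
        ≤ Real.exp (-y) * (2 * y * (w.re ^ 2)⁻¹) := by gcongr
      _ = _ := by ring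

/-- If `1 + y²/w²` were real and at most `0`, then `w²` would be a negative real and `w` purely
imaginary. Hence the principal logarithm is smooth along the whole path of integration. -/
theorem one_add_div_sq_mem_slitPlane {w : ℂ} (hw : 0 < w.re) (y : ℝ) :
    1 + (y : ℂ) ^ 2 / w ^ 2 ∈ Complex.slitPlane := by
  have hw0 : w ≠ 0 := by rintro rfl; simp at hw
  rw [Complex.mem_slitPlane_iff_not_le_zero]
  intro hle
  obtain ⟨hre, him⟩ := Complex.le_def.mp hle
  set u := 1 + (y : ℂ) ^ 2 / w ^ 2 with hu
  have hu' : u = (u.re : ℂ) := by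
    apply Complex.ext <;> simp [him]
  simp only [Complex.zero_re] at hre
  have h1 : (y : ℂ) ^ 2 = ((u.re - 1 : ℝ) : ℂ) * w ^ 2 := by
    push_cast
    rw [← hu', hu]
    field_simp
    ring
  have h2 : (y : ℂ) ^ 2 = ((y ^ 2 : ℝ) : ℂ) := by push_cast; rfl
  rw [h2] at h1
  have hr := congrArg Complex.re h1
  have hi := congrArg Complex.im h1
  rw [Complex.ofReal_re, Complex.re_ofReal_mul] at hr
  rw [Complex.ofReal_im, Complex.im_ofReal_mul] at hi
  rw [sq w, Complex.mul_re] at hr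
  rw [sq w, Complex.mul_im] at hi
  have h3 : u.re - 1 ≠ 0 := by linarith
  have h4 : w.im = 0 := by
    have : w.re * w.im + w.im * w.re = 0 := by
      rcases mul_eq_zero.mp hi.symm with h | h
      · exact absurd h h3
      · exact h
    have h5 : w.re * w.im = 0 := by linarith
    exact (mul_eq_zero.mp h5).resolve_left hw.ne'
  rw [h4] at hr
  nlinarith [sq_nonneg y, mul_pos hw hw]

theorem norm_log_le (u : ℂ) : ‖Complex.log u‖ ≤ |Real.log ‖u‖| + Real.pi := by
  have h := Complex.norm_le_abs_re_add_abs_im (Complex.log u)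
  rw [Complex.log_re, Complex.log_im] at h
  exact h.trans (by gcongr; exact Complex.abs_arg_le_pi u)

theorem abs_log_le_add_inv {x : ℝ} (hx : 0 < x) : |Real.log x| ≤ x + x⁻¹ := by
  have h1 := Real.log_le_sub_one_of_pos hx
  have h2 := Real.one_sub_inv_le_log_of_pos hx
  have h3 : 0 < x⁻¹ := inv_pos.mpr hx
  rw [abs_le]; constructor <;> linarith

theorem norm_log_one_add_le {w : ℂ} (hw : 0 < w.re) (y : ℝ) :
    ‖Complex.log (1 + (y : ℂ) ^ 2 / w ^ 2)‖ ≤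
      1 + y ^ 2 / ‖w‖ ^ 2 + ‖w‖ ^ 2 / w.re ^ 2 + Real.pi := by
  have hw0 : w ≠ 0 := by rintro rfl; simp at hw
  have hn : 0 < ‖w‖ := norm_pos_iff.mpr hw0
  have h0 : 1 + (y : ℂ) ^ 2 / w ^ 2 ≠ 0 :=
    Complex.slitPlane_ne_zero (one_add_div_sq_mem_slitPlane hw y)
  have e : 1 + (y : ℂ) ^ 2 / w ^ 2 = ((y : ℂ) ^ 2 + w ^ 2) / w ^ 2 := by field_simp; ring
  have h1 : ‖1 + (y : ℂ) ^ 2 / w ^ 2‖ ≤ 1 + y ^ 2 / ‖w‖ ^ 2 := by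
    refine (norm_add_le _ _).trans (le_of_eq ?_)
    simp
  have h2 : ‖1 + (y : ℂ) ^ 2 / w ^ 2‖⁻¹ ≤ ‖w‖ ^ 2 / w.re ^ 2 := by
    rw [e, norm_div, inv_div, norm_pow]
    gcongr
    exact sq_re_le_norm_sq_add_sq w y
  have h3 := abs_log_le_add_inv (norm_pos_iff.mpr h0)
  have h4 := norm_log_le (1 + (y : ℂ) ^ 2 / w ^ 2)
  linarith

theorem continuous_log_one_add {w : ℂ} (hw : 0 < w.re) :
    Continuous fun y : ℝ => Complex.log (1 + (y : ℂ) ^ 2 / w ^ 2) :=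
  Continuous.clog (by fun_prop) fun y => one_add_div_sq_mem_slitPlane hw y

theorem integrableOn_exp_neg_mul_log {w : ℂ} (hw : 0 < w.re) :
    IntegrableOn (fun y : ℝ => Complex.exp (-(y : ℂ)) * Complex.log (1 + (y : ℂ) ^ 2 / w ^ 2))
      (Ioi 0) := by
  have hc := continuous_log_one_add hw
  refine Integrable.mono' (((integrableOn_pow_mul_exp_neg 0).const_mul
    (1 + ‖w‖ ^ 2 / w.re ^ 2 + Real.pi)).add
    ((integrableOn_pow_mul_exp_neg 2).const_mul (‖w‖ ^ 2)⁻¹))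
    (Continuous.aestronglyMeasurable (by fun_prop)) (Eventually.of_forall fun y => ?_)
  rw [norm_mul, norm_ofReal_exp_neg]
  refine (mul_le_mul_of_nonneg_left (norm_log_one_add_le hw y) (Real.exp_nonneg _)).trans
    (le_of_eq ?_)
  simp only [Pi.add_apply]
  ring

/-- `binetTerm` as a logarithmic integral. -/
theorem binetTerm_eq_integral_log {w : ℂ} (hw : 0 < w.re) : binetTerm w =
    ∫ y in Ioi (0 : ℝ), Complex.exp (-(y : ℂ)) * Complex.log (1 + (y : ℂ) ^ 2 / w ^ 2) := by
  have hne := hw.ne'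
  have hw0 : w ≠ 0 := by rintro rfl; simp at hw
  have hftc := integral_Ioi_of_hasDerivAt_of_tendsto' (a := 0) (m := 0)
    (f := fun y : ℝ => Complex.exp (-(y : ℂ)) * Complex.log (1 + (y : ℂ) ^ 2 / w ^ 2))
    (f' := fun y : ℝ => 2 * (y : ℂ) * Complex.exp (-(y : ℂ)) * ((y : ℂ) ^ 2 + w ^ 2)⁻¹ -
      Complex.exp (-(y : ℂ)) * Complex.log (1 + (y : ℂ) ^ 2 / w ^ 2)) ?_ ?_ ?_
  · rw [integral_sub (integrableOn_binet_kernel hne) (integrableOn_exp_neg_mul_log hw),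
      ← binetTerm_eq_integral hw] at hftc
    simp at hftc
    exact sub_eq_zero.mp hftc
  · intro y _
    have h0 := sq_add_sq_ne_zero hne y
    have h1 : HasDerivAt (fun y : ℝ => 1 + (y : ℂ) ^ 2 / w ^ 2) (2 * (y : ℂ) / w ^ 2) y :=
      ((hasDerivAt_ofReal_sq y).div_const _).const_add 1
    have h2 := h1.clog_real (one_add_div_sq_mem_slitPlane hw y)
    convert! (hasDerivAt_ofReal_exp_neg y).mul h2 using 1
    have e : 1 + (y : ℂ) ^ 2 / w ^ 2 = ((y : ℂ) ^ 2 + w ^ 2) / w ^ 2 := by field_simp; ring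
    generalize Complex.log (1 + (y : ℂ) ^ 2 / w ^ 2) = L
    rw [e]
    field_simp
    ring
  · exact (integrableOn_binet_kernel hne).sub (integrableOn_exp_neg_mul_log hw)
  · refine squeeze_zero_norm (a := fun y : ℝ => (1 + ‖w‖ ^ 2 / w.re ^ 2 + Real.pi) *
      (y ^ 0 * Real.exp (-y)) + (‖w‖ ^ 2)⁻¹ * (y ^ 2 * Real.exp (-y))) (fun y => ?_)
      (by simpa using ((tendsto_pow_mul_exp_neg 0).const_mul
        (1 + ‖w‖ ^ 2 / w.re ^ 2 + Real.pi)).add ((tendsto_pow_mul_exp_neg 2).const_mul _))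
    rw [norm_mul, norm_ofReal_exp_neg]
    refine (mul_le_mul_of_nonneg_left (norm_log_one_add_le hw y) (Real.exp_nonneg _)).trans
      (le_of_eq ?_)
    ring

/-! ### Series and integrals in a Stokes sector, and their recurrence in `N` -/

theorem natCast_add_one_ne_zero' (n : ℕ) : (n : ℂ) + 1 ≠ 0 := Nat.cast_add_one_ne_zero n

theorem two_pi_ne_zero' : 2 * (Real.pi : ℂ) ≠ 0 :=
  mul_ne_zero two_ne_zero (by exact_mod_cast Real.pi_ne_zero)

theorem ne_zero_of_re_ne_zero {z : ℂ} (hz : z.re ≠ 0) : z ≠ 0 := by rintro rfl; simp at hz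

theorem scaled_re_ne_zero {z : ℂ} (hz : z.re ≠ 0) (n : ℕ) :
    (2 * Real.pi * ((n : ℂ) + 1) * z).re ≠ 0 := by
  rw [re_scaled]
  have := Real.pi_pos
  have : (0 : ℝ) < 2 * Real.pi * ((n : ℝ) + 1) := by positivity
  exact mul_ne_zero this.ne' hz

/-- Gives both families of terms the common denominator `y² + (2π(n+1)z)²`. Writing `N = K + 1`
makes the exponent `2N - 2 = 2K` natural. -/
theorem termSS_eq (K : ℕ) {z : ℂ} (hz : z.re ≠ 0) (y : ℝ) (n : ℕ) :
    termSS (K + 1) z y n = (2 * Real.pi * z) ^ 2 / ((n : ℂ) + 1) ^ (2 * K) *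
      ((y : ℂ) ^ 2 + (2 * Real.pi * ((n : ℂ) + 1) * z) ^ 2)⁻¹ := by
  have h0 := sq_add_sq_ne_zero (scaled_re_ne_zero hz n) y
  have h1 := natCast_add_one_ne_zero' n
  have h2 := two_pi_ne_zero'
  have h3 := ne_zero_of_re_ne_zero hz
  have e : ((y : ℂ) / (2 * Real.pi * z)) ^ 2 + ((n : ℂ) + 1) ^ 2 =
      ((y : ℂ) ^ 2 + (2 * Real.pi * ((n : ℂ) + 1) * z) ^ 2) / (2 * Real.pi * z) ^ 2 := by
    field_simp
  have hzp : (2 * ((K + 1 : ℕ) : ℤ) - 2) = ((2 * K : ℕ) : ℤ) := by push_cast; ring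
  rw [termSS, e, hzp, zpow_natCast]
  field_simp

/-- The exponent `2N - 4` is negative for `N = 1`, so it appears as a quotient of the powers `2` and
`2K`. -/
theorem termSqSS_eq (K : ℕ) {z : ℂ} (hz : z.re ≠ 0) (y : ℝ) (n : ℕ) :
    termSqSS (K + 1) z y n = ((n : ℂ) + 1) ^ 2 / ((n : ℂ) + 1) ^ (2 * K) *
      ((y : ℂ) ^ 2 + (2 * Real.pi * ((n : ℂ) + 1) * z) ^ 2)⁻¹ ^ 2 := by
  have h0 := sq_add_sq_ne_zero (scaled_re_ne_zero hz n) y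
  have h1 := natCast_add_one_ne_zero' n
  have e : (y : ℂ) ^ 2 + 4 * (Real.pi : ℂ) ^ 2 * ((n : ℂ) + 1) ^ 2 * z ^ 2 =
      (y : ℂ) ^ 2 + (2 * Real.pi * ((n : ℂ) + 1) * z) ^ 2 := by ring
  have hzp : (2 * ((K + 1 : ℕ) : ℤ) - 4) = ((2 * K : ℕ) : ℤ) - 2 := by push_cast; ring
  rw [termSqSS, e, hzp, zpow_sub₀ h1, zpow_natCast]
  norm_cast
  push_cast
  field_simp

theorem norm_inv_scaled_le {z : ℂ} (hz : z.re ≠ 0) (y : ℝ) (n : ℕ) :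
    ‖((y : ℂ) ^ 2 + (2 * Real.pi * ((n : ℂ) + 1) * z) ^ 2)⁻¹‖ ≤
      ((2 * Real.pi * z.re) ^ 2)⁻¹ / ((n : ℝ) + 1) ^ 2 := by
  refine (norm_inv_sq_add_sq_le (scaled_re_ne_zero hz n) y).trans (le_of_eq ?_)
  rw [re_scaled]
  field_simp

theorem norm_natCast_add_one (n : ℕ) : ‖(n : ℂ) + 1‖ = (n : ℝ) + 1 := by
  exact_mod_cast Complex.norm_natCast (n + 1)

theorem norm_termSS_le (K : ℕ) {z : ℂ} (hz : z.re ≠ 0) (y : ℝ) (n : ℕ) :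
    ‖termSS (K + 1) z y n‖ ≤
      ‖2 * Real.pi * z‖ ^ 2 * ((2 * Real.pi * z.re) ^ 2)⁻¹ / ((n : ℝ) + 1) ^ 2 := by
  rw [termSS_eq K hz, norm_mul, norm_div, norm_pow, norm_pow, norm_natCast_add_one]
  have h1 : (1 : ℝ) ≤ ((n : ℝ) + 1) ^ (2 * K) := one_le_pow₀ (by linarith [n.cast_nonneg (α := ℝ)])
  rw [mul_div_assoc]
  refine mul_le_mul (div_le_self (by positivity) h1) (norm_inv_scaled_le hz y n) (norm_nonneg _)
    (by positivity)

theorem norm_termSqSS_le (K : ℕ) {z : ℂ} (hz : z.re ≠ 0) (y : ℝ) (n : ℕ) :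
    ‖termSqSS (K + 1) z y n‖ ≤
      ((2 * Real.pi * z.re) ^ 2)⁻¹ ^ 2 / ((n : ℝ) + 1) ^ 2 := by
  rw [termSqSS_eq K hz, norm_mul, norm_div, norm_pow, norm_pow, norm_pow, norm_natCast_add_one]
  have h1 : (1 : ℝ) ≤ ((n : ℝ) + 1) ^ (2 * K) := one_le_pow₀ (by linarith [n.cast_nonneg (α := ℝ)])
  calc ((n : ℝ) + 1) ^ 2 / ((n : ℝ) + 1) ^ (2 * K) *
        ‖((y : ℂ) ^ 2 + (2 * Real.pi * ((n : ℂ) + 1) * z) ^ 2)⁻¹‖ ^ 2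
      ≤ ((n : ℝ) + 1) ^ 2 * (((2 * Real.pi * z.re) ^ 2)⁻¹ / ((n : ℝ) + 1) ^ 2) ^ 2 := by
        gcongr
        · exact div_le_self (by positivity) h1
        · exact norm_inv_scaled_le hz y n
    _ = _ := by field_simp

theorem summable_termSS (K : ℕ) {z : ℂ} (hz : z.re ≠ 0) (y : ℝ) :
    Summable (termSS (K + 1) z y) :=
  Summable.of_norm_bounded (summable_const_div_sq _) (norm_termSS_le K hz y)

theorem summable_termSqSS (K : ℕ) {z : ℂ} (hz : z.re ≠ 0) (y : ℝ) :
    Summable (termSqSS (K + 1) z y) :=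
  Summable.of_norm_bounded (summable_const_div_sq _) (norm_termSqSS_le K hz y)

theorem integrableOn_pow_mul_exp_neg_mul_tsum (K : ℕ) {f : ℝ → ℕ → ℂ}
    (hf : ∀ n, Continuous fun y => f y n) {C : ℝ}
    (hC : ∀ y n, ‖f y n‖ ≤ C / ((n : ℝ) + 1) ^ 2) :
    IntegrableOn (fun y : ℝ => (y : ℂ) ^ (2 * ((K + 1 : ℕ) : ℤ) - 2) * Complex.exp (-(y : ℂ)) *
      ∑' n, f y n) (Ioi 0) := by
  have hzp : (2 * ((K + 1 : ℕ) : ℤ) - 2) = ((2 * K : ℕ) : ℤ) := by push_cast; ring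
  simp only [hzp, zpow_natCast]
  have hs := summable_const_div_sq C
  have hc : Continuous fun y => ∑' n, f y n := continuous_tsum hf hs fun n y => hC y n
  refine Integrable.mono'
    ((integrableOn_pow_mul_exp_neg (2 * K)).const_mul (∑' n : ℕ, C / ((n : ℝ) + 1) ^ 2))
    (Continuous.aestronglyMeasurable (by fun_prop)) ?_
  refine (ae_restrict_mem measurableSet_Ioi).mono fun y hy => ?_
  rw [norm_mul, norm_mul, norm_pow, norm_ofReal_of_pos hy, norm_ofReal_exp_neg, mul_comm]
  have hy' : (0 : ℝ) < y := hy
  gcongr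
  exact tsum_of_norm_bounded hs.hasSum (hC y)

theorem integrableOn_integrandSS (K : ℕ) {z : ℂ} (hz : z.re ≠ 0) :
    IntegrableOn (integrandSS (K + 1) z) (Ioi 0) := by
  refine integrableOn_pow_mul_exp_neg_mul_tsum K (fun n => ?_) (norm_termSS_le K hz)
  have hc := continuous_inv_sq_add_sq (scaled_re_ne_zero hz n)
  simp only [termSS_eq K hz]
  fun_prop

theorem integrableOn_integrandSqSS (K : ℕ) {z : ℂ} (hz : z.re ≠ 0) :
    IntegrableOn (integrandSqSS (K + 1) z) (Ioi 0) := by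
  refine integrableOn_pow_mul_exp_neg_mul_tsum K (fun n => ?_) (norm_termSqSS_le K hz)
  have hc := continuous_inv_sq_add_sq (scaled_re_ne_zero hz n)
  simp only [termSqSS_eq K hz]
  fun_prop

theorem hasSum_zeta_even (K : ℕ) :
    HasSum (fun n : ℕ => 1 / ((n : ℂ) + 1) ^ (2 * (K + 1)))
      (riemannZeta (2 * ((K + 1 : ℕ) : ℂ))) := by
  have h1 : 1 < 2 * (K + 1) := by omega
  have h := zeta_nat_eq_tsum_of_gt_one h1
  have hs : Summable (fun n : ℕ => 1 / (n : ℂ) ^ (2 * (K + 1))) := by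
    have := Real.summable_one_div_nat_pow.mpr h1
    rw [← Complex.summable_ofReal] at this
    simpa using this
  have hs' := (summable_nat_add_iff 1).mpr hs
  have h2 := hs.tsum_eq_zero_add
  have h3 : riemannZeta (2 * ((K + 1 : ℕ) : ℂ)) = ∑' n : ℕ, 1 / ((n : ℂ) + 1) ^ (2 * (K + 1)) := by
    push_cast at h ⊢
    rw [h, h2]
    simp
  rw [h3]
  simpa using hs'.hasSum

/-- One step of a geometric expansion: with `X` the denominator, `y² = X - (2πz)²(n+1)²`. The part
with `X` cancels the denominator and sums to a zeta value; the other part is the integrand for the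
smaller `N`. -/
theorem integrandSS_succ (K : ℕ) {z : ℂ} (hz : z.re ≠ 0) {y : ℝ} (hy : 0 < y) :
    integrandSS (K + 2) z y = (2 * Real.pi * z) ^ 2 *
      (((y ^ (2 * K) * Real.exp (-y) : ℝ) : ℂ) * riemannZeta (2 * ((K + 1 : ℕ) : ℂ)) -
        integrandSS (K + 1) z y) := by
  have hyc : (y : ℂ) ≠ 0 := by exact_mod_cast hy.ne'
  have h1 : ∑' n, (y : ℂ) ^ 2 * termSS (K + 2) z y n = (2 * Real.pi * z) ^ 2 *
      (riemannZeta (2 * ((K + 1 : ℕ) : ℂ)) - ∑' n, termSS (K + 1) z y n) := by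
    rw [← (hasSum_zeta_even K).tsum_eq, ← (hasSum_zeta_even K).summable.tsum_sub
      (summable_termSS K hz y), ← tsum_mul_left]
    refine tsum_congr fun n => ?_
    rw [termSS_eq K hz, termSS_eq (K + 1) hz]
    have h0 := sq_add_sq_ne_zero (scaled_re_ne_zero hz n) y
    have h2 := natCast_add_one_ne_zero' n
    set X := (y : ℂ) ^ 2 + (2 * Real.pi * ((n : ℂ) + 1) * z) ^ 2 with hX
    have hy2 : (y : ℂ) ^ 2 = X - (2 * Real.pi * z) ^ 2 * ((n : ℂ) + 1) ^ 2 := by rw [hX]; ring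
    clear_value X
    rw [hy2]
    field_simp
    ring
  rw [tsum_mul_left] at h1
  have hz1 : (2 * ((K + 1 : ℕ) : ℤ) - 2) = ((2 * K : ℕ) : ℤ) := by push_cast; ring
  have hz2 : (2 * ((K + 2 : ℕ) : ℤ) - 2) = ((2 * K + 2 : ℕ) : ℤ) := by push_cast; ring
  rw [integrandSS, integrandSS, hz1, hz2, zpow_natCast, zpow_natCast]
  push_cast
  push_cast at h1
  rw [pow_add]
  linear_combination ((y : ℂ) ^ (2 * K) * Complex.exp (-(y : ℂ))) * h1

/-- The same substitution for `y²`; here cancelling one power of the squared denominator gives back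
the simple integrand. -/
theorem integrandSqSS_succ (K : ℕ) {z : ℂ} (hz : z.re ≠ 0) (y : ℝ) :
    integrandSqSS (K + 2) z y = ((2 * Real.pi * z) ^ 2)⁻¹ * integrandSS (K + 1) z y -
      (2 * Real.pi * z) ^ 2 * integrandSqSS (K + 1) z y := by
  have h1 : ∑' n, (y : ℂ) ^ 2 * termSqSS (K + 2) z y n =
      ((2 * Real.pi * z) ^ 2)⁻¹ * ∑' n, termSS (K + 1) z y n -
      (2 * Real.pi * z) ^ 2 * ∑' n, termSqSS (K + 1) z y n := by
    rw [← tsum_mul_left, ← tsum_mul_left, ← ((summable_termSS K hz y).mul_left _).tsum_sub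
      ((summable_termSqSS K hz y).mul_left _)]
    refine tsum_congr fun n => ?_
    rw [termSS_eq K hz, termSqSS_eq K hz, termSqSS_eq (K + 1) hz]
    have h0 := sq_add_sq_ne_zero (scaled_re_ne_zero hz n) y
    have h2 := natCast_add_one_ne_zero' n
    have h3 := mul_ne_zero two_pi_ne_zero' (ne_zero_of_re_ne_zero hz)
    set X := (y : ℂ) ^ 2 + (2 * Real.pi * ((n : ℂ) + 1) * z) ^ 2 with hX
    have hy2 : (y : ℂ) ^ 2 = X - (2 * Real.pi * z) ^ 2 * ((n : ℂ) + 1) ^ 2 := by rw [hX]; ring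
    clear_value X
    rw [hy2]
    generalize 2 * Real.pi * z = A at *
    field_simp
    ring
  rw [tsum_mul_left] at h1
  have hz1 : (2 * ((K + 1 : ℕ) : ℤ) - 2) = ((2 * K : ℕ) : ℤ) := by push_cast; ring
  have hz2 : (2 * ((K + 2 : ℕ) : ℤ) - 2) = ((2 * K + 2 : ℕ) : ℤ) := by push_cast; ring
  rw [integrandSqSS, integrandSS, integrandSqSS, hz1, hz2, zpow_natCast, zpow_natCast]
  rw [pow_add]
  linear_combination ((y : ℂ) ^ (2 * K) * Complex.exp (-(y : ℂ))) * h1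

theorem integral_integrandSS_succ (K : ℕ) {z : ℂ} (hz : z.re ≠ 0) :
    ∫ y in Ioi (0 : ℝ), integrandSS (K + 2) z y = (2 * Real.pi * z) ^ 2 *
      (((2 * K).factorial : ℂ) * riemannZeta (2 * ((K + 1 : ℕ) : ℂ)) -
        ∫ y in Ioi (0 : ℝ), integrandSS (K + 1) z y) := by
  rw [setIntegral_congr_fun measurableSet_Ioi fun y hy => integrandSS_succ K hz hy,
    integral_const_mul, integral_sub _ (integrableOn_integrandSS K hz), integral_mul_const,
    integral_complex_ofReal, integral_pow_mul_exp_neg, Complex.ofReal_natCast]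
  exact (integrableOn_pow_mul_exp_neg (2 * K)).ofReal.mul_const _

theorem integral_integrandSqSS_succ (K : ℕ) {z : ℂ} (hz : z.re ≠ 0) :
    ∫ y in Ioi (0 : ℝ), integrandSqSS (K + 2) z y =
      ((2 * Real.pi * z) ^ 2)⁻¹ * (∫ y in Ioi (0 : ℝ), integrandSS (K + 1) z y) -
      (2 * Real.pi * z) ^ 2 * ∫ y in Ioi (0 : ℝ), integrandSqSS (K + 1) z y := by
  rw [setIntegral_congr_fun measurableSet_Ioi fun y _ => integrandSqSS_succ K hz y,
    integral_sub ((integrableOn_integrandSS K hz).const_mul _)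
      ((integrableOn_integrandSqSS K hz).const_mul _), integral_const_mul, integral_const_mul]

/-- The value `c_{K+1}(1)` is a zeta value, and `Γ(2K+2) = (2K+1)(2K)!` is split so that `(2K)!`
matches the moment `∫ y^{2K} e^{-y} dy` produced by the recurrence of the integrals. -/
theorem truncatedSeries_succ (K : ℕ) (z : ℂ) :
    truncatedSeries (K + 2) z = truncatedSeries (K + 1) z -
      2 * (-1) ^ (K + 1) * ((2 * K + 1 : ℕ) * ((2 * K).factorial : ℂ)) *
        riemannZeta (2 * ((K + 1 : ℕ) : ℂ)) / (2 * Real.pi * z) ^ (2 * K + 2) := by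
  rw [truncatedSeries, truncatedSeries, Finset.sum_Ico_succ_top (by omega), cosecantPoly_one]
  have hG : Complex.Gamma (2 * ((K + 1 : ℕ) : ℂ)) = (2 * K + 1 : ℕ) * ((2 * K).factorial : ℂ) := by
    have := Complex.Gamma_nat_eq_factorial (2 * K + 1)
    rw [Nat.factorial_succ] at this
    rw [← Nat.cast_mul, ← this]
    congr 1
    push_cast; ring
  rw [hG]
  have e : (2 * Real.pi * z) ^ (2 * K + 2) = (2 * z) ^ (2 * (K + 1)) * (Real.pi : ℂ) ^ (2 * (K + 1)) := by
    rw [← mul_pow]; congr 1; ring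
  rw [e, sub_eq_add_neg]
  congr 1
  rw [div_mul_eq_mul_div, div_mul_div_comm, neg_div']
  congr 1
  ring

/-- Truncating the asymptotic series one term later is compensated by the remainder. -/
theorem remainderPsiSS_sub_truncatedSeries (K : ℕ) {z : ℂ} (hz : z.re ≠ 0) :
    remainderPsiSS (K + 1) z - truncatedSeries (K + 1) z = remainderPsiSS 1 z := by
  induction K with
  | zero => simp [truncatedSeries]
  | succ K ih =>
    -- The coefficient `3 - 2N` drops by `2`, and the simple integral released by the recurrence of
    -- the squared one makes up for it. The zeta terms form exactly the new summand of the series.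
    rw [← ih, truncatedSeries_succ, remainderPsiSS, remainderPsiSS, remainderSS, remainderSS,
      integral_integrandSS_succ K hz, integral_integrandSqSS_succ K hz]
    have hA : 2 * Real.pi * z ≠ 0 := mul_ne_zero two_pi_ne_zero' (ne_zero_of_re_ne_zero hz)
    have hz0 := ne_zero_of_re_ne_zero hz
    have hz1 : (2 * ((K + 1 : ℕ) : ℤ) - 4) = ((2 * K : ℕ) : ℤ) - ((2 : ℕ) : ℤ) := by push_cast; ring
    have hz2 : (2 * ((K + 1 + 1 : ℕ) : ℤ) - 4) = ((2 * K : ℕ) : ℤ) := by push_cast; ring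
    rw [hz1, hz2, zpow_sub₀ hA, zpow_natCast, zpow_natCast]
    generalize (∫ y in Ioi (0 : ℝ), integrandSS (K + 1) z y) = I
    generalize (∫ y in Ioi (0 : ℝ), integrandSqSS (K + 1) z y) = J
    generalize riemannZeta (2 * ((K + 1 : ℕ) : ℂ)) = Z
    generalize 2 * Real.pi * z = A at *
    generalize ((2 * K).factorial : ℂ) = F
    have e1 : A ^ (2 * (K + 1 + 1)) = A ^ (2 * K) * A ^ 4 := by ring
    have e2 : A ^ (2 * (K + 1)) = A ^ (2 * K) * A ^ 2 := by ring
    have e3 : A ^ (2 * K + 2) = A ^ (2 * K) * A ^ 2 := by ring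
    rw [e1, e2, e3]
    have hAK : A ^ (2 * K) ≠ 0 := pow_ne_zero _ hA
    generalize A ^ (2 * K) = B at *
    push_cast
    field_simp
    ring

theorem summable_integral_norm_binetKernelDeriv {z : ℂ} (hz : z.re ≠ 0) :
    Summable fun n : ℕ => ∫ y in Ioi (0 : ℝ),
      ‖Complex.exp (-(y : ℂ)) * binetKernelDeriv (2 * Real.pi * ((n : ℂ) + 1) * z) y‖ := by
  set C := 4 * ‖2 * Real.pi * z‖ ^ 2 * (((2 * Real.pi * z.re) ^ 2)⁻¹) ^ 2 +
    2 * ((2 * Real.pi * z.re) ^ 2)⁻¹ with hC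
  refine Summable.of_nonneg_of_le (fun n => integral_nonneg fun y => norm_nonneg _) (fun n => ?_)
    (summable_const_div_sq C)
  have hre := scaled_re_ne_zero hz n
  have hb : ∀ y : ℝ, ‖binetKernelDeriv (2 * Real.pi * ((n : ℂ) + 1) * z) y‖ ≤
      C / ((n : ℝ) + 1) ^ 2 := by
    intro y
    refine (norm_binetKernelDeriv_le hre y).trans (le_of_eq ?_)
    rw [re_scaled, norm_scaled, hC, norm_mul, norm_mul, Complex.norm_real,
      Real.norm_of_nonneg Real.pi_pos.le, Complex.norm_ofNat]
    have := Real.pi_pos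
    field_simp
  calc ∫ y in Ioi (0 : ℝ),
        ‖Complex.exp (-(y : ℂ)) * binetKernelDeriv (2 * Real.pi * ((n : ℂ) + 1) * z) y‖
      ≤ ∫ y in Ioi (0 : ℝ), C / ((n : ℝ) + 1) ^ 2 * (y ^ 0 * Real.exp (-y)) := by
        refine integral_mono (integrableOn_binetKernelDeriv hre).norm
          ((integrableOn_pow_mul_exp_neg 0).const_mul _) fun y => ?_
        simp only
        rw [norm_mul, norm_ofReal_exp_neg, pow_zero, one_mul, mul_comm]
        exact mul_le_mul_of_nonneg_right (hb y) (Real.exp_nonneg _)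
    _ = C / ((n : ℝ) + 1) ^ 2 := by
        rw [integral_const_mul, integral_pow_mul_exp_neg]; simp

/-- The kernel splits as `4w²/(y²+w²)² - 2/(y²+w²)`; with `w = 2π(n+1)z`, summation under the
integral yields the two series of the case `N = 1`. -/
theorem remainderPsiSS_one {z : ℂ} (hz : 0 < z.re) :
    remainderPsiSS 1 z = -∑' n, binetSeriesTerm z n := by
  have hne := hz.ne'
  have hz0 := ne_zero_of_re_ne_zero hne
  have hA : 2 * Real.pi * z ≠ 0 := mul_ne_zero two_pi_ne_zero' hz0
  have h := hasSum_integral_of_summable_integral_norm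
    (fun n : ℕ => integrableOn_binetKernelDeriv (scaled_re_ne_zero hne n))
    (summable_integral_norm_binetKernelDeriv hne)
  have hT : ∀ n : ℕ, binetSeriesTerm z n = ∫ y in Ioi (0 : ℝ),
      Complex.exp (-(y : ℂ)) * binetKernelDeriv (2 * Real.pi * ((n : ℂ) + 1) * z) y := fun n => by
    have hp := Real.pi_pos
    rw [binetSeriesTerm, binetTerm_eq_integral_deriv]
    rw [re_scaled]
    positivity
  rw [funext hT, h.tsum_eq]
  have e : ∀ y ∈ Ioi (0 : ℝ), ∑' n : ℕ, Complex.exp (-(y : ℂ)) *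
      binetKernelDeriv (2 * Real.pi * ((n : ℂ) + 1) * z) y =
      4 * (2 * Real.pi * z) ^ 2 * integrandSqSS 1 z y -
        2 / (2 * Real.pi * z) ^ 2 * integrandSS 1 z y := by
    intro y _
    have h1 := summable_termSS 0 hne y
    have h2 := summable_termSqSS 0 hne y
    simp only [zero_add] at h1 h2
    have hz1 : (2 * ((1 : ℕ) : ℤ) - 2) = 0 := by norm_num
    rw [integrandSS, integrandSqSS, hz1, zpow_zero, one_mul, ← tsum_mul_left, ← tsum_mul_left,
      ← tsum_mul_left, ← tsum_mul_left,
      ← ((h2.mul_left _).mul_left _).tsum_sub ((h1.mul_left _).mul_left _)]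
    refine tsum_congr fun n => ?_
    have e1 := termSS_eq 0 hne y n
    have e2 := termSqSS_eq 0 hne y n
    rw [zero_add] at e1 e2
    rw [e1, e2, binetKernelDeriv]
    have h0 := sq_add_sq_ne_zero (scaled_re_ne_zero hne n) y
    have h2 := natCast_add_one_ne_zero' n
    field_simp
    ring
  have i1 := integrableOn_integrandSS 0 hne
  have i2 := integrableOn_integrandSqSS 0 hne
  rw [zero_add] at i1 i2
  rw [setIntegral_congr_fun measurableSet_Ioi e, integral_sub (i2.const_mul _) (i1.const_mul _),
    integral_const_mul, integral_const_mul, remainderPsiSS, remainderSS]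
  have hz1 : (2 * ((1 : ℕ) : ℤ) - 4) = -2 := by norm_num
  rw [hz1, zpow_neg]
  norm_cast
  push_cast
  field_simp
  ring

/-! ### Reflection, rotation and the expansion in Stokes sectors -/

/-- Only `z²` enters: the factor `z` in front of `R_N` is cancelled by `1/z`. One remainder thus
serves both half-planes. -/
theorem remainderPsiSS_neg (N : ℕ) (z : ℂ) : remainderPsiSS N (-z) = remainderPsiSS N z := by
  have h1 : termSS N (-z) = termSS N z := by
    funext y n
    rw [termSS, termSS, mul_neg, div_neg, neg_sq]
  have h2 : termSqSS N (-z) = termSqSS N z := by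
    funext y n
    rw [termSqSS, termSqSS, neg_sq]
  have h3 : integrandSS N (-z) = integrandSS N z := by
    funext y; rw [integrandSS, integrandSS, h1]
  have h4 : integrandSqSS N (-z) = integrandSqSS N z := by
    funext y; rw [integrandSqSS, integrandSqSS, h2]
  have h5 : Even (2 * (N : ℤ) - 4) := ⟨N - 2, by ring⟩
  rw [remainderPsiSS, remainderPsiSS, remainderSS, remainderSS, h3, h4, mul_neg (2 * (Real.pi : ℂ)),
    h5.neg_zpow, (even_two_mul N).neg_pow]
  rw [div_neg]
  ring

theorem ne_neg_natCast_of_re_pos {z : ℂ} (hz : 0 < z.re) (m : ℕ) : z ≠ -(m : ℂ) := by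
  rintro rfl
  simp at hz
  have h0 : (0 : ℝ) ≤ m := Nat.cast_nonneg m
  linarith

/-- The reflection formula for the digamma function. -/
theorem digamma_sub_digamma_one_sub {z : ℂ} (hz : z ∈ Complex.integerComplement) :
    Complex.digamma z - Complex.digamma (1 - z) =
      -(Real.pi * Complex.cot (Real.pi * z)) := by
  have hpi : (Real.pi : ℂ) ≠ 0 := by exact_mod_cast Real.pi_ne_zero
  have hsin : Complex.sin (Real.pi * z) ≠ 0 := sin_pi_mul_ne_zero hz
  have h1 : ∀ m : ℕ, z ≠ -(m : ℂ) := fun m h => hz ⟨-(m : ℤ), by rw [h]; simp⟩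
  have h2 : ∀ m : ℕ, 1 - z ≠ -(m : ℂ) := fun m h => hz ⟨(m : ℤ) + 1, by
    push_cast; linear_combination h⟩
  have d1 := (Complex.differentiableAt_Gamma z h1).hasDerivAt
  have d2 : HasDerivAt (fun w => Complex.Gamma (1 - w)) (-deriv Complex.Gamma (1 - z)) z := by
    have := (Complex.differentiableAt_Gamma (1 - z) h2).hasDerivAt.comp_const_sub 1 z
    simpa using this
  have d3 : HasDerivAt (fun w => Real.pi / Complex.sin (Real.pi * w))
      ((0 * Complex.sin (Real.pi * z) - Real.pi * (Complex.cos (Real.pi * z) * (Real.pi * 1))) /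
        Complex.sin (Real.pi * z) ^ 2) z :=
    (hasDerivAt_const z (Real.pi : ℂ)).fun_div (((hasDerivAt_id z).const_mul (Real.pi : ℂ)).csin) hsin
  -- `Γ(w)Γ(1-w)` and `π / sin πw` are the same function, so these two derivatives agree; dividing
  -- by the product gives the difference of the logarithmic derivatives.
  have d4 := d1.fun_mul d2
  rw [funext Complex.Gamma_mul_Gamma_one_sub] at d4
  have e := d4.unique d3
  have g1 := Complex.Gamma_ne_zero h1
  have g2 := Complex.Gamma_ne_zero h2
  have g := Complex.Gamma_mul_Gamma_one_sub z
  rw [Complex.digamma_def, logDeriv_apply, logDeriv_apply, Complex.cot]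
  have e2 : deriv Complex.Gamma z / Complex.Gamma z -
      deriv Complex.Gamma (1 - z) / Complex.Gamma (1 - z) =
      (deriv Complex.Gamma z * Complex.Gamma (1 - z) +
        Complex.Gamma z * -deriv Complex.Gamma (1 - z)) /
        (Complex.Gamma z * Complex.Gamma (1 - z)) := by
    field_simp
    ring
  rw [e2, e, g]
  field_simp
  ring

/-- Reflection leads to `ψ(1-z) = ψ(-z) - 1/z`, and Binet's formula applies at `-z`. The `-1/z`
turns `+1/(2z)` into `-1/(2z)`, and the remainder is even. -/
theorem digamma_of_re_neg {z : ℂ} (hz : z.re < 0) (hzm : ∀ m : ℕ, z ≠ -(m : ℂ)) :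
    Complex.digamma z = Complex.log (-z) - 1 / (2 * z) + remainderPsiSS 1 z -
      Real.pi * Complex.cot (Real.pi * z) := by
  have hre : 0 < (-z).re := by simpa using hz
  have hz0 := ne_zero_of_re_ne_zero hz.ne
  have hint : z ∈ Complex.integerComplement := by
    rintro ⟨k, hk⟩
    have h1 : (k : ℝ) < 0 := by
      have := hz; rw [← hk] at this; simpa using this
    have h2 : k < 0 := by exact_mod_cast h1
    obtain ⟨m, hm⟩ := Int.eq_ofNat_of_zero_le (by omega : 0 ≤ -k)
    refine hzm m ?_
    rw [← hk, show k = -(m : ℤ) by omega]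
    simp
  have h1 := digamma_sub_digamma_one_sub hint
  have h2 := Complex.digamma_apply_add_one (-z) (ne_neg_natCast_of_re_pos hre)
  have h3 := digamma_eq_binet hre
  have h4 := remainderPsiSS_one hre
  rw [remainderPsiSS_neg] at h4
  rw [neg_add_eq_sub] at h2
  rw [h2, h3] at h1
  rw [h4]
  rw [sub_eq_iff_eq_add] at h1
  rw [h1]
  field_simp
  ring

theorem truncated_add_remainder_eq {N : ℕ} (hN : 1 ≤ N) {z : ℂ} (hz : z.re ≠ 0) :
    remainderPsiSS N z - truncatedSeries N z = remainderPsiSS 1 z := by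
  obtain ⟨K, rfl⟩ := Nat.exists_eq_add_of_le' hN
  exact remainderPsiSS_sub_truncatedSeries K hz

/-- Rotating a point of the surface of the logarithm by `Mπ`. -/
theorem point_eq_neg_one_pow_mul (M : ℕ) {s : ℝ} (hs : s = 1 ∨ s = -1) (r θ : ℝ) :
    point r θ = (-1) ^ M * point r (θ - s * (M * Real.pi)) := by
  have h : Complex.exp ((s * (M * Real.pi) : ℝ) * Complex.I) = (-1) ^ M := by
    rcases hs with rfl | rfl
    · rw [show ((1 * (M * Real.pi) : ℝ) : ℂ) * Complex.I = (M : ℂ) * (Real.pi * Complex.I) by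
        push_cast; ring, Complex.exp_nat_mul, Complex.exp_pi_mul_I]
    · rw [show ((-1 * (M * Real.pi) : ℝ) : ℂ) * Complex.I = (M : ℂ) * (-(Real.pi * Complex.I)) by
        push_cast; ring, Complex.exp_nat_mul, Complex.exp_neg, Complex.exp_pi_mul_I]
      norm_num
  have e : ((θ : ℝ) : ℂ) * Complex.I =
      (s * (M * Real.pi) : ℝ) * Complex.I + ((θ - s * (M * Real.pi) : ℝ) : ℂ) * Complex.I := by
    push_cast; ring
  rw [point, point, e, Complex.exp_add, h]
  ring

theorem re_point (r φ : ℝ) : (point r φ).re = r * Real.cos φ := by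
  rw [point, Complex.re_ofReal_mul, Complex.exp_ofReal_mul_I_re]

theorem log_point {r φ : ℝ} (hr : 0 < r) (h1 : -Real.pi < φ) (h2 : φ ≤ Real.pi) :
    Complex.log (point r φ) = surfaceLog r φ := by
  rw [point, Complex.log_ofReal_mul hr (Complex.exp_ne_zero _), Complex.log_exp, surfaceLog]
  · simpa using h1
  · simpa using h2

/-- The expansion of the digamma function in a Stokes sector. -/
theorem digamma_stokes_sector {N : ℕ} (hN : 1 ≤ N) (M : ℕ) {s : ℝ} (hs : s = 1 ∨ s = -1)
    {r θ : ℝ} (hr : 0 < r) (h1 : ((M : ℝ) - 1 / 2) * Real.pi < s * θ)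
    (h2 : s * θ < ((M : ℝ) + 1 / 2) * Real.pi) :
    (point r θ).re ≠ 0 ∧ ((∀ m : ℕ, point r θ ≠ -(m : ℂ)) →
      Complex.digamma (point r θ) =
        surfaceLog r θ - 1 / (2 * point r θ) - truncatedSeries N (point r θ)
          + remainderPsiSS N (point r θ) + discontinuityPsiSS M s (point r θ)) := by
  have hpi := Real.pi_pos
  -- Undoing `M` half-turns puts the point in the open right half-plane, where `surfaceLog` is the
  -- principal logarithm.
  set φ := θ - s * (M * Real.pi) with hφ
  have hss : s * s = 1 := by rcases hs with rfl | rfl <;> norm_num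
  have hb : -(Real.pi / 2) < φ ∧ φ < Real.pi / 2 := by
    rcases hs with rfl | rfl <;> constructor <;> simp only [hφ] <;> linarith
  have hcos : 0 < r * Real.cos φ := mul_pos hr (Real.cos_pos_of_mem_Ioo hb)
  have hpt := point_eq_neg_one_pow_mul M hs r θ
  have hlog := log_point hr (by linarith : -Real.pi < φ) (by linarith : φ ≤ Real.pi)
  have hsl : surfaceLog r θ = surfaceLog r φ + s * M * Real.pi * Complex.I := by
    rw [surfaceLog, surfaceLog, hφ]; push_cast; ring
  rw [← hφ] at hpt
  rw [← re_point] at hcos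
  rcases Nat.even_or_odd' M with ⟨m, rfl | rfl⟩
  · rw [(even_two_mul m).neg_one_pow, one_mul] at hpt
    rw [hsl, hpt]
    refine ⟨hcos.ne', fun _ => ?_⟩
    rw [digamma_eq_binet hcos, ← hlog]
    have h4 := truncated_add_remainder_eq hN hcos.ne'
    rw [remainderPsiSS_one hcos] at h4
    rw [discontinuityPsiSS, Nat.mul_div_cancel_left _ two_pos, (even_two_mul m).neg_one_pow]
    push_cast
    linear_combination -h4
  · have hodd : Odd (2 * m + 1) := ⟨m, rfl⟩
    -- For odd `M` the point lies in the left half-plane and `log (-z)` is the logarithm at `φ`. Of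
    -- the shift by `sMπi` one `sπi` is not absorbed by the floor; with the cotangent it gives `-sπi
    -- - π cot πz = -2sπi / (1 - e^{-2sπiz})`.
    rw [hodd.neg_one_pow, neg_one_mul] at hpt
    have hre : (point r θ).re < 0 := by rw [hpt]; simpa using hcos
    refine ⟨hre.ne, fun hzm => ?_⟩
    rw [digamma_of_re_neg hre hzm, hsl, ← hlog, ← truncated_add_remainder_eq hN hre.ne,
      show -point r θ = point r φ by rw [hpt, neg_neg]]
    have hdiv : (2 * m + 1) / 2 = m := by omega
    rw [discontinuityPsiSS, hdiv, hodd.neg_one_pow, Complex.cot_pi_eq_exp_ratio]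
    -- Equality would make `z` an integer, and a negative one as `Re z < 0`, hence a pole of `ψ`.
    have hE : Complex.exp (2 * Real.pi * Complex.I * point r θ) ≠ 1 := by
      intro hE
      obtain ⟨k, hk⟩ := Complex.exp_eq_one_iff.mp hE
      have h5 : point r θ = k := by
        have := two_pi_ne_zero'
        have h6 : 2 * (Real.pi : ℂ) * Complex.I ≠ 0 := mul_ne_zero this Complex.I_ne_zero
        apply mul_left_cancel₀ h6
        rw [hk]; ring
      have h7 : (k : ℝ) < 0 := by rw [h5] at hre; simpa using hre
      have h8 : k < 0 := by exact_mod_cast h7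
      obtain ⟨j, hj⟩ := Int.eq_ofNat_of_zero_le (by omega : 0 ≤ -k)
      refine hzm j ?_
      rw [h5, show k = -(j : ℤ) by omega]
      simp
    have hE0 := Complex.exp_ne_zero (2 * Real.pi * Complex.I * point r θ)
    rcases hs with rfl | rfl
    · rw [show -((1 : ℝ) : ℂ) * (2 * Complex.I * (Real.pi : ℂ) * point r θ) =
        -(2 * Real.pi * Complex.I * point r θ) by push_cast; ring, Complex.exp_neg]
      generalize Complex.exp (2 * Real.pi * Complex.I * point r θ) = E at *
      have h9 : 1 - E ≠ 0 := sub_ne_zero.mpr hE.symm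
      have h10 : 1 - E⁻¹ = -(1 - E) / E := by field_simp; ring
      have e1 : (E + 1) / (Complex.I * (1 - E)) = -Complex.I * ((E + 1) / (1 - E)) := by
        field_simp; rw [Complex.I_sq]; ring
      rw [h10, e1]
      push_cast
      field_simp
      ring
    · rw [show -((-1 : ℝ) : ℂ) * (2 * Complex.I * (Real.pi : ℂ) * point r θ) =
        (2 * Real.pi * Complex.I * point r θ) by push_cast; ring]
      generalize Complex.exp (2 * Real.pi * Complex.I * point r θ) = E at *
      have h9 : 1 - E ≠ 0 := sub_ne_zero.mpr hE.symm
      have e1 : (E + 1) / (Complex.I * (1 - E)) = -Complex.I * ((E + 1) / (1 - E)) := by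
        field_simp; rw [Complex.I_sq]; ring
      rw [e1]
      push_cast
      field_simp
      ring

/-! ### Boundary values on the imaginary axis -/

/-- Binet's formula for the digamma function on the imaginary axis. -/
theorem digamma_eq_binet_of_re_eq_zero {z : ℂ} (hz : z.re = 0) (hz0 : z ≠ 0) :
    Complex.digamma z = Complex.log z - 1 / (2 * z) - ∑' n, binetSeriesTerm z n := by
  have him : z.im ≠ 0 := fun h => hz0 (Complex.ext hz h)
  have hzm : ∀ m : ℕ, z ≠ -(m : ℂ) := fun m h => him (by rw [h]; simp)
  have hp := Real.pi_pos
  have hlim : Tendsto (fun η : ℝ => z + η) (𝓝[>] 0) (𝓝 z) := by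
    have : Tendsto (fun η : ℝ => z + (η : ℂ)) (𝓝 0) (𝓝 (z + ((0 : ℝ) : ℂ))) :=
      (by fun_prop : Continuous fun η : ℝ => z + (η : ℂ)).tendsto 0
    rw [Complex.ofReal_zero, add_zero] at this
    exact this.mono_left nhdsWithin_le_nhds
  -- For purely imaginary `z` a real shift can only increase the norm, so one majorant of order
  -- `n⁻²` works for all `η`.
  have hnorm : ∀ η : ℝ, ‖z‖ ≤ ‖z + η‖ := by
    intro η
    have h1 : ‖z‖ = |z.im| := by
      rw [← Complex.re_add_im z, hz]; simp
    rw [h1]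
    simpa using Complex.abs_im_le_norm (z + η)
  have hre : ∀ η : ℝ, 0 < η → 0 < (z + η).re := fun η hη => by simpa [hz] using hη
  have hzn : 0 < ‖z‖ := norm_pos_iff.mpr hz0
  have hψ : Tendsto (fun η : ℝ => Complex.digamma (z + η)) (𝓝[>] 0)
      (𝓝 (Complex.digamma z)) := by
    refine Tendsto.comp (g := Complex.digamma) (y := 𝓝 z) ?_ hlim
    have hd : DifferentiableOn ℂ Complex.Gamma {w | w.im ≠ 0} := fun w hw =>
      (Complex.differentiableAt_Gamma w fun m h => hw (by rw [h]; simp)).differentiableWithinAt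
    have ho : IsOpen {w : ℂ | w.im ≠ 0} := isOpen_ne_fun Complex.continuous_im continuous_const
    have h1 : ContinuousAt (deriv Complex.Gamma) z :=
      ((hd.deriv ho).differentiableAt (ho.mem_nhds him)).continuousAt
    exact h1.div (Complex.continuousAt_Gamma z hzm) (Complex.Gamma_ne_zero hzm)
  have hlog : Tendsto (fun η : ℝ => Complex.log (z + η)) (𝓝[>] 0) (𝓝 (Complex.log z)) :=
    (continuousAt_clog (Or.inr him)).tendsto.comp hlim
  have hinv : Tendsto (fun η : ℝ => 1 / (2 * (z + η))) (𝓝[>] 0) (𝓝 (1 / (2 * z))) :=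
    tendsto_const_nhds.div (hlim.const_mul 2) (mul_ne_zero two_ne_zero hz0)
  have hsum : Tendsto (fun η : ℝ => ∑' n, binetSeriesTerm (z + η) n) (𝓝[>] 0)
      (𝓝 (∑' n, binetSeriesTerm z n)) := by
    refine tendsto_tsum_of_dominated_convergence
      (summable_const_div_sq (binetConst / (2 * Real.pi * ‖z‖) ^ 2)) (fun n => ?_) ?_
    · have hc : ContinuousWithinAt binetTerm {w | 0 ≤ w.re ∧ w ≠ 0}
          (2 * Real.pi * ((n : ℂ) + 1) * z) := by
        refine continuousOn_binetTerm _ ⟨by rw [re_scaled, hz, mul_zero], ?_⟩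
        exact mul_ne_zero (mul_ne_zero two_pi_ne_zero' (natCast_add_one_ne_zero' n)) hz0
      refine hc.tendsto.comp (tendsto_nhdsWithin_iff.mpr ⟨hlim.const_mul _, ?_⟩)
      filter_upwards [self_mem_nhdsWithin] with η hη
      have h3 := hre η hη
      have h4 : 0 < (2 * Real.pi * ((n : ℂ) + 1) * (z + η)).re := by rw [re_scaled]; positivity
      exact ⟨h4.le, ne_zero_of_re_ne_zero h4.ne'⟩
    · filter_upwards [self_mem_nhdsWithin] with η hη n
      refine (norm_binetSeriesTerm_le (hre η hη).le n).trans ?_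
      have := binetConst_nonneg
      have := hnorm η
      gcongr
  refine tendsto_nhds_unique hψ (((hlog.sub hinv).sub hsum).congr' ?_)
  filter_upwards [self_mem_nhdsWithin] with η hη
  exact (digamma_eq_binet (hre η hη)).symm

theorem measurable_log_one_sub_sq (W : ℝ) : Measurable fun y : ℝ => Real.log (1 - y ^ 2 / W ^ 2) :=
  Real.measurable_log.comp (by fun_prop)

theorem abs_log_one_sub_sq_le {W y : ℝ} (hW : 0 < W) (hy : 0 < y) :
    |Real.log (1 - y ^ 2 / W ^ 2)| ≤ |Real.log (W - y)| + |Real.log W| + y / W := by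
  rcases eq_or_ne y W with rfl | hne
  -- At the singular point `Real.log 0 = 0` makes the bound trivial.
  · have : 1 - y ^ 2 / y ^ 2 = 0 := by field_simp; ring
    rw [this, Real.log_zero, abs_zero]
    positivity
  · have h1 : W - y ≠ 0 := sub_ne_zero.mpr hne.symm
    have e : 1 - y ^ 2 / W ^ 2 = (W - y) / W * (1 + y / W) := by field_simp; ring
    have h2 : 0 < 1 + y / W := by positivity
    rw [e, Real.log_mul (div_ne_zero h1 hW.ne') h2.ne', Real.log_div h1 hW.ne']
    have h3 : |Real.log (1 + y / W)| ≤ y / W := by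
      rw [abs_of_nonneg (Real.log_nonneg (by linarith [div_pos hy hW]))]
      have := Real.log_le_sub_one_of_pos h2
      linarith
    have h4 := abs_add_le (Real.log (W - y) - Real.log W) (Real.log (1 + y / W))
    have h5 := abs_sub (Real.log (W - y)) (Real.log W)
    linarith

/-- The logarithmic singularity at `W` is locally integrable, and beyond `W + 1` the logarithm is at
most `y`. -/
theorem integrableOn_exp_neg_mul_abs_log_sub {W : ℝ} (hW : 0 < W) :
    IntegrableOn (fun y : ℝ => Real.exp (-y) * |Real.log (W - y)|) (Ioi 0) := by
  have hm : Measurable fun y : ℝ => Real.exp (-y) * |Real.log (W - y)| := by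
    have : Measurable fun y : ℝ => Real.log (W - y) := Real.measurable_log.comp (by fun_prop)
    fun_prop
  rw [← Ioc_union_Ioi_eq_Ioi (by linarith : (0 : ℝ) ≤ W + 1)]
  refine IntegrableOn.union ?_ ?_
  · have h1 : IntervalIntegrable (fun y => Real.log (W - y)) volume 0 (W + 1) := by
      have := (intervalIntegral.intervalIntegrable_log' (a := W) (b := -1)).comp_sub_left W
      simpa using this
    have h2 : IntegrableOn (fun y => Real.log (W - y)) (Ioc 0 (W + 1)) :=
      (intervalIntegrable_iff_integrableOn_Ioc_of_le (by linarith)).mp h1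
    refine Integrable.mono' h2.abs hm.aestronglyMeasurable ?_
    refine (ae_restrict_mem measurableSet_Ioc).mono fun y hy => ?_
    rw [Real.norm_of_nonneg (by positivity)]
    exact mul_le_of_le_one_left (abs_nonneg _) (Real.exp_le_one_iff.mpr (by linarith [hy.1]))
  · refine Integrable.mono' ((integrableOn_pow_mul_exp_neg 1).mono_set
      (Ioi_subset_Ioi (by linarith : (0 : ℝ) ≤ W + 1))) hm.aestronglyMeasurable ?_
    refine (ae_restrict_mem measurableSet_Ioi).mono fun y hy => ?_
    have hy' : W + 1 < y := hy
    rw [Real.norm_of_nonneg (by positivity), pow_one, mul_comm]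
    refine mul_le_mul_of_nonneg_right ?_ (Real.exp_nonneg _)
    rw [← Real.log_neg_eq_log, neg_sub, abs_of_nonneg (Real.log_nonneg (by linarith))]
    have := Real.log_le_sub_one_of_pos (by linarith : 0 < y - W)
    linarith

theorem integrableOn_exp_neg_mul_log_one_sub {W : ℝ} (hW : 0 < W) :
    IntegrableOn (fun y : ℝ => Real.exp (-y) * Real.log (1 - y ^ 2 / W ^ 2)) (Ioi 0) := by
  have hm := measurable_log_one_sub_sq W
  refine Integrable.mono' (((integrableOn_exp_neg_mul_abs_log_sub hW).add
    ((integrableOn_pow_mul_exp_neg 0).const_mul |Real.log W|)).add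
    ((integrableOn_pow_mul_exp_neg 1).const_mul W⁻¹))
    (Measurable.aestronglyMeasurable (by fun_prop)) ?_
  refine (ae_restrict_mem measurableSet_Ioi).mono fun y hy => ?_
  rw [norm_mul, Real.norm_of_nonneg (Real.exp_nonneg _), Real.norm_eq_abs]
  refine (mul_le_mul_of_nonneg_left (abs_log_one_sub_sq_le hW hy) (Real.exp_nonneg _)).trans
    (le_of_eq ?_)
  simp only [Pi.add_apply]
  field_simp

/-- The factorization `(w + iy)(w - iy)` again, now with imaginary parts; unlike the bound by `(Re
w)²`, this one survives as `Re w → 0`. -/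
theorem norm_add_mul_I_le_of_im (w : ℂ) (y : ℝ) : |w.im ^ 2 - y ^ 2| ≤ ‖(y : ℂ) ^ 2 + w ^ 2‖ := by
  have e : (y : ℂ) ^ 2 + w ^ 2 = (w + y * Complex.I) * (w - y * Complex.I) := by
    ring_nf; rw [Complex.I_sq]; ring
  have h1 : |w.im + y| ≤ ‖w + y * Complex.I‖ := by
    simpa using Complex.abs_im_le_norm (w + y * Complex.I)
  have h2 : |w.im - y| ≤ ‖w - y * Complex.I‖ := by
    simpa using Complex.abs_im_le_norm (w - y * Complex.I)
  rw [e, norm_mul, show w.im ^ 2 - y ^ 2 = (w.im + y) * (w.im - y) by ring, abs_mul]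
  exact mul_le_mul h1 h2 (abs_nonneg _) (norm_nonneg _)

/-- The limit of the logarithmic integrand of `binetTerm` on the imaginary axis. -/
theorem tendsto_log_one_add {W y : ℝ} (hW : 0 < W) (hy : 0 < y) (hyW : y ≠ W) :
    Tendsto (fun δ : ℝ => Complex.log (1 + (y : ℂ) ^ 2 / ((W : ℂ) * Complex.I + δ) ^ 2)) (𝓝[>] 0)
      (𝓝 ((Real.log (1 - y ^ 2 / W ^ 2) : ℂ) -
        (Ioi W).indicator (fun _ => (Real.pi : ℂ) * Complex.I) y)) := by
  have hWc : (W : ℂ) * Complex.I ≠ 0 := mul_ne_zero (by exact_mod_cast hW.ne') Complex.I_ne_zero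
  have hu : Tendsto (fun δ : ℝ => 1 + (y : ℂ) ^ 2 / ((W : ℂ) * Complex.I + δ) ^ 2) (𝓝[>] 0)
      (𝓝 ((1 - y ^ 2 / W ^ 2 : ℝ) : ℂ)) := by
    have h1 : Tendsto (fun δ : ℝ => (W : ℂ) * Complex.I + δ) (𝓝[>] 0) (𝓝 (W * Complex.I)) := by
      have : Tendsto (fun δ : ℝ => (W : ℂ) * Complex.I + δ) (𝓝 0)
          (𝓝 ((W : ℂ) * Complex.I + ((0 : ℝ) : ℂ))) :=
        (by fun_prop : Continuous fun δ : ℝ => (W : ℂ) * Complex.I + δ).tendsto 0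
      rw [Complex.ofReal_zero, add_zero] at this
      exact this.mono_left nhdsWithin_le_nhds
    have h2 : ((1 - y ^ 2 / W ^ 2 : ℝ) : ℂ) = 1 + (y : ℂ) ^ 2 / (W * Complex.I) ^ 2 := by
      push_cast
      rw [mul_pow, Complex.I_sq]
      ring
    rw [h2]
    exact tendsto_const_nhds.add (tendsto_const_nhds.div (h1.pow 2) (pow_ne_zero 2 hWc))
  rcases lt_or_gt_of_ne hyW with hlt | hgt
  · have hpos : 0 < 1 - y ^ 2 / W ^ 2 := by
      rw [sub_pos, div_lt_one (by positivity)]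
      exact pow_lt_pow_left₀ hlt hy.le two_ne_zero
    have hni : y ∉ Ioi W := fun h => lt_asymm hlt h
    rw [indicator_of_notMem hni, sub_zero, Complex.ofReal_log hpos.le]
    refine (continuousAt_clog ?_).tendsto.comp hu
    rw [Complex.ofReal_mem_slitPlane]
    exact hpos
  · have hneg : 1 - y ^ 2 / W ^ 2 < 0 := by
      rw [sub_neg, one_lt_div (by positivity)]
      exact pow_lt_pow_left₀ hgt hW.le two_ne_zero
    rw [indicator_of_mem (mem_Ioi.mpr hgt)]
    -- The limit lies on the branch cut and is approached from the lower half-plane, which selects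
    -- the argument `-π`.
    have hl := Complex.tendsto_log_nhdsWithin_im_neg_of_re_neg_of_im_zero
      (z := ((1 - y ^ 2 / W ^ 2 : ℝ) : ℂ)) (by rw [Complex.ofReal_re]; exact hneg) (Complex.ofReal_im _)
    rw [Complex.norm_real, Real.norm_eq_abs, Real.log_abs] at hl
    refine hl.comp (tendsto_nhdsWithin_iff.mpr ⟨hu, ?_⟩)
    filter_upwards [self_mem_nhdsWithin] with δ hδ
    have hδ' : (0 : ℝ) < δ := hδ
    change (1 + (y : ℂ) ^ 2 / ((W : ℂ) * Complex.I + δ) ^ 2).im < 0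
    have e : ((W : ℂ) * Complex.I + δ) ^ 2 =
        ((δ ^ 2 - W ^ 2 : ℝ) : ℂ) + ((2 * W * δ : ℝ) : ℂ) * Complex.I := by
      push_cast; ring_nf; rw [Complex.I_sq]; ring
    have hne : ((W : ℂ) * Complex.I + δ) ^ 2 ≠ 0 := by
      refine pow_ne_zero 2 (ne_zero_of_re_ne_zero ?_)
      simpa using hδ'.ne'
    have him : (((W : ℂ) * Complex.I + δ) ^ 2).im = 2 * W * δ := by
      rw [e, Complex.add_im, Complex.ofReal_im, Complex.im_ofReal_mul, Complex.I_im]; ring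
    have hns := Complex.normSq_pos.mpr hne
    have e2 : (y : ℂ) ^ 2 / ((W : ℂ) * Complex.I + δ) ^ 2 =
        ((y ^ 2 : ℝ) : ℂ) * (((W : ℂ) * Complex.I + δ) ^ 2)⁻¹ := by push_cast; rw [div_eq_mul_inv]
    rw [e2, Complex.add_im, Complex.one_im, zero_add, Complex.im_ofReal_mul, Complex.inv_im, him]
    have : 0 < y ^ 2 * (2 * W * δ / Complex.normSq (((W : ℂ) * Complex.I + δ) ^ 2)) := by positivity
    rw [neg_div, mul_neg]
    linarith

/-- A majorant independent of `δ`. Since `δ ≤ W` gives `|w|² ≤ 2W²`, the argument of the logarithm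
is at least half its limiting modulus, whence the `log 2`. -/
theorem norm_log_one_add_le_of_im {W δ y : ℝ} (hW : 0 < W) (hδ : 0 < δ) (hδW : δ ≤ W)
    (hyW : y ≠ W) (hy : 0 < y) :
    ‖Complex.log (1 + (y : ℂ) ^ 2 / ((W : ℂ) * Complex.I + δ) ^ 2)‖ ≤
      |Real.log (1 - y ^ 2 / W ^ 2)| + Real.log 2 + y ^ 2 / W ^ 2 + Real.pi := by
  set w : ℂ := (W : ℂ) * Complex.I + δ with hw
  have hre : w.re = δ := by simp [hw]
  have him : w.im = W := by simp [hw]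
  have hw0 : w ≠ 0 := ne_zero_of_re_ne_zero (by rw [hre]; exact hδ.ne')
  have hns : ‖w‖ ^ 2 = W ^ 2 + δ ^ 2 := by
    rw [← Complex.normSq_eq_norm_sq, Complex.normSq_apply, hre, him]; ring
  have h0 : 1 + (y : ℂ) ^ 2 / w ^ 2 ≠ 0 :=
    Complex.slitPlane_ne_zero (one_add_div_sq_mem_slitPlane (by rw [hre]; exact hδ) y)
  have hup : ‖1 + (y : ℂ) ^ 2 / w ^ 2‖ ≤ 1 + y ^ 2 / W ^ 2 := by
    refine (norm_add_le _ _).trans ?_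
    rw [norm_one, norm_div, norm_pow, norm_pow, hns, Complex.norm_real, Real.norm_eq_abs, sq_abs]
    gcongr
    nlinarith
  have hlo : |1 - y ^ 2 / W ^ 2| / 2 ≤ ‖1 + (y : ℂ) ^ 2 / w ^ 2‖ := by
    have e : 1 + (y : ℂ) ^ 2 / w ^ 2 = ((y : ℂ) ^ 2 + w ^ 2) / w ^ 2 := by field_simp; ring
    have h1 := norm_add_mul_I_le_of_im w y
    rw [him] at h1
    rw [e, norm_div, norm_pow, hns]
    have e2 : |1 - y ^ 2 / W ^ 2| = |W ^ 2 - y ^ 2| / W ^ 2 := by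
      rw [← abs_of_pos (by positivity : 0 < W ^ 2), ← abs_div, abs_of_pos (by positivity : 0 < W ^ 2)]
      congr 1
      field_simp
    rw [e2, div_div]
    gcongr
    nlinarith
  have hne : 1 - y ^ 2 / W ^ 2 ≠ 0 := by
    intro h
    have h2 : y ^ 2 = W ^ 2 := by field_simp at h; linarith
    exact hyW ((pow_left_inj₀ hy.le hW.le two_ne_zero).mp h2)
  have hp := abs_pos.mpr hne
  have hn := norm_pos_iff.mpr h0
  have l1 : Real.log ‖1 + (y : ℂ) ^ 2 / w ^ 2‖ ≤ y ^ 2 / W ^ 2 := by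
    have := Real.log_le_sub_one_of_pos hn
    linarith
  have l2 : Real.log (1 - y ^ 2 / W ^ 2) - Real.log 2 ≤ Real.log ‖1 + (y : ℂ) ^ 2 / w ^ 2‖ := by
    rw [← Real.log_abs (1 - y ^ 2 / W ^ 2), ← Real.log_div hp.ne' two_ne_zero]
    exact Real.log_le_log (by positivity) hlo
  have l3 := norm_log_le (1 + (y : ℂ) ^ 2 / w ^ 2)
  have l4 : |Real.log ‖1 + (y : ℂ) ^ 2 / w ^ 2‖| ≤
      |Real.log (1 - y ^ 2 / W ^ 2)| + Real.log 2 + y ^ 2 / W ^ 2 := by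
    have a1 := neg_abs_le (Real.log (1 - y ^ 2 / W ^ 2))
    have a2 := Real.log_pos one_lt_two
    have a3 : 0 ≤ y ^ 2 / W ^ 2 := by positivity
    have a4 := abs_nonneg (Real.log (1 - y ^ 2 / W ^ 2))
    rw [abs_le]
    constructor <;> linarith
  linarith

/-- The jump of the logarithm past `y = W` integrates to an exponentially small quantity, the source
of the term switched on at a Stokes line. -/
theorem integral_exp_neg_mul_indicator {W : ℝ} (hW : 0 < W) :
    ∫ y in Ioi (0 : ℝ), Complex.exp (-(y : ℂ)) *
      (Ioi W).indicator (fun _ => (Real.pi : ℂ) * Complex.I) y =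
      Real.exp (-W) * (Real.pi * Complex.I) := by
  have e : ∀ y : ℝ, Complex.exp (-(y : ℂ)) *
      (Ioi W).indicator (fun _ => (Real.pi : ℂ) * Complex.I) y =
      (Ioi W).indicator (fun y : ℝ => ((Real.exp (-y) : ℝ) : ℂ) * ((Real.pi : ℂ) * Complex.I)) y := by
    intro y
    by_cases h : y ∈ Ioi W
    · rw [indicator_of_mem h, indicator_of_mem h]; push_cast; rfl
    · rw [indicator_of_notMem h, indicator_of_notMem h, mul_zero]
  rw [funext e, setIntegral_indicator measurableSet_Ioi,
    inter_eq_right.mpr (Ioi_subset_Ioi hW.le), integral_mul_const, integral_complex_ofReal,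
    integral_exp_neg_Ioi]

theorem integrableOn_exp_neg_mul_indicator (W : ℝ) :
    IntegrableOn (fun y : ℝ => Complex.exp (-(y : ℂ)) *
      (Ioi W).indicator (fun _ => (Real.pi : ℂ) * Complex.I) y) (Ioi 0) := by
  refine Integrable.mono' ((integrableOn_pow_mul_exp_neg 0).const_mul Real.pi) ?_ ?_
  · have : Measurable ((Ioi W).indicator fun _ : ℝ => (Real.pi : ℂ) * Complex.I) :=
      measurable_const.indicator measurableSet_Ioi
    exact Measurable.aestronglyMeasurable (by fun_prop)
  · refine Eventually.of_forall fun y => ?_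
    rw [norm_mul, norm_ofReal_exp_neg, pow_zero, one_mul, mul_comm]
    refine mul_le_mul_of_nonneg_right ((norm_indicator_le_norm_self _ _).trans ?_)
      (Real.exp_nonneg _)
    simp [abs_of_pos Real.pi_pos]

/-- The boundary values of `binetTerm` on the positive imaginary axis. -/
theorem binetTerm_mul_I {W : ℝ} (hW : 0 < W) :
    binetTerm (W * Complex.I) =
      ((∫ y in Ioi (0 : ℝ), Real.exp (-y) * Real.log (1 - y ^ 2 / W ^ 2) : ℝ) : ℂ) -
        Real.exp (-W) * (Real.pi * Complex.I) := by
  have hm := measurable_log_one_sub_sq W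
  have hlim : Tendsto (fun δ : ℝ => (W : ℂ) * Complex.I + δ) (𝓝[>] 0) (𝓝 (W * Complex.I)) := by
    have : Tendsto (fun δ : ℝ => (W : ℂ) * Complex.I + δ) (𝓝 0)
        (𝓝 ((W : ℂ) * Complex.I + ((0 : ℝ) : ℂ))) :=
      (by fun_prop : Continuous fun δ : ℝ => (W : ℂ) * Complex.I + δ).tendsto 0
    rw [Complex.ofReal_zero, add_zero] at this
    exact this.mono_left nhdsWithin_le_nhds
  have hre : ∀ δ : ℝ, 0 < δ → 0 < ((W : ℂ) * Complex.I + δ).re := fun δ hδ => by simpa using hδ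
  -- `binetTerm (iW + δ)` has two limits as `δ → 0+`: one by continuity up to the boundary, one by
  -- dominated convergence in the logarithmic form.
  have hT : Tendsto (fun δ : ℝ => binetTerm (W * Complex.I + δ)) (𝓝[>] 0)
      (𝓝 (binetTerm (W * Complex.I))) := by
    have hc : ContinuousWithinAt binetTerm {w | 0 ≤ w.re ∧ w ≠ 0} (W * Complex.I) :=
      continuousOn_binetTerm _ ⟨by simp,
        mul_ne_zero (by exact_mod_cast hW.ne') Complex.I_ne_zero⟩
    refine hc.tendsto.comp (tendsto_nhdsWithin_iff.mpr ⟨hlim, ?_⟩)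
    filter_upwards [self_mem_nhdsWithin] with δ hδ
    exact ⟨(hre δ hδ).le, ne_zero_of_re_ne_zero (hre δ hδ).ne'⟩
  have hae : ∀ᵐ y : ℝ ∂volume.restrict (Ioi 0), y ≠ W :=
    ae_restrict_of_ae (measure_eq_zero_iff_ae_notMem.mp (Real.volume_singleton (a := W)))
  have hI : Tendsto (fun δ : ℝ => ∫ y in Ioi (0 : ℝ), Complex.exp (-(y : ℂ)) *
      Complex.log (1 + (y : ℂ) ^ 2 / ((W : ℂ) * Complex.I + δ) ^ 2)) (𝓝[>] 0)
      (𝓝 (∫ y in Ioi (0 : ℝ), Complex.exp (-(y : ℂ)) * ((Real.log (1 - y ^ 2 / W ^ 2) : ℂ) -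
        (Ioi W).indicator (fun _ => (Real.pi : ℂ) * Complex.I) y))) := by
    refine tendsto_integral_filter_of_dominated_convergence
      (fun y => |Real.exp (-y) * Real.log (1 - y ^ 2 / W ^ 2)| +
        (Real.log 2 + Real.pi) * (y ^ 0 * Real.exp (-y)) + (W ^ 2)⁻¹ * (y ^ 2 * Real.exp (-y)))
      ?_ ?_ ?_ ?_
    · filter_upwards [self_mem_nhdsWithin] with δ hδ
      have := continuous_log_one_add (hre δ hδ)
      exact Continuous.aestronglyMeasurable (by fun_prop)
    · have hev : ∀ᶠ δ : ℝ in 𝓝[>] 0, δ ≤ W :=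
        nhdsWithin_le_nhds ((gt_mem_nhds hW).mono fun _ h => le_of_lt h)
      filter_upwards [self_mem_nhdsWithin, hev] with δ hδ hδW
      filter_upwards [hae, ae_restrict_mem measurableSet_Ioi] with y hyW hy
      rw [norm_mul, norm_ofReal_exp_neg]
      refine (mul_le_mul_of_nonneg_left (norm_log_one_add_le_of_im hW hδ hδW hyW hy)
        (Real.exp_nonneg _)).trans (le_of_eq ?_)
      rw [abs_mul, abs_of_pos (Real.exp_pos _)]
      field_simp
      ring
    · exact ((integrableOn_exp_neg_mul_log_one_sub hW).abs.add
        ((integrableOn_pow_mul_exp_neg 0).const_mul _)).add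
        ((integrableOn_pow_mul_exp_neg 2).const_mul _)
    · filter_upwards [hae, ae_restrict_mem measurableSet_Ioi] with y hyW hy
      exact (tendsto_log_one_add hW hy hyW).const_mul _
  have hI' := hI.congr' (f₂ := fun δ : ℝ => binetTerm (W * Complex.I + δ)) (by
    filter_upwards [self_mem_nhdsWithin] with δ hδ
    exact (binetTerm_eq_integral_log (hre δ hδ)).symm)
  rw [tendsto_nhds_unique hT hI', ← integral_exp_neg_mul_indicator hW, ← integral_complex_ofReal,
    ← integral_sub _ (integrableOn_exp_neg_mul_indicator W)]
  · congr 1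
    funext y
    push_cast
    ring
  · exact (integrableOn_exp_neg_mul_log_one_sub hW).ofReal

/-- The Laplace kernel is real; this transfers the boundary values to the negative imaginary axis.
-/
theorem binetTerm_conj (w : ℂ) :
    binetTerm ((starRingEnd ℂ) w) = (starRingEnd ℂ) (binetTerm w) := by
  rw [binetTerm, binetTerm, map_div₀, map_add, map_pow, ← integral_conj]
  simp [← Complex.exp_conj, map_ofNat (starRingEnd ℂ) 2]

/-! ### Summation over `n`: Euler's sine product and the geometric series -/

/-- The `n`-th pole `2π(n+1)ρ`. -/
noncomputable def pole (ρ : ℝ) (n : ℕ) : ℝ := 2 * Real.pi * ((n : ℝ) + 1) * ρ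

theorem pole_pos {ρ : ℝ} (hρ : 0 < ρ) (n : ℕ) : 0 < pole ρ n := by
  have := Real.pi_pos
  rw [pole]; positivity

theorem countable_poles (ρ : ℝ) : (poles ρ).Countable := by
  have : poles ρ = range (pole ρ) := by
    ext p; exact ⟨fun ⟨n, hn⟩ => ⟨n, hn.symm⟩, fun ⟨n, hn⟩ => ⟨n, hn.symm⟩⟩
  rw [this]
  exact countable_range _

theorem ae_notMem_poles (ρ : ℝ) (s : Set ℝ) : ∀ᵐ y ∂volume.restrict s, y ∉ poles ρ :=
  ae_restrict_of_ae (measure_eq_zero_iff_ae_notMem.mp ((countable_poles ρ).measure_zero volume))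

theorem ne_pole {ρ y : ℝ} (hy : y ∉ poles ρ) (n : ℕ) : y ≠ pole ρ n := fun h => hy ⟨n, h⟩

theorem sin_half_ne_zero {ρ y : ℝ} (hρ : 0 < ρ) (hy : 0 < y) (hyp : y ∉ poles ρ) :
    Real.sin (y / (2 * ρ)) ≠ 0 := by
  intro h
  obtain ⟨k, hk⟩ := Real.sin_eq_zero_iff.mp h
  have hpi := Real.pi_pos
  have h1 : 0 < y / (2 * ρ) := by positivity
  rw [← hk] at h1
  have h2 : (0 : ℝ) < k := by
    by_contra hcon
    have := mul_nonpos_of_nonpos_of_nonneg (not_lt.mp hcon) hpi.le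
    linarith
  have h3 : 0 < k := by exact_mod_cast h2
  obtain ⟨m, hm⟩ := Int.eq_ofNat_of_zero_le (by omega : 0 ≤ k - 1)
  refine hyp ⟨m, ?_⟩
  have h4 : (k : ℝ) = (m : ℝ) + 1 := by
    have : k = (m : ℤ) + 1 := by omega
    rw [this]; push_cast; rfl
  rw [h4, eq_div_iff (by positivity)] at hk
  linarith

theorem one_sub_sq_div_pole_ne_zero {ρ y : ℝ} (hρ : 0 < ρ) (hy : 0 < y) (hyp : y ∉ poles ρ)
    (n : ℕ) : 1 - y ^ 2 / pole ρ n ^ 2 ≠ 0 := by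
  have hp := pole_pos hρ n
  intro h
  have h2 : y ^ 2 = pole ρ n ^ 2 := by field_simp at h; linarith
  exact ne_pole hyp n ((pow_left_inj₀ hy.le hp.le two_ne_zero).mp h2)

theorem summable_log_one_sub_sq {ρ : ℝ} (y : ℝ) :
    Summable fun n : ℕ => Real.log (1 - y ^ 2 / pole ρ n ^ 2) := by
  have h : Summable fun n : ℕ => -(y ^ 2 / pole ρ n ^ 2) := by
    have := (summable_const_div_sq (y ^ 2 / (2 * Real.pi * ρ) ^ 2)).neg
    refine this.congr fun n => ?_
    rw [pole, div_div, ← mul_pow]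
    congr 3
    ring
  simpa [sub_eq_add_neg] using Real.summable_log_one_add_of_summable h

/-- The logarithmic form of Euler's product for the sine. -/
theorem hasSum_log_one_sub_sq {ρ y : ℝ} (hρ : 0 < ρ) (hy : 0 < y) (hyp : y ∉ poles ρ) :
    HasSum (fun n : ℕ => Real.log (1 - y ^ 2 / pole ρ n ^ 2))
      (Real.log (Real.sin (y / (2 * ρ))) - Real.log (y / (2 * ρ))) := by
  have hpi := Real.pi_pos
  have hsin := sin_half_ne_zero hρ hy hyp
  -- Absolute convergence reduces the claim to partial sums, which are logarithms of the partial
  -- Euler products. Signs do not matter, as `Real.log` is `log|·|`.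
  rw [(summable_log_one_sub_sq y).hasSum_iff_tendsto_nat]
  set x := y / (2 * Real.pi * ρ) with hx
  have hpx : Real.pi * x = y / (2 * ρ) := by rw [hx]; field_simp
  have hprod := Real.tendsto_euler_sin_prod x
  rw [hpx] at hprod
  have hv : 0 < y / (2 * ρ) := by positivity
  have h1 := (hprod.log hsin).sub_const (Real.log (y / (2 * ρ)))
  refine h1.congr fun n => ?_
  have e : ∀ j : ℕ, 1 - x ^ 2 / ((j : ℝ) + 1) ^ 2 = 1 - y ^ 2 / pole ρ j ^ 2 := by
    intro j
    rw [hx, pole, div_pow, div_div, ← mul_pow]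
    congr 3
    ring
  simp only [e]
  rw [Real.log_mul hv.ne' (Finset.prod_ne_zero_iff.mpr fun j _ =>
    one_sub_sq_div_pole_ne_zero hρ hy hyp j), Real.log_prod fun j _ =>
    one_sub_sq_div_pole_ne_zero hρ hy hyp j]
  ring

/-- The logarithm of `|sin (y / 2ρ) / (y / 2ρ)|`. -/
noncomputable def logSinc (ρ y : ℝ) : ℝ :=
  Real.log (Real.sin (y / (2 * ρ))) - Real.log (y / (2 * ρ))

theorem measurable_logSinc (ρ : ℝ) : Measurable (logSinc ρ) := by
  have h1 : Measurable fun y : ℝ => Real.log (Real.sin (y / (2 * ρ))) :=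
    Real.measurable_log.comp (by fun_prop)
  have h2 : Measurable fun y : ℝ => Real.log (y / (2 * ρ)) :=
    Real.measurable_log.comp (by fun_prop)
  exact h1.sub h2

/-- Tonelli: `∫|f| ≤ ∑ ∫|F n|`. Besides the exchange of sum and integral, this yields the
integrability of the limit. -/
theorem integrable_of_hasSum_of_summable_integral_norm {μ : Measure ℝ} {F : ℕ → ℝ → ℝ} {f : ℝ → ℝ}
    (hF : ∀ n, Integrable (F n) μ) (hs : Summable fun n => ∫ y, ‖F n y‖ ∂μ)
    (hf : AEStronglyMeasurable f μ) (h : ∀ᵐ y ∂μ, HasSum (fun n => F n y) (f y)) :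
    Integrable f μ ∧ HasSum (fun n => ∫ y, F n y ∂μ) (∫ y, f y ∂μ) := by
  refine ⟨⟨hf, ?_⟩, ?_⟩
  · have h1 : ∫⁻ y, ‖f y‖ₑ ∂μ ≤ ∑' n, ∫⁻ y, ‖F n y‖ₑ ∂μ := by
      rw [← lintegral_tsum fun n => (hF n).1.enorm]
      refine lintegral_mono_ae (h.mono fun y hy => ?_)
      rw [← hy.tsum_eq]
      exact enorm_tsum_le_tsum_enorm
    refine h1.trans_lt ?_
    have h2 : ∀ n, ∫⁻ y, ‖F n y‖ₑ ∂μ = ENNReal.ofReal (∫ y, ‖F n y‖ ∂μ) := fun n =>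
      (ofReal_integral_norm_eq_lintegral_enorm (hF n)).symm
    simp only [h2]
    exact hs.tsum_ofReal_lt_top
  · have h1 := hasSum_integral_of_summable_integral_norm hF hs
    rwa [integral_congr_ae (h.mono fun y hy => hy.tsum_eq)] at h1

/-- The real parts of the boundary values of `binetTerm`. -/
noncomputable def logIntegral (W : ℝ) : ℝ :=
  ∫ y in Ioi (0 : ℝ), Real.exp (-y) * Real.log (1 - y ^ 2 / W ^ 2)

theorem binetSeriesTerm_mul_I {ρ : ℝ} (hρ : 0 < ρ) (n : ℕ) :
    binetSeriesTerm (ρ * Complex.I) n =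
      (logIntegral (pole ρ n) : ℂ) - Real.exp (-pole ρ n) * (Real.pi * Complex.I) := by
  rw [binetSeriesTerm, logIntegral, ← binetTerm_mul_I (pole_pos hρ n)]
  congr 1
  rw [pole]
  push_cast
  ring

theorem hasSum_exp_neg_pole {ρ : ℝ} (hρ : 0 < ρ) :
    HasSum (fun n : ℕ => Real.exp (-pole ρ n)) (1 / (Real.exp (2 * Real.pi * ρ) - 1)) := by
  have hpi := Real.pi_pos
  have hq : Real.exp (-(2 * Real.pi * ρ)) < 1 := Real.exp_lt_one_iff.mpr (neg_lt_zero.mpr (by positivity))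
  have h := (hasSum_geometric_of_lt_one (Real.exp_nonneg _) hq).mul_left
    (Real.exp (-(2 * Real.pi * ρ)))
  convert! h using 1
  · funext n
    rw [← Real.exp_nat_mul, ← Real.exp_add, pole]
    congr 1
    ring
  · rw [Real.exp_neg]
    have h1 : 1 < Real.exp (2 * Real.pi * ρ) := Real.one_lt_exp_iff.mpr (by positivity)
    have h2 : Real.exp (2 * Real.pi * ρ) - 1 ≠ 0 := by linarith
    generalize Real.exp (2 * Real.pi * ρ) = E at *
    have h3 : E ≠ 0 := by linarith
    have h4 : 1 - E⁻¹ = (E - 1) / E := by field_simp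
    rw [h4]
    field_simp

/-- These are the real parts of the terms of Binet's series, already known to converge on the
imaginary axis. -/
theorem summable_logIntegral {ρ : ℝ} (hρ : 0 < ρ) : Summable fun n => logIntegral (pole ρ n) := by
  have h := summable_binetSeriesTerm (z := (ρ : ℂ) * Complex.I) (by simp)
  have h1 := (Complex.hasSum_re h.hasSum).summable
  refine h1.congr fun n => ?_
  rw [binetSeriesTerm_mul_I hρ, ← mul_assoc, ← Complex.ofReal_mul, Complex.sub_re,
    Complex.re_ofReal_mul, Complex.I_re, Complex.ofReal_re, mul_zero, sub_zero]

theorem log_one_sub_le {x : ℝ} (hx : 0 ≤ x) : Real.log (1 - x) ≤ x := by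
  rcases eq_or_ne (1 - x) 0 with h | h
  · rw [h, Real.log_zero]; exact hx
  · rw [← Real.log_abs]
    have h1 := Real.log_le_sub_one_of_pos (abs_pos.mpr h)
    have h2 : |1 - x| ≤ 1 + x := by rw [abs_le]; constructor <;> linarith
    linarith

/-- From `log|1-x| ≤ x` for `x ≥ 0` follows `|log|1-x|| ≤ 2x - log|1-x|`, so summability of the
signed integrals implies that of the absolute ones. The constant `4` is `2 · 2!`, from `∫ y² e^{-y}
dy`. -/
theorem summable_integral_abs_log {ρ : ℝ} (hρ : 0 < ρ) :
    Summable fun n => ∫ y in Ioi (0 : ℝ),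
      ‖Real.exp (-y) * Real.log (1 - y ^ 2 / pole ρ n ^ 2)‖ := by
  have hsq : Summable fun n : ℕ => 4 * (pole ρ n ^ 2)⁻¹ := by
    refine (summable_const_div_sq (4 / (2 * Real.pi * ρ) ^ 2)).congr fun n => ?_
    rw [pole, div_div, ← mul_pow, div_eq_mul_inv]
    congr 3
    ring
  refine Summable.of_nonneg_of_le (fun n => integral_nonneg fun y => norm_nonneg _) (fun n => ?_)
    (hsq.sub (summable_logIntegral hρ))
  have hp := pole_pos hρ n
  have i1 := integrableOn_exp_neg_mul_log_one_sub hp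
  have i2 := (integrableOn_pow_mul_exp_neg 2).const_mul (2 * (pole ρ n ^ 2)⁻¹)
  have e : 4 * (pole ρ n ^ 2)⁻¹ - logIntegral (pole ρ n) =
      ∫ y in Ioi (0 : ℝ), (2 * (pole ρ n ^ 2)⁻¹ * (y ^ 2 * Real.exp (-y)) -
        Real.exp (-y) * Real.log (1 - y ^ 2 / pole ρ n ^ 2)) := by
    rw [integral_sub i2 i1, integral_const_mul, integral_pow_mul_exp_neg, logIntegral]
    norm_num
    ring
  rw [e]
  refine setIntegral_mono_on i1.norm (i2.sub i1) measurableSet_Ioi fun y hy => ?_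
  have h1 := log_one_sub_le (x := y ^ 2 / pole ρ n ^ 2) (by positivity)
  have h2 : 0 ≤ y ^ 2 / pole ρ n ^ 2 := by positivity
  rw [norm_mul, Real.norm_of_nonneg (Real.exp_nonneg _), Real.norm_eq_abs]
  have h3 : |Real.log (1 - y ^ 2 / pole ρ n ^ 2)| ≤
      2 * (y ^ 2 / pole ρ n ^ 2) - Real.log (1 - y ^ 2 / pole ρ n ^ 2) := by
    rw [abs_le]; constructor <;> linarith
  refine (mul_le_mul_of_nonneg_left h3 (Real.exp_nonneg _)).trans (le_of_eq ?_)
  field_simp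

theorem integrableOn_exp_neg_mul_logSinc_and_hasSum {ρ : ℝ} (hρ : 0 < ρ) :
    IntegrableOn (fun y : ℝ => Real.exp (-y) * logSinc ρ y) (Ioi 0) ∧
      HasSum (fun n => logIntegral (pole ρ n))
        (∫ y in Ioi (0 : ℝ), Real.exp (-y) * logSinc ρ y) := by
  refine integrable_of_hasSum_of_summable_integral_norm
    (fun n => integrableOn_exp_neg_mul_log_one_sub (pole_pos hρ n)) (summable_integral_abs_log hρ)
    ?_ ?_
  · have := measurable_logSinc ρ
    exact Measurable.aestronglyMeasurable (by fun_prop)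
  · filter_upwards [ae_notMem_poles ρ (Ioi 0), ae_restrict_mem measurableSet_Ioi] with y hyp hy
    exact (hasSum_log_one_sub_sq hρ hy hyp).mul_left _

theorem hasSum_binetSeriesTerm_mul_I {ρ : ℝ} (hρ : 0 < ρ) :
    HasSum (binetSeriesTerm (ρ * Complex.I))
      (((∫ y in Ioi (0 : ℝ), Real.exp (-y) * logSinc ρ y : ℝ) : ℂ) -
        1 / (Complex.exp (2 * Real.pi * ρ) - 1) * (Real.pi * Complex.I)) := by
  rw [funext (binetSeriesTerm_mul_I hρ)]
  have h1 := Complex.hasSum_ofReal.mpr (integrableOn_exp_neg_mul_logSinc_and_hasSum hρ).2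
  have h2 := (Complex.hasSum_ofReal.mpr (hasSum_exp_neg_pole hρ)).mul_right
    ((Real.pi : ℂ) * Complex.I)
  convert! h1.sub h2 using 3
  push_cast
  rfl

theorem hasSum_binetSeriesTerm_neg_mul_I {ρ : ℝ} (hρ : 0 < ρ) :
    HasSum (binetSeriesTerm (-(ρ * Complex.I)))
      (((∫ y in Ioi (0 : ℝ), Real.exp (-y) * logSinc ρ y : ℝ) : ℂ) +
        1 / (Complex.exp (2 * Real.pi * ρ) - 1) * (Real.pi * Complex.I)) := by
  have h := Complex.hasSum_conj'.mpr (hasSum_binetSeriesTerm_mul_I hρ)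
  convert! h using 1
  · funext n
    rw [binetSeriesTerm, binetSeriesTerm, ← binetTerm_conj]
    simp [map_ofNat (starRingEnd ℂ) 2]
  · simp [← Complex.exp_conj, map_ofNat (starRingEnd ℂ) 2]

/-- Binet's formula on the imaginary axis, with the exponentially small term that is switched on
there. -/
theorem digamma_mul_I {ρ σ : ℝ} (hρ : 0 < ρ) (hσ : σ = 1 ∨ σ = -1) :
    Complex.digamma (σ * ρ * Complex.I) =
      Complex.log (σ * ρ * Complex.I) - 1 / (2 * (σ * ρ * Complex.I)) -
        ((∫ y in Ioi (0 : ℝ), Real.exp (-y) * logSinc ρ y : ℝ) : ℂ) +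
        σ / (Complex.exp (2 * Real.pi * ρ) - 1) * (Real.pi * Complex.I) := by
  have hne : (σ : ℂ) * ρ * Complex.I ≠ 0 := by
    have h1 : (ρ : ℂ) ≠ 0 := by exact_mod_cast hρ.ne'
    have h2 : (σ : ℂ) ≠ 0 := by rcases hσ with rfl | rfl <;> simp
    exact mul_ne_zero (mul_ne_zero h2 h1) Complex.I_ne_zero
  rw [digamma_eq_binet_of_re_eq_zero (by simp [mul_assoc]) hne]
  rcases hσ with rfl | rfl
  · simp only [Complex.ofReal_one, one_mul]
    rw [(hasSum_binetSeriesTerm_mul_I hρ).tsum_eq]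
    ring
  · simp only [Complex.ofReal_neg, Complex.ofReal_one, neg_mul, one_mul]
    rw [(hasSum_binetSeriesTerm_neg_mul_I hρ).tsum_eq]
    ring

/-! ### The excised half-line and integration by parts on it -/

theorem mem_excised_poles {ρ ε y : ℝ} :
    y ∈ excised (poles ρ) ε ↔ 0 < y ∧ ∀ n, ε < |y - pole ρ n| :=
  and_congr_right fun _ => ⟨fun h n => h _ ⟨n, rfl⟩, by rintro h p ⟨n, rfl⟩; exact h n⟩

theorem measurableSet_excised (ρ ε : ℝ) : MeasurableSet (excised (poles ρ) ε) := by
  have : excised (poles ρ) ε = Ioi 0 ∩ ⋂ n, {y | ε < |y - pole ρ n|} := by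
    ext y; simp [mem_excised_poles]
  rw [this]
  exact measurableSet_Ioi.inter
    (MeasurableSet.iInter fun n => measurableSet_lt measurable_const (by fun_prop))

theorem excised_subset_Ioi (S : Set ℝ) (ε : ℝ) : excised S ε ⊆ Ioi 0 := fun _ hy => hy.1

theorem notMem_of_mem_excised {S : Set ℝ} {ε y : ℝ} (hε : 0 < ε) (hy : y ∈ excised S ε) :
    y ∉ S := fun h => by
  have := hy.2 y h
  simp at this
  linarith

/-- The poles lie on the lattice `2πρℤ`, so the distance of `y / (2πρ)` to its nearest integer
serves for all of them at once. -/
theorem exists_le_abs_sub_pole {ρ y : ℝ} (hρ : 0 < ρ) (hy : 0 < y) (hyp : y ∉ poles ρ) :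
    ∃ δ > 0, ∀ n, δ ≤ |y - pole ρ n| := by
  have hpi := Real.pi_pos
  have hd : 0 < 2 * Real.pi * ρ := by positivity
  set x := y / (2 * Real.pi * ρ) with hx
  have hne : x - round x ≠ 0 := by
    intro h
    have hsin := sin_half_ne_zero hρ hy hyp
    have : y / (2 * ρ) = (round x : ℝ) * Real.pi := by
      rw [← sub_eq_zero.mp h, hx]; field_simp
    rw [this, Real.sin_int_mul_pi] at hsin
    exact hsin rfl
  refine ⟨2 * Real.pi * ρ * |x - round x|, mul_pos hd (abs_pos.mpr hne), fun n => ?_⟩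
  have h := round_le x ((n : ℤ) + 1)
  have e : y - pole ρ n = 2 * Real.pi * ρ * (x - ((n : ℤ) + 1 : ℤ)) := by
    rw [hx, pole]; push_cast; field_simp
  rw [e, abs_mul, abs_of_pos hd]
  exact mul_le_mul_of_nonneg_left h hd.le

/-- Dominated convergence: every `y` that is not a pole belongs to the excised sets from some `ε`
on, and the poles form a null set. -/
theorem tendsto_setIntegral_excised {ρ : ℝ} (hρ : 0 < ρ) {H : ℝ → ℝ}
    (hH : IntegrableOn H (Ioi 0)) :
    Tendsto (fun ε => ∫ y in excised (poles ρ) ε, H y) (𝓝[>] 0) (𝓝 (∫ y in Ioi 0, H y)) := by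
  have e : ∀ ε, ∫ y in excised (poles ρ) ε, H y =
      ∫ y in Ioi 0, (excised (poles ρ) ε).indicator H y := fun ε => by
    rw [setIntegral_indicator (measurableSet_excised ρ ε),
      inter_eq_right.mpr (excised_subset_Ioi _ ε)]
  simp only [e]
  refine tendsto_integral_filter_of_dominated_convergence (fun y => ‖H y‖)
    (Eventually.of_forall fun ε => hH.1.indicator (measurableSet_excised ρ ε))
    (Eventually.of_forall fun ε => Eventually.of_forall fun y => norm_indicator_le_norm_self H y)
    hH.norm ?_
  filter_upwards [ae_notMem_poles ρ (Ioi 0), ae_restrict_mem measurableSet_Ioi] with y hyp hy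
  obtain ⟨δ, hδ, h⟩ := exists_le_abs_sub_pole hρ hy hyp
  refine tendsto_const_nhds.congr' ?_
  filter_upwards [mem_nhdsWithin_of_mem_nhds (Iio_mem_nhds hδ)] with ε hε
  rw [indicator_of_mem]
  exact mem_excised_poles.mpr ⟨hy, fun n => lt_of_lt_of_le hε (h n)⟩

/-- `F` is integrable outside the neighbourhoods of the points of `S`, with an integral of the
form `A / ε + L + o(1)`. -/
def HasExpansion (F : ℝ → ℝ) (S : Set ℝ) (A L : ℝ) : Prop :=
  (∀ ε : ℝ, 0 < ε → IntegrableOn F (excised S ε)) ∧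
    Tendsto (fun ε : ℝ => (∫ y in excised S ε, F y) - A / ε) (𝓝[>] 0) (𝓝 L)

theorem HasExpansion.hasFinitePart {F : ℝ → ℝ} {S : Set ℝ} {A L : ℝ} (h : HasExpansion F S A L) :
    HasFinitePart F S L := ⟨h.1, A, h.2⟩

theorem HasExpansion.hasPrincipalValue {F : ℝ → ℝ} {S : Set ℝ} {L : ℝ}
    (h : HasExpansion F S 0 L) : HasPrincipalValue F S L := ⟨h.1, by simpa using h.2⟩

/-- The excised sets avoid the poles, so an identity valid off the poles suffices. This is how
partial fractions and the recurrence in `N` reach the regularized integrals. -/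
theorem HasExpansion.linearCombination {ρ : ℝ} {F G E : ℝ → ℝ} {A B L L' : ℝ} (a b : ℝ)
    (hF : HasExpansion F (poles ρ) A L) (hG : HasExpansion G (poles ρ) B L')
    (hE : ∀ y, 0 < y → y ∉ poles ρ → E y = a * F y + b * G y) :
    HasExpansion E (poles ρ) (a * A + b * B) (a * L + b * L') := by
  have hE' : ∀ ε, 0 < ε → EqOn (fun y => a * F y + b * G y) E (excised (poles ρ) ε) :=
    fun ε hε y hy => (hE y hy.1 (notMem_of_mem_excised hε hy)).symm
  refine ⟨fun ε hε => IntegrableOn.congr_fun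
    (((hF.1 ε hε).const_mul a).add ((hG.1 ε hε).const_mul b)) (hE' ε hε)
    (measurableSet_excised ρ ε), ?_⟩
  refine ((hF.2.const_mul a).add (hG.2.const_mul b)).congr' ?_
  filter_upwards [self_mem_nhdsWithin] with ε hε
  rw [← setIntegral_congr_fun (measurableSet_excised ρ ε) (hE' ε hε),
    integral_add ((hF.1 ε hε).const_mul a) ((hG.1 ε hε).const_mul b), integral_const_mul,
    integral_const_mul]
  ring

theorem hasExpansion_of_integrableOn {ρ : ℝ} (hρ : 0 < ρ) {H : ℝ → ℝ}
    (hH : IntegrableOn H (Ioi 0)) : HasExpansion H (poles ρ) 0 (∫ y in Ioi 0, H y) :=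
  ⟨fun ε _ => hH.mono_set (excised_subset_Ioi _ ε), by
    simpa using tendsto_setIntegral_excised hρ hH⟩

theorem pole_add_notMem_poles {ρ t : ℝ} (n : ℕ) (ht : t ≠ 0) (ht' : |t| < 2 * Real.pi * ρ) :
    pole ρ n + t ∉ poles ρ := by
  rintro ⟨m, hm⟩
  have e : t = 2 * Real.pi * ρ * (((m : ℤ) - (n : ℤ) : ℤ) : ℝ) := by
    rw [pole] at hm; push_cast; linarith
  have hd : 0 < 2 * Real.pi * ρ := (abs_nonneg t).trans_lt ht'
  have h0 : (m : ℤ) - n ≠ 0 := by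
    intro h; rw [h] at e; simp at e; exact ht e
  have h1 : (1 : ℝ) ≤ |(((m : ℤ) - (n : ℤ) : ℤ) : ℝ)| := by
    rw [← Int.cast_abs]
    exact_mod_cast Int.one_le_abs h0
  rw [e, abs_mul, abs_of_pos hd] at ht'
  have := mul_le_mul_of_nonneg_left h1 hd.le
  linarith

/-- The left end of the `n`-th component of the excised half-line. -/
noncomputable def gapLeft (ρ ε : ℝ) : ℕ → ℝ
  | 0 => 0
  | n + 1 => pole ρ n + ε

theorem pole_succ (ρ : ℝ) (n : ℕ) : pole ρ (n + 1) = pole ρ n + 2 * Real.pi * ρ := by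
  rw [pole, pole]; push_cast; ring

theorem monotone_pole {ρ : ℝ} (hρ : 0 < ρ) : Monotone (pole ρ) := by
  have hpi := Real.pi_pos
  refine monotone_nat_of_le_succ fun n => ?_
  rw [pole_succ]
  have : 0 < 2 * Real.pi * ρ := by positivity
  linarith

theorem excised_poles_eq_iUnion {ρ ε : ℝ} (hρ : 0 < ρ) (hε : 0 < ε) :
    excised (poles ρ) ε = ⋃ n, Ioo (gapLeft ρ ε n) (pole ρ n - ε) := by
  have hpi := Real.pi_pos
  have hd : 0 < 2 * Real.pi * ρ := by positivity
  ext y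
  rw [mem_excised_poles, mem_iUnion]
  constructor
  · rintro ⟨hy, h⟩
    have h1 := Nat.floor_le (div_nonneg hy.le hd.le)
    have h2 := Nat.lt_floor_add_one (y / (2 * Real.pi * ρ))
    -- The number of poles not exceeding `y`, hence the index of its gap.
    set n := ⌊y / (2 * Real.pi * ρ)⌋₊
    rw [le_div_iff₀ hd] at h1
    rw [div_lt_iff₀ hd] at h2
    refine ⟨n, ?_, ?_⟩
    · clear_value n
      cases n with
      | zero => exact hy
      | succ n =>
        have h3 := h n
        push_cast at h1
        rw [abs_of_nonneg (by rw [pole]; linarith)] at h3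
        rw [gapLeft]; linarith
    · have h3 := h n
      rw [abs_of_nonpos (by rw [pole]; linarith)] at h3
      linarith
  · rintro ⟨n, h1, h2⟩
    constructor
    · cases n with
      | zero => exact h1
      | succ n =>
        rw [gapLeft] at h1
        have := pole_pos hρ n
        linarith
    · intro m
      rcases le_or_gt n m with h | h
      · have := monotone_pole hρ h
        rw [abs_of_nonpos (by linarith)]; linarith
      · cases n with
        | zero => omega
        | succ n =>
          have := monotone_pole hρ (Nat.lt_succ_iff.mp h)
          rw [gapLeft] at h1
          rw [abs_of_nonneg (by linarith)]; linarith

theorem pairwise_disjoint_gap {ρ ε : ℝ} (hρ : 0 < ρ) (hε : 0 < ε) :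
    Pairwise (Function.onFun Disjoint fun n => Ioo (gapLeft ρ ε n) (pole ρ n - ε)) := by
  refine (pairwise_disjoint_on _).mpr fun m n hmn => ?_
  rw [disjoint_left]
  rintro y ⟨_, h1⟩ ⟨h2, _⟩
  cases n with
  | zero => omega
  | succ n =>
    have := monotone_pole hρ (Nat.lt_succ_iff.mp hmn)
    rw [gapLeft] at h2
    linarith

theorem gapLeft_lt {ρ ε : ℝ} (hρ : 0 < ρ) (hε' : ε < Real.pi * ρ) (n : ℕ) :
    gapLeft ρ ε n < pole ρ n - ε := by
  have hpi := Real.pi_pos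
  have hd : 0 < Real.pi * ρ := by positivity
  cases n with
  | zero => rw [gapLeft, pole]; push_cast; linarith
  | succ n => rw [gapLeft, pole_succ]; linarith

/-- Integration by parts outside the neighbourhoods of the poles. -/
theorem setIntegral_excised_eq {ρ ε : ℝ} {U F H : ℝ → ℝ} (hρ : 0 < ρ) (hε : 0 < ε)
    (hε' : ε < Real.pi * ρ)
    (hU : ∀ y, 0 < y → y ∉ poles ρ → HasDerivAt U (F y - H y) y)
    (hF : IntegrableOn F (excised (poles ρ) ε)) (hH : IntegrableOn H (excised (poles ρ) ε))
    (h0 : Tendsto U (𝓝[>] 0) (𝓝 0)) (hs : Summable fun n => U (pole ρ n + ε)) :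
    ∫ y in excised (poles ρ) ε, F y =
      (∫ y in excised (poles ρ) ε, H y) + ∑' n, (U (pole ρ n - ε) - U (pole ρ n + ε)) := by
  have hpi := Real.pi_pos
  have hd : ε < 2 * Real.pi * ρ := by
    have : 0 < Real.pi * ρ := by positivity
    linarith
  have hsub : ∀ n, Ioo (gapLeft ρ ε n) (pole ρ n - ε) ⊆ excised (poles ρ) ε := fun n => by
    rw [excised_poles_eq_iUnion hρ hε]
    exact subset_iUnion (fun n => Ioo (gapLeft ρ ε n) (pole ρ n - ε)) n
  have hcont : ∀ n t, t ≠ 0 → |t| < 2 * Real.pi * ρ → ContinuousAt U (pole ρ n + t) := by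
    intro n t ht ht'
    refine (hU _ ?_ (pole_add_notMem_poles n ht ht')).continuousAt
    have h1 := monotone_pole hρ (Nat.zero_le n)
    have h2 := neg_abs_le t
    have h3 : pole ρ 0 = 2 * Real.pi * ρ := by rw [pole]; push_cast; ring
    linarith
  -- The values of `U` at the left ends of the gaps: `0` at the origin, then `U (pole ρ n + ε)` with
  -- a shift of index. Undoing the shift regroups the sum over gaps into a sum over poles.
  set ul : ℕ → ℝ := fun n => Nat.casesOn n 0 fun n => U (pole ρ n + ε) with hul
  have hgap : ∀ n, ∫ y in Ioo (gapLeft ρ ε n) (pole ρ n - ε), (F y - H y) =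
      U (pole ρ n - ε) - ul n := by
    intro n
    have hlt := gapLeft_lt hρ hε' n
    rw [← integral_Ioc_eq_integral_Ioo, ← intervalIntegral.integral_of_le hlt.le]
    refine intervalIntegral.integral_eq_sub_of_hasDerivAt_of_tendsto (f := U) hlt (fun y hy => ?_) ?_ ?_ ?_
    · have := hsub n hy
      exact hU y this.1 (notMem_of_mem_excised hε this)
    · rw [intervalIntegrable_iff_integrableOn_Ioo_of_le hlt.le]
      exact (hF.sub hH).mono_set (hsub n)
    · cases n with
      | zero => exact h0
      | succ n =>
        have := hcont n ε hε.ne' (by rwa [abs_of_pos hε])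
        exact this.tendsto.mono_left nhdsWithin_le_nhds
    · have := hcont n (-ε) (neg_ne_zero.mpr hε.ne') (by rwa [abs_neg, abs_of_pos hε])
      exact this.tendsto.mono_left nhdsWithin_le_nhds
  have hsum : HasSum (fun n => U (pole ρ n - ε) - ul n)
      (∫ y in excised (poles ρ) ε, (F y - H y)) := by
    have := hasSum_integral_iUnion (f := fun y => F y - H y) (μ := volume)
      (fun n => measurableSet_Ioo) (pairwise_disjoint_gap hρ hε)
      (by rw [← excised_poles_eq_iUnion hρ hε]; exact hF.sub hH)
    rw [← excised_poles_eq_iUnion hρ hε] at this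
    simpa only [hgap] using this
  have hul' : HasSum ul (∑' n, U (pole ρ n + ε)) := by
    have := (hasSum_nat_add_iff (f := ul) 1).mp hs.hasSum
    simpa [hul] using this
  have h1 := hsum.add hul'
  simp only [sub_add_cancel] at h1
  have h2 := (h1.sub hs.hasSum).tsum_eq
  rw [h2, integral_sub hF hH]
  ring

/-! ### Cotangent expansions off the poles and behaviour at the origin -/

theorem one_div_pole_sq (ρ : ℝ) (n : ℕ) :
    1 / pole ρ n ^ 2 = 1 / (2 * Real.pi * ρ) ^ 2 / ((n : ℝ) + 1) ^ 2 := by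
  rw [pole, div_div, ← mul_pow]
  congr 2
  ring

/-- For a pole `p`, `p ≤ |y-p| + y` and `y ≤ |y-p| · y/δ`, so `p ≤ |y-p|(1 + y/δ)`; moreover `p ≤ y
+ p`. The bound decays like `n⁻²` and grows only linearly in `y`. -/
theorem abs_one_div_sub_sq_le {ρ y δ : ℝ} (hρ : 0 < ρ) (hy : 0 < y) (hδ : 0 < δ) {n : ℕ}
    (h : δ ≤ |y - pole ρ n|) :
    |1 / (y ^ 2 - pole ρ n ^ 2)| ≤ (1 + y / δ) * (1 / pole ρ n ^ 2) := by
  have hp := pole_pos hρ n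
  have h1 : pole ρ n ≤ |y - pole ρ n| * (1 + y / δ) := by
    have h2 : y ≤ |y - pole ρ n| * (y / δ) := by
      rw [mul_div_assoc', le_div_iff₀ hδ, mul_comm]
      exact mul_le_mul_of_nonneg_right h hy.le
    have h3 := neg_abs_le (y - pole ρ n)
    linarith
  have h4 : |y ^ 2 - pole ρ n ^ 2| = |y - pole ρ n| * (y + pole ρ n) := by
    rw [← abs_of_pos (add_pos hy hp), ← abs_mul]
    congr 1
    ring
  have h0 : 0 < |y - pole ρ n| := hδ.trans_le h
  have hq : 0 < 1 + y / δ := by positivity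
  rw [abs_div, abs_one, h4, mul_one_div, div_le_div_iff₀ (by positivity) (by positivity)]
  calc 1 * pole ρ n ^ 2 = pole ρ n * pole ρ n := by ring
    _ ≤ (|y - pole ρ n| * (1 + y / δ)) * (y + pole ρ n) :=
      mul_le_mul h1 (by linarith) hp.le (by positivity)
    _ = _ := by ring

theorem abs_one_div_sub_sq_le' {ρ y δ : ℝ} (hρ : 0 < ρ) (hy : 0 < y) (hδ : 0 < δ) {n : ℕ}
    (h : δ ≤ |y - pole ρ n|) :
    |1 / (y ^ 2 - pole ρ n ^ 2)| ≤
      (1 + y / δ) * (1 / (2 * Real.pi * ρ) ^ 2) / ((n : ℝ) + 1) ^ 2 := by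
  refine (abs_one_div_sub_sq_le hρ hy hδ h).trans (le_of_eq ?_)
  rw [one_div_pole_sq]
  ring

theorem abs_sq_div_sub_sq_sq_le {ρ y δ : ℝ} (hρ : 0 < ρ) (hy : 0 < y) (hδ : 0 < δ) {n : ℕ}
    (h : δ ≤ |y - pole ρ n|) :
    |((n : ℝ) + 1) ^ 2 / (y ^ 2 - pole ρ n ^ 2) ^ 2| ≤
      ((1 + y / δ) * (1 / (2 * Real.pi * ρ) ^ 2)) ^ 2 / ((n : ℝ) + 1) ^ 2 := by
  have h1 := pow_le_pow_left₀ (abs_nonneg _) (abs_one_div_sub_sq_le' hρ hy hδ h) 2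
  have h2 : (0 : ℝ) < ((n : ℝ) + 1) ^ 2 := by positivity
  have h3 := mul_le_mul_of_nonneg_left h1 h2.le
  have e : |((n : ℝ) + 1) ^ 2 / (y ^ 2 - pole ρ n ^ 2) ^ 2| =
      ((n : ℝ) + 1) ^ 2 * |1 / (y ^ 2 - pole ρ n ^ 2)| ^ 2 := by
    rw [sq_abs, abs_of_nonneg (by positivity), div_pow, one_pow, mul_one_div]
  rw [e]
  refine h3.trans (le_of_eq ?_)
  field_simp

theorem summable_one_div_sub_sq {ρ y : ℝ} (hρ : 0 < ρ) (hy : 0 < y) (hyp : y ∉ poles ρ) :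
    Summable fun n : ℕ => 1 / (y ^ 2 - pole ρ n ^ 2) := by
  obtain ⟨δ, hδ, h⟩ := exists_le_abs_sub_pole hρ hy hyp
  exact (summable_const_div_sq _).of_norm_bounded fun n => abs_one_div_sub_sq_le' hρ hy hδ (h n)

theorem summable_sq_div_sub_sq_sq {ρ y : ℝ} (hρ : 0 < ρ) (hy : 0 < y) (hyp : y ∉ poles ρ) :
    Summable fun n : ℕ => ((n : ℝ) + 1) ^ 2 / (y ^ 2 - pole ρ n ^ 2) ^ 2 := by
  obtain ⟨δ, hδ, h⟩ := exists_le_abs_sub_pole hρ hy hyp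
  exact (summable_const_div_sq _).of_norm_bounded fun n => abs_sq_div_sub_sq_sq_le hρ hy hδ (h n)

theorem sub_sq_ne_zero {ρ y : ℝ} (hρ : 0 < ρ) (hy : 0 < y) (hyp : y ∉ poles ρ) (n : ℕ) :
    y ^ 2 - pole ρ n ^ 2 ≠ 0 := fun h =>
  ne_pole hyp n ((pow_left_inj₀ hy.le (pole_pos hρ n).le two_ne_zero).mp (sub_eq_zero.mp h))

/-- Termwise differentiation off the poles. -/
theorem hasDerivAt_of_hasSum {ρ y₀ : ℝ} (hρ : 0 < ρ) (hy₀ : 0 < y₀) (hyp₀ : y₀ ∉ poles ρ)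
    {f : ℝ → ℝ} {g g' : ℕ → ℝ → ℝ}
    (hg : ∀ n y, 0 < y → y ∉ poles ρ → HasDerivAt (g n) (g' n y) y)
    (hb : ∀ δ Y : ℝ, 0 < δ → 0 < Y → ∃ C, ∀ n y, 0 < y → y ≤ Y → (∀ n, δ ≤ |y - pole ρ n|) →
      |g' n y| ≤ C / ((n : ℝ) + 1) ^ 2)
    (hf : ∀ y, 0 < y → y ∉ poles ρ → HasSum (fun n => g n y) (f y)) :
    HasDerivAt f (∑' n, g' n y₀) y₀ := by
  obtain ⟨δ, hδ, h⟩ := exists_le_abs_sub_pole hρ hy₀ hyp₀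
  -- On the ball of this radius `y` stays positive, below `2y₀`, and at distance at least `δ/2` from
  -- all poles.
  set η := min (δ / 2) (y₀ / 2) with hη
  have hη0 : 0 < η := by positivity
  have hη1 : η ≤ δ / 2 := min_le_left _ _
  have hη2 : η ≤ y₀ / 2 := min_le_right _ _
  have hball : ∀ y ∈ Metric.ball y₀ η, 0 < y ∧ y ≤ 2 * y₀ ∧ ∀ n, δ / 2 ≤ |y - pole ρ n| := by
    intro y hy
    rw [Metric.mem_ball, Real.dist_eq] at hy
    have h1 := abs_lt.mp hy
    refine ⟨by linarith, by linarith, fun n => ?_⟩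
    have h2 := abs_sub_le y₀ y (pole ρ n)
    rw [abs_sub_comm y₀ y] at h2
    have := h n
    linarith
  have hnp : ∀ y ∈ Metric.ball y₀ η, y ∉ poles ρ := by
    rintro y hy ⟨n, hn⟩
    have := (hball y hy).2.2 n
    rw [hn, pole, sub_self, abs_zero] at this
    linarith
  obtain ⟨C, hC⟩ := hb (δ / 2) (2 * y₀) (by positivity) (by positivity)
  have hmem : y₀ ∈ Metric.ball y₀ η := Metric.mem_ball_self hη0
  have hd := hasDerivAt_tsum_of_isPreconnected (summable_const_div_sq C) Metric.isOpen_ball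
    (convex_ball y₀ η).isPreconnected
    (fun n y hy => hg n y (hball y hy).1 (hnp y hy))
    (fun n y hy => hC n y (hball y hy).1 (hball y hy).2.1 (hball y hy).2.2) hmem
    (hf y₀ hy₀ hyp₀).summable hmem
  refine hd.congr_of_eventuallyEq ?_
  filter_upwards [Metric.ball_mem_nhds y₀ hη0] with y hy
  exact (hf y (hball y hy).1 (hnp y hy)).tsum_eq.symm

/-- The derivative of `logSinc`. -/
noncomputable def logSincDeriv (ρ y : ℝ) : ℝ :=
  Real.cos (y / (2 * ρ)) / (2 * ρ * Real.sin (y / (2 * ρ))) - 1 / y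

/-- The second derivative of `logSinc`. -/
noncomputable def logSincDeriv₂ (ρ y : ℝ) : ℝ :=
  1 / y ^ 2 - 1 / (2 * ρ * Real.sin (y / (2 * ρ))) ^ 2

theorem measurable_logSincDeriv (ρ : ℝ) : Measurable (logSincDeriv ρ) := by
  unfold logSincDeriv; fun_prop

theorem measurable_logSincDeriv₂ (ρ : ℝ) : Measurable (logSincDeriv₂ ρ) := by
  unfold logSincDeriv₂; fun_prop

theorem hasDerivAt_logSinc {ρ y : ℝ} (hρ : 0 < ρ) (hy : 0 < y) (hyp : y ∉ poles ρ) :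
    HasDerivAt (logSinc ρ) (logSincDeriv ρ y) y := by
  have hs := sin_half_ne_zero hρ hy hyp
  have hd : HasDerivAt (fun y : ℝ => y / (2 * ρ)) (1 / (2 * ρ)) y :=
    (hasDerivAt_id y).div_const _
  convert! (hd.sin.log hs).sub (hd.log (by positivity)) using 1
  rw [logSincDeriv]
  field_simp

theorem hasDerivAt_logSincDeriv {ρ y : ℝ} (hρ : 0 < ρ) (hy : 0 < y) (hyp : y ∉ poles ρ) :
    HasDerivAt (logSincDeriv ρ) (logSincDeriv₂ ρ y) y := by
  have hs := sin_half_ne_zero hρ hy hyp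
  have hd : HasDerivAt (fun y : ℝ => y / (2 * ρ)) (1 / (2 * ρ)) y :=
    (hasDerivAt_id y).div_const _
  have h1 := (hd.cos.fun_div (hd.sin.const_mul (2 * ρ)) (by positivity)).sub
    ((hasDerivAt_const y (1 : ℝ)).fun_div (hasDerivAt_id y) hy.ne')
  convert! h1 using 1
  rw [logSincDeriv₂]
  have h2 := Real.sin_sq_add_cos_sq (y / (2 * ρ))
  generalize Real.sin (y / (2 * ρ)) = S at *
  generalize Real.cos (y / (2 * ρ)) = T at *
  simp only [id]
  field_simp
  linear_combination y ^ 2 * h2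

theorem hasSum_logSinc {ρ y : ℝ} (hρ : 0 < ρ) (hy : 0 < y) (hyp : y ∉ poles ρ) :
    HasSum (fun n : ℕ => Real.log (1 - y ^ 2 / pole ρ n ^ 2)) (logSinc ρ y) :=
  hasSum_log_one_sub_sq hρ hy hyp

/-- The partial fraction expansion of the cotangent. -/
theorem tsum_one_div_sub_sq {ρ y : ℝ} (hρ : 0 < ρ) (hy : 0 < y) (hyp : y ∉ poles ρ) :
    ∑' n, 1 / (y ^ 2 - pole ρ n ^ 2) = logSincDeriv ρ y / (2 * y) := by
  have h := hasDerivAt_of_hasSum hρ hy hyp (f := logSinc ρ)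
    (g := fun n y => Real.log (1 - y ^ 2 / pole ρ n ^ 2))
    (g' := fun n y => 2 * y * (1 / (y ^ 2 - pole ρ n ^ 2)))
    (fun n y hy hyp => by
      have hp := pole_pos hρ n
      have h1 := one_sub_sq_div_pole_ne_zero hρ hy hyp n
      have h2 := sub_sq_ne_zero hρ hy hyp n
      have hd := ((((hasDerivAt_id y).fun_pow 2).div_const (pole ρ n ^ 2)).const_sub 1).log h1
      convert! hd using 1
      have h3 : 1 - y ^ 2 / pole ρ n ^ 2 = -(y ^ 2 - pole ρ n ^ 2) / pole ρ n ^ 2 := by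
        field_simp; ring
      simp only [id, h3]
      generalize y ^ 2 - pole ρ n ^ 2 = D at *
      field_simp
      norm_num)
    (fun δ Y hδ hY => ⟨2 * Y * ((1 + Y / δ) * (1 / (2 * Real.pi * ρ) ^ 2)), fun n y hy hyY hyδ => by
      have h1 := abs_one_div_sub_sq_le' hρ hy hδ (hyδ n)
      rw [abs_mul, abs_of_pos (by positivity : 0 < 2 * y), mul_div_assoc]
      refine mul_le_mul (by linarith) (h1.trans ?_) (abs_nonneg _) (by positivity)
      gcongr⟩)
    fun y hy hyp => hasSum_logSinc hρ hy hyp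
  have h1 := (hasDerivAt_logSinc hρ hy hyp).unique h
  rw [tsum_mul_left] at h1
  rw [h1]
  field_simp

/-- Differentiate the cotangent expansion once more. Writing `D = y² - p²`, the derivative of `2y/D`
is `2/D - 4y²/D²`, and `y² = D + p²` turns it into `-2/D - 4p²/D²` with `p² = (2πρ)²(n+1)²`. -/
theorem tsum_sq_div_sub_sq_sq {ρ y : ℝ} (hρ : 0 < ρ) (hy : 0 < y) (hyp : y ∉ poles ρ) :
    ∑' n : ℕ, ((n : ℝ) + 1) ^ 2 / (y ^ 2 - pole ρ n ^ 2) ^ 2 =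
      -(logSincDeriv ρ y / y + logSincDeriv₂ ρ y) / (4 * (2 * Real.pi * ρ) ^ 2) := by
  have hpi := Real.pi_pos
  have hsplit : ∀ (n : ℕ) (y : ℝ), 0 < y → y ∉ poles ρ →
      2 * (1 / (y ^ 2 - pole ρ n ^ 2)) - 4 * y ^ 2 * (1 / (y ^ 2 - pole ρ n ^ 2)) ^ 2 =
        -2 * (1 / (y ^ 2 - pole ρ n ^ 2)) - 4 * (2 * Real.pi * ρ) ^ 2 *
          (((n : ℝ) + 1) ^ 2 / (y ^ 2 - pole ρ n ^ 2) ^ 2) := by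
    intro n y hy hyp
    have h1 := sub_sq_ne_zero hρ hy hyp n
    have h2 : (2 * Real.pi * ρ) ^ 2 * ((n : ℝ) + 1) ^ 2 = y ^ 2 - (y ^ 2 - pole ρ n ^ 2) := by
      rw [pole]; ring
    generalize y ^ 2 - pole ρ n ^ 2 = D at *
    have h3 : (4 * (2 * Real.pi * ρ) ^ 2) * (((n : ℝ) + 1) ^ 2 / D ^ 2) =
      4 * (y ^ 2 - D) / D ^ 2 := by rw [← h2]; ring
    rw [h3]
    field_simp
    ring
  have h := hasDerivAt_of_hasSum hρ hy hyp (f := logSincDeriv ρ)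
    (g := fun n y => 2 * y * (1 / (y ^ 2 - pole ρ n ^ 2)))
    (g' := fun n y => -2 * (1 / (y ^ 2 - pole ρ n ^ 2)) - 4 * (2 * Real.pi * ρ) ^ 2 *
          (((n : ℝ) + 1) ^ 2 / (y ^ 2 - pole ρ n ^ 2) ^ 2))
    (fun n y hy hyp => by
      have h2 := sub_sq_ne_zero hρ hy hyp n
      have hd := ((hasDerivAt_id y).const_mul 2).fun_mul ((hasDerivAt_const y (1 : ℝ)).fun_div
        (((hasDerivAt_id y).fun_pow 2).sub_const (pole ρ n ^ 2)) h2)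
      rw [← hsplit n y hy hyp]
      convert! hd using 1
      simp only [id]
      generalize y ^ 2 - pole ρ n ^ 2 = D at *
      field_simp
      norm_num
      try ring)
    (fun δ Y hδ hY => ⟨2 * ((1 + Y / δ) * (1 / (2 * Real.pi * ρ) ^ 2)) + 4 * (2 * Real.pi * ρ) ^ 2 *
        ((1 + Y / δ) * (1 / (2 * Real.pi * ρ) ^ 2)) ^ 2, fun n y hy hyY hyδ => by
      have h1 := abs_one_div_sub_sq_le' hρ hy hδ (hyδ n)
      have h2 := abs_sq_div_sub_sq_sq_le hρ hy hδ (hyδ n)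
      have h3 : (1 + y / δ) * (1 / (2 * Real.pi * ρ) ^ 2) ≤
        (1 + Y / δ) * (1 / (2 * Real.pi * ρ) ^ 2) := by gcongr
      refine (abs_sub _ _).trans ?_
      rw [abs_mul, abs_mul (4 * (2 * Real.pi * ρ) ^ 2), abs_of_neg (by norm_num : (-2 : ℝ) < 0),
        abs_of_pos (by positivity : 0 < 4 * (2 * Real.pi * ρ) ^ 2), neg_neg, add_div,
        mul_div_assoc 2, mul_div_assoc (4 * (2 * Real.pi * ρ) ^ 2)]
      refine add_le_add (mul_le_mul_of_nonneg_left (h1.trans ?_) two_pos.le)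
        (mul_le_mul_of_nonneg_left (h2.trans ?_) (by positivity))
      · gcongr
      · gcongr⟩)
    fun y hy hyp => by
      have h1 := (summable_one_div_sub_sq hρ hy hyp).hasSum.mul_left (2 * y)
      rw [tsum_one_div_sub_sq hρ hy hyp] at h1
      convert! h1 using 1
      field_simp
  have h1 := (hasDerivAt_logSincDeriv hρ hy hyp).unique h
  rw [((summable_one_div_sub_sq hρ hy hyp).mul_left (-2)).tsum_sub
    ((summable_sq_div_sub_sq_sq hρ hy hyp).mul_left _), tsum_mul_left, tsum_mul_left,
    tsum_one_div_sub_sq hρ hy hyp] at h1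
  rw [h1]
  field_simp
  ring

theorem abs_tsum_le_of_hasSum {f g : ℕ → ℝ} {a : ℝ} (hg : HasSum g a) (h : ∀ n, |f n| ≤ g n) :
    |∑' n, f n| ≤ a :=
  tsum_of_norm_bounded (f := f) hg h

/-- With `δ = ε` the growth is polynomial in `y` on the excised set, so the factor `e^{-y}` ensures
absolute convergence. -/
theorem exists_abs_tsum_le {ρ : ℝ} (hρ : 0 < ρ) : ∃ C, 0 ≤ C ∧ ∀ δ y : ℝ, 0 < δ → 0 < y →
    (∀ n, δ ≤ |y - pole ρ n|) →
    |∑' n, 1 / (y ^ 2 - pole ρ n ^ 2)| ≤ (1 + y / δ) * C ∧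
    |∑' n : ℕ, ((n : ℝ) + 1) ^ 2 / (y ^ 2 - pole ρ n ^ 2) ^ 2| ≤ (1 + y / δ) ^ 2 * C := by
  set b : ℝ := 1 / (2 * Real.pi * ρ) ^ 2 with hb
  have hb0 : 0 ≤ b := by positivity
  set T := ∑' n : ℕ, 1 / ((n : ℝ) + 1) ^ 2 with hT
  have hs := (summable_const_div_sq 1).hasSum
  have hT0 : 0 ≤ T := tsum_nonneg fun n => by positivity
  refine ⟨b * T + b ^ 2 * T, by positivity, fun δ y hδ hy h => ⟨?_, ?_⟩⟩
  · have hq : 0 ≤ 1 + y / δ := by positivity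
    refine (abs_tsum_le_of_hasSum (hs.mul_left ((1 + y / δ) * b)) fun n => ?_).trans ?_
    · rw [mul_one_div]; exact abs_one_div_sub_sq_le' hρ hy hδ (h n)
    · rw [mul_assoc]
      refine mul_le_mul_of_nonneg_left ?_ hq
      have : 0 ≤ b ^ 2 * T := by positivity
      linarith
  · refine (abs_tsum_le_of_hasSum (hs.mul_left (((1 + y / δ) * b) ^ 2)) fun n => ?_).trans ?_
    · rw [mul_one_div]; exact abs_sq_div_sub_sq_sq_le hρ hy hδ (h n)
    · rw [mul_pow, mul_assoc]
      refine mul_le_mul_of_nonneg_left ?_ (sq_nonneg _)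
      have : 0 ≤ b * T := by positivity
      linarith

theorem notMem_poles_of_lt {ρ y : ℝ} (hρ : 0 < ρ) (h : y < 2 * Real.pi * ρ) : y ∉ poles ρ := by
  rintro ⟨n, hn⟩
  have h1 := monotone_pole hρ (Nat.zero_le n)
  have h2 : pole ρ 0 = 2 * Real.pi * ρ := by rw [pole]; push_cast; ring
  change y = pole ρ n at hn
  linarith

/-- Below half the first pole the logarithms in the sine product are comparable to `y²/p²`. The
quadratic vanishing removes the boundary terms at `0` and compensates the weight `1/y²`. -/
theorem exists_abs_logSinc_le {ρ : ℝ} (hρ : 0 < ρ) : ∃ C, 0 ≤ C ∧ ∀ y, 0 < y → y < Real.pi * ρ →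
    |logSinc ρ y| ≤ C * y ^ 2 ∧ |logSincDeriv ρ y| ≤ C * y := by
  have hpi := Real.pi_pos
  have ha : 0 < Real.pi * ρ := by positivity
  obtain ⟨C, hC, h⟩ := exists_abs_tsum_le hρ
  set b : ℝ := 1 / (2 * Real.pi * ρ) ^ 2 with hb
  have hb0 : 0 ≤ b := by positivity
  set T := ∑' n : ℕ, 1 / ((n : ℝ) + 1) ^ 2 with hT
  have hs := (summable_const_div_sq 1).hasSum
  have hT0 : 0 ≤ T := tsum_nonneg fun n => by positivity
  refine ⟨2 * b * T + 4 * C, by positivity, fun y hy hya => ?_⟩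
  have hyp := notMem_poles_of_lt hρ (by linarith : y < 2 * Real.pi * ρ)
  have hpole : ∀ n, 2 * (Real.pi * ρ) ≤ pole ρ n := fun n => by
    have h1 := monotone_pole hρ (Nat.zero_le n)
    have h2 : pole ρ 0 = 2 * Real.pi * ρ := by rw [pole]; push_cast; ring
    linarith
  constructor
  · have h1 : |logSinc ρ y| ≤ 2 * y ^ 2 * b * T := by
      rw [← (hasSum_logSinc hρ hy hyp).tsum_eq]
      refine abs_tsum_le_of_hasSum (hs.mul_left (2 * y ^ 2 * b)) fun n => ?_
      have hp := pole_pos hρ n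
      have hx0 : 0 ≤ y ^ 2 / pole ρ n ^ 2 := by positivity
      have hx1 : y ^ 2 / pole ρ n ^ 2 ≤ 1 / 2 := by
        rw [div_le_iff₀ (by positivity)]
        have := hpole n
        nlinarith
      have e : 2 * y ^ 2 * b * (1 / ((n : ℝ) + 1) ^ 2) = 2 * (y ^ 2 / pole ρ n ^ 2) := by
        rw [div_eq_mul_one_div (y ^ 2) (pole ρ n ^ 2), one_div_pole_sq]; ring
      rw [e]
      generalize y ^ 2 / pole ρ n ^ 2 = x at *
      have h2 := log_one_sub_le hx0
      have h3 := Real.one_sub_inv_le_log_of_pos (by linarith : 0 < 1 - x)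
      have h4 : (1 - x)⁻¹ ≤ 1 + 2 * x := by
        rw [inv_le_iff_one_le_mul₀ (by linarith)]
        nlinarith
      rw [abs_le]
      constructor <;> linarith
    have h2 : 0 ≤ 4 * C * y ^ 2 := by positivity
    nlinarith
  · have h1 := (h (Real.pi * ρ) y ha hy fun n => by
      have := hpole n
      rw [abs_of_nonpos (by linarith)]; linarith).1
    rw [tsum_one_div_sub_sq hρ hy hyp, abs_div, abs_of_pos (by positivity : 0 < 2 * y),
      div_le_iff₀ (by positivity)] at h1
    have h2 : y / (Real.pi * ρ) ≤ 1 := (div_le_one ha).mpr hya.le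
    have h3 : (1 + y / (Real.pi * ρ)) * C * (2 * y) ≤ 2 * C * (2 * y) := by gcongr; linarith
    have h4 : 0 ≤ 2 * b * T * y := by positivity
    linarith

theorem tendsto_zero_of_abs_le_mul {f : ℝ → ℝ} {a C : ℝ} (ha : 0 < a)
    (h : ∀ y, 0 < y → y < a → |f y| ≤ C * y) : Tendsto f (𝓝[>] 0) (𝓝 0) := by
  have h1 : Tendsto (fun y : ℝ => C * y) (𝓝[>] 0) (𝓝 0) := by
    have : Tendsto (fun y : ℝ => C * y) (𝓝 0) (𝓝 (C * 0)) := tendsto_id.const_mul C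
    rw [mul_zero] at this
    exact this.mono_left nhdsWithin_le_nhds
  refine squeeze_zero_norm' ?_ h1
  filter_upwards [Ioo_mem_nhdsGT ha] with y hy
  exact h y hy.1 hy.2

theorem tendsto_logSincDeriv {ρ : ℝ} (hρ : 0 < ρ) : Tendsto (logSincDeriv ρ) (𝓝[>] 0) (𝓝 0) := by
  have hpi := Real.pi_pos
  obtain ⟨C, -, h⟩ := exists_abs_logSinc_le hρ
  exact tendsto_zero_of_abs_le_mul (by positivity) fun y hy hya => (h y hy hya).2

theorem tendsto_logSinc_div {ρ : ℝ} (hρ : 0 < ρ) :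
    Tendsto (fun y => logSinc ρ y / y) (𝓝[>] 0) (𝓝 0) := by
  have hpi := Real.pi_pos
  obtain ⟨C, -, h⟩ := exists_abs_logSinc_le hρ
  refine tendsto_zero_of_abs_le_mul (a := Real.pi * ρ) (C := C) (by positivity) fun y hy hya => ?_
  rw [abs_div, abs_of_pos hy, div_le_iff₀ hy]
  have := (h y hy hya).1
  linarith

theorem tendsto_id_nhdsGT_zero : Tendsto (fun y : ℝ => y) (𝓝[>] 0) (𝓝 0) :=
  tendsto_id.mono_left nhdsWithin_le_nhds

theorem tendsto_logSinc {ρ : ℝ} (hρ : 0 < ρ) : Tendsto (logSinc ρ) (𝓝[>] 0) (𝓝 0) := by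
  have h := (tendsto_logSinc_div hρ).mul tendsto_id_nhdsGT_zero
  rw [mul_zero] at h
  refine h.congr' ?_
  filter_upwards [self_mem_nhdsWithin] with y hy
  exact div_mul_cancel₀ _ (ne_of_gt hy)

/-- Up to `ε · logSinc` and a multiple of `ε` this is `ε log ε`. It shows that the logarithmic
divergence at the poles is beaten by increments of order `ε`. -/
theorem tendsto_mul_log_sin {ρ : ℝ} (hρ : 0 < ρ) :
    Tendsto (fun ε => ε * Real.log (Real.sin (ε / (2 * ρ)))) (𝓝[>] 0) (𝓝 0) := by
  have h1 := tendsto_id_nhdsGT_zero.mul (tendsto_logSinc hρ)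
  have h2 : Tendsto (fun x : ℝ => Real.log x * x) (𝓝[>] 0) (𝓝 0) := by
    simpa only [Real.rpow_one] using tendsto_log_mul_rpow_nhdsGT_zero zero_lt_one
  have h3 := tendsto_id_nhdsGT_zero.mul_const (Real.log (2 * ρ))
  have h := (h1.add h2).sub h3
  simp only [mul_zero, zero_mul, add_zero, sub_zero] at h
  refine h.congr' ?_
  filter_upwards [self_mem_nhdsWithin] with y hy
  rw [logSinc, Real.log_div (ne_of_gt hy) (by positivity)]
  ring

theorem integrableOn_excised_exp_mul {ρ ε : ℝ} (hρ : 0 < ρ) (hε : 0 < ε) :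
    IntegrableOn (fun y => Real.exp (-y) * (logSincDeriv ρ y / (2 * y))) (excised (poles ρ) ε) ∧
    IntegrableOn (fun y => Real.exp (-y) * (-(logSincDeriv ρ y / y + logSincDeriv₂ ρ y) /
      (4 * (2 * Real.pi * ρ) ^ 2))) (excised (poles ρ) ε) := by
  have m1 := measurable_logSincDeriv ρ
  have m2 := measurable_logSincDeriv₂ ρ
  obtain ⟨C, hC, h⟩ := exists_abs_tsum_le hρ
  have i0 := (integrableOn_pow_mul_exp_neg 0).mono_set (excised_subset_Ioi (poles ρ) ε)
  have i1 := (integrableOn_pow_mul_exp_neg 1).mono_set (excised_subset_Ioi (poles ρ) ε)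
  have i2 := (integrableOn_pow_mul_exp_neg 2).mono_set (excised_subset_Ioi (poles ρ) ε)
  constructor
  · refine Integrable.mono' (g := fun y => C * (y ^ 0 * Real.exp (-y)) + C / ε *
      (y ^ 1 * Real.exp (-y))) ((i0.const_mul _).add (i1.const_mul _)) (Measurable.aestronglyMeasurable (by fun_prop)) ?_
    filter_upwards [ae_restrict_mem (measurableSet_excised ρ ε)] with y hy
    have h1 := (h ε y hε hy.1 fun n => ((mem_excised_poles.mp hy).2 n).le).1
    rw [tsum_one_div_sub_sq hρ hy.1 (notMem_of_mem_excised hε hy)] at h1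
    rw [norm_mul, Real.norm_of_nonneg (Real.exp_nonneg _), Real.norm_eq_abs]
    refine (mul_le_mul_of_nonneg_left h1 (Real.exp_nonneg _)).trans (le_of_eq ?_)
    ring
  · refine Integrable.mono' (g := fun y => C * (y ^ 0 * Real.exp (-y)) + 2 * C / ε *
      (y ^ 1 * Real.exp (-y)) + C / ε ^ 2 * (y ^ 2 * Real.exp (-y)))
      (((i0.const_mul _).add (i1.const_mul _)).add (i2.const_mul _)) (Measurable.aestronglyMeasurable (by fun_prop)) ?_
    filter_upwards [ae_restrict_mem (measurableSet_excised ρ ε)] with y hy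
    have h1 := (h ε y hε hy.1 fun n => ((mem_excised_poles.mp hy).2 n).le).2
    rw [tsum_sq_div_sub_sq_sq hρ hy.1 (notMem_of_mem_excised hε hy)] at h1
    rw [norm_mul, Real.norm_of_nonneg (Real.exp_nonneg _), Real.norm_eq_abs]
    refine (mul_le_mul_of_nonneg_left h1 (Real.exp_nonneg _)).trans (le_of_eq ?_)
    field_simp
    ring

theorem integrableOn_excised_exp_mul_logSincDeriv₂ {ρ ε : ℝ} (hρ : 0 < ρ) (hε : 0 < ε) :
    IntegrableOn (fun y => Real.exp (-y) * (logSincDeriv₂ ρ y / 2)) (excised (poles ρ) ε) := by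
  have hpi := Real.pi_pos
  obtain ⟨h1, h2⟩ := integrableOn_excised_exp_mul hρ hε
  refine IntegrableOn.congr_fun ((h1.const_mul (-1)).sub (h2.const_mul (2 * (2 * Real.pi * ρ) ^ 2)))
    (fun y hy => ?_) (measurableSet_excised ρ ε)
  have := hy.1.ne'
  simp only [Pi.sub_apply]
  field_simp
  ring

/-! ### Boundary sums over the poles -/

theorem two_mul_le_pole {ρ : ℝ} (hρ : 0 < ρ) (n : ℕ) : 2 * (Real.pi * ρ) ≤ pole ρ n := by
  have h1 := monotone_pole hρ (Nat.zero_le n)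
  have h2 : pole ρ 0 = 2 * Real.pi * ρ := by rw [pole]; push_cast; ring
  linarith

theorem mul_exp_neg_le {B y p : ℝ} (hB : 0 ≤ B) (h : p / 2 ≤ y) :
    B * y * Real.exp (-y) ≤ 2 * B * Real.exp (-(p / 4)) := by
  have h1 := Real.add_one_le_exp (y / 2)
  have h2 : y * Real.exp (-y) ≤ 2 * Real.exp (-(y / 2)) := by
    have e : Real.exp (-y) = Real.exp (-(y / 2)) * Real.exp (-(y / 2)) := by
      rw [← Real.exp_add]; ring_nf
    have h3 : Real.exp (y / 2) * Real.exp (-(y / 2)) = 1 := by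
      rw [← Real.exp_add, add_neg_cancel, Real.exp_zero]
    rw [e, ← mul_assoc]
    refine mul_le_mul_of_nonneg_right ?_ (Real.exp_nonneg _)
    have h4 : y ≤ 2 * Real.exp (y / 2) := by linarith
    calc y * Real.exp (-(y / 2)) ≤ 2 * Real.exp (y / 2) * Real.exp (-(y / 2)) :=
          mul_le_mul_of_nonneg_right h4 (Real.exp_nonneg _)
      _ = 2 := by rw [mul_assoc, h3, mul_one]
  have h5 : Real.exp (-(y / 2)) ≤ Real.exp (-(p / 4)) := Real.exp_le_exp.mpr (by linarith)
  calc B * y * Real.exp (-y) = B * (y * Real.exp (-y)) := by ring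
    _ ≤ B * (2 * Real.exp (-(p / 4))) := mul_le_mul_of_nonneg_left (by linarith) hB
    _ = _ := by ring

theorem summable_exp_neg_pole_div {ρ : ℝ} (hρ : 0 < ρ) :
    Summable fun n => Real.exp (-(pole ρ n / 4)) := by
  refine (hasSum_exp_neg_pole (by positivity : 0 < ρ / 4)).summable.congr fun n => ?_
  rw [pole, pole]
  ring_nf

/-- The sums over the poles of the increments of a rapidly decreasing function. -/
theorem exists_abs_tsum_increment_le {ρ B : ℝ} (hρ : 0 < ρ) (hB : 0 ≤ B) {w w' : ℝ → ℝ}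
    (hd : ∀ y, Real.pi * ρ ≤ y → HasDerivAt w (w' y) y)
    (hw : ∀ y, Real.pi * ρ ≤ y → |w y| ≤ B * y) (hw' : ∀ y, Real.pi * ρ ≤ y → |w' y| ≤ B * y) :
    ∃ K, ∀ ε, 0 < ε → ε < Real.pi * ρ →
      (Summable fun n => Real.exp (-(pole ρ n + ε)) * w (pole ρ n + ε)) ∧
      (Summable fun n => Real.exp (-(pole ρ n - ε)) * w (pole ρ n - ε)) ∧
      |∑' n, (Real.exp (-(pole ρ n - ε)) * w (pole ρ n - ε) -
        Real.exp (-(pole ρ n + ε)) * w (pole ρ n + ε))| ≤ K * ε := by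
  have hE := summable_exp_neg_pole_div hρ
  have hval : ∀ n y, pole ρ n / 2 ≤ y → |Real.exp (-y) * w y| ≤
      2 * B * Real.exp (-(pole ρ n / 4)) := by
    intro n y hy
    have := two_mul_le_pole hρ n
    rw [abs_mul, abs_of_pos (Real.exp_pos _), mul_comm]
    exact (mul_le_mul_of_nonneg_right (hw y (by linarith)) (Real.exp_nonneg _)).trans
      (mul_exp_neg_le hB hy)
  refine ⟨8 * B * ∑' n, Real.exp (-(pole ρ n / 4)), fun ε hε hε' => ⟨?_, ?_, ?_⟩⟩
  · refine (hE.mul_left (2 * B)).of_norm_bounded fun n => hval n _ ?_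
    have := two_mul_le_pole hρ n
    linarith
  · refine (hE.mul_left (2 * B)).of_norm_bounded fun n => hval n _ ?_
    have := two_mul_le_pole hρ n
    linarith
  · have h := abs_tsum_le_of_hasSum (hE.hasSum.mul_left (8 * B * ε)) (f := fun n =>
      Real.exp (-(pole ρ n - ε)) * w (pole ρ n - ε) -
        Real.exp (-(pole ρ n + ε)) * w (pole ρ n + ε)) fun n => ?_
    · refine h.trans (le_of_eq (by ring))
    have hp := two_mul_le_pole hρ n
    -- Mean value inequality on an interval of length `2ε`. The derivative bound is `2B + 2B` from
    -- the two terms of the product rule, hence `8Bε` in all.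
    have hbd := (convex_Icc (pole ρ n - ε) (pole ρ n + ε)).norm_image_sub_le_of_norm_hasDerivWithin_le
      (f := fun y => Real.exp (-y) * w y)
      (f' := fun y => Real.exp (-y) * -1 * w y + Real.exp (-y) * w' y)
      (C := 4 * B * Real.exp (-(pole ρ n / 4))) (x := pole ρ n + ε) (y := pole ρ n - ε)
      (fun y hy => ((hasDerivAt_neg y).exp.fun_mul (hd y (by linarith [hy.1]))).hasDerivWithinAt)
      (fun y hy => ?_) ⟨by linarith, by linarith⟩ ⟨by linarith, by linarith⟩
    · refine hbd.trans (le_of_eq ?_)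
      rw [Real.norm_eq_abs, show pole ρ n - ε - (pole ρ n + ε) = -(2 * ε) by ring, abs_neg,
        abs_of_pos (by positivity)]
      ring
    · have hy2 : pole ρ n / 2 ≤ y := by linarith [hy.1]
      have h1 := hval n y hy2
      have h2 : |Real.exp (-y) * w' y| ≤ 2 * B * Real.exp (-(pole ρ n / 4)) := by
        rw [abs_mul, abs_of_pos (Real.exp_pos _), mul_comm]
        exact (mul_le_mul_of_nonneg_right (hw' y (by linarith)) (Real.exp_nonneg _)).trans
          (mul_exp_neg_le hB hy2)
      have e : Real.exp (-y) * -1 * w y + Real.exp (-y) * w' y =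
        Real.exp (-y) * w' y - Real.exp (-y) * w y := by ring
      rw [e]
      refine (abs_sub _ _).trans ?_
      linarith

theorem pole_add_div {ρ : ℝ} (hρ : 0 < ρ) (n : ℕ) (t : ℝ) :
    (pole ρ n + t) / (2 * ρ) = t / (2 * ρ) + ((n + 1 : ℕ) : ℝ) * Real.pi := by
  rw [pole]; push_cast; field_simp; ring

/-- Shifting by a pole changes the sine by a sign only, which `Real.log` ignores. The singular part
is therefore the same at all poles, and even in `t`. -/
theorem logSinc_pole_add {ρ : ℝ} (hρ : 0 < ρ) (n : ℕ) (t : ℝ) :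
    logSinc ρ (pole ρ n + t) =
      Real.log (Real.sin (t / (2 * ρ))) - Real.log ((pole ρ n + t) / (2 * ρ)) := by
  rw [logSinc]
  congr 1
  rw [pole_add_div hρ, Real.sin_add_nat_mul_pi]
  rcases neg_one_pow_eq_or ℝ (n + 1) with h | h <;> rw [h] <;> simp

theorem logSincDeriv_pole_add {ρ : ℝ} (hρ : 0 < ρ) (n : ℕ) (t : ℝ) :
    logSincDeriv ρ (pole ρ n + t) =
      Real.cos (t / (2 * ρ)) / (2 * ρ * Real.sin (t / (2 * ρ))) - 1 / (pole ρ n + t) := by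
  rw [logSincDeriv, pole_add_div hρ, Real.sin_add_nat_mul_pi, Real.cos_add_nat_mul_pi]
  congr 1
  rcases neg_one_pow_eq_or ℝ (n + 1) with h | h <;> rw [h] <;> simp [neg_div_neg_eq]

theorem logSinc_pole_sub {ρ : ℝ} (hρ : 0 < ρ) (n : ℕ) (t : ℝ) :
    logSinc ρ (pole ρ n - t) =
      Real.log (Real.sin (t / (2 * ρ))) - Real.log ((pole ρ n - t) / (2 * ρ)) := by
  have := logSinc_pole_add hρ n (-t)
  rwa [neg_div, Real.sin_neg, Real.log_neg_eq_log, ← sub_eq_add_neg] at this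

/-- The cotangent part is odd in `t`: at the two sides of a pole its contributions add up instead of
cancelling, which creates the `1/ε` term of the finite part. -/
theorem logSincDeriv_pole_sub {ρ : ℝ} (hρ : 0 < ρ) (n : ℕ) (t : ℝ) :
    logSincDeriv ρ (pole ρ n - t) =
      -(Real.cos (t / (2 * ρ)) / (2 * ρ * Real.sin (t / (2 * ρ)))) - 1 / (pole ρ n - t) := by
  have := logSincDeriv_pole_add hρ n (-t)
  rwa [neg_div, Real.sin_neg, Real.cos_neg, ← sub_eq_add_neg, mul_neg, div_neg] at this

/-- The sum over the poles of the increments `W (p - ε) - W (p + ε)` of `W y = e^{-y} w y`. -/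
noncomputable def poleIncrement (w : ℝ → ℝ) (ρ ε : ℝ) : ℝ :=
  ∑' n, (Real.exp (-(pole ρ n - ε)) * w (pole ρ n - ε) -
    Real.exp (-(pole ρ n + ε)) * w (pole ρ n + ε))

/-- `e^{-y} w y` is summable over the poles shifted by `±ε`, with increments of order `ε`. -/
def HasSmallIncrements (w : ℝ → ℝ) (ρ : ℝ) : Prop :=
  ∃ K, ∀ ε, 0 < ε → ε < Real.pi * ρ →
    (Summable fun n => Real.exp (-(pole ρ n + ε)) * w (pole ρ n + ε)) ∧
    (Summable fun n => Real.exp (-(pole ρ n - ε)) * w (pole ρ n - ε)) ∧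
    |poleIncrement w ρ ε| ≤ K * ε

theorem HasSmallIncrements.summable {w : ℝ → ℝ} {ρ ε : ℝ} (h : HasSmallIncrements w ρ) (hε : 0 < ε)
    (hε' : ε < Real.pi * ρ) : Summable fun n => Real.exp (-(pole ρ n + ε)) * w (pole ρ n + ε) := by
  obtain ⟨K, hK⟩ := h
  exact (hK ε hε hε').1

theorem HasSmallIncrements.hasSum {w : ℝ → ℝ} {ρ ε : ℝ} (h : HasSmallIncrements w ρ) (hε : 0 < ε)
    (hε' : ε < Real.pi * ρ) :
    HasSum (fun n => Real.exp (-(pole ρ n - ε)) * w (pole ρ n - ε) -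
      Real.exp (-(pole ρ n + ε)) * w (pole ρ n + ε)) (poleIncrement w ρ ε) := by
  obtain ⟨K, hK⟩ := h
  exact ((hK ε hε hε').2.1.sub (hK ε hε hε').1).hasSum

theorem HasSmallIncrements.tendsto {w : ℝ → ℝ} {ρ : ℝ} (hρ : 0 < ρ) (h : HasSmallIncrements w ρ) :
    Tendsto (poleIncrement w ρ) (𝓝[>] 0) (𝓝 0) := by
  have hpi := Real.pi_pos
  obtain ⟨K, hK⟩ := h
  exact tendsto_zero_of_abs_le_mul (by positivity : 0 < Real.pi * ρ) fun ε hε hε' =>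
    (hK ε hε hε').2.2

theorem HasSmallIncrements.tendsto_log_mul {w : ℝ → ℝ} {ρ : ℝ} (hρ : 0 < ρ)
    (h : HasSmallIncrements w ρ) :
    Tendsto (fun ε => Real.log (Real.sin (ε / (2 * ρ))) * poleIncrement w ρ ε) (𝓝[>] 0)
      (𝓝 0) := by
  have hpi := Real.pi_pos
  obtain ⟨K, hK⟩ := h
  have h1 := (tendsto_mul_log_sin hρ).norm.const_mul K
  rw [norm_zero, mul_zero] at h1
  refine squeeze_zero_norm' ?_ h1
  filter_upwards [Ioo_mem_nhdsGT (by positivity : 0 < Real.pi * ρ)] with ε hε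
  have h2 := (hK ε hε.1 hε.2).2.2
  rw [norm_mul, norm_mul, Real.norm_of_nonneg hε.1.le, Real.norm_eq_abs (poleIncrement w ρ ε)]
  calc _ ≤ ‖Real.log (Real.sin (ε / (2 * ρ)))‖ * (K * ε) :=
        mul_le_mul_of_nonneg_left h2 (norm_nonneg _)
    _ = _ := by ring

theorem one_div_le_mul_self {a y : ℝ} (ha : 0 < a) (hy : a ≤ y) : 1 / y ≤ 1 / a ^ 2 * y := by
  have h0 : 0 < y := ha.trans_le hy
  rw [div_le_iff₀ h0, mul_assoc, div_mul_eq_mul_div, one_mul, le_div_iff₀ (by positivity)]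
  nlinarith

theorem one_le_mul_self {a y : ℝ} (ha : 0 < a) (hy : a ≤ y) : 1 ≤ 1 / a * y := by
  rw [div_mul_eq_mul_div, one_mul, le_div_iff₀ ha]
  linarith

theorem one_div_sq_le_mul_self {a y : ℝ} (ha : 0 < a) (hy : a ≤ y) :
    1 / y ^ 2 ≤ 1 / a ^ 3 * y := by
  have h0 : 0 < y := ha.trans_le hy
  rw [div_le_iff₀ (by positivity), mul_assoc, div_mul_eq_mul_div, one_mul,
    le_div_iff₀ (by positivity), one_mul, ← pow_succ']
  exact pow_le_pow_left₀ ha.le hy 3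

theorem log_div_nonneg_and_le {ρ y : ℝ} (hρ : 0 < ρ) (hy : Real.pi * ρ ≤ y) :
    0 ≤ Real.log (y / (2 * ρ)) ∧ Real.log (y / (2 * ρ)) ≤ 1 / (2 * ρ) * y := by
  have hpi := Real.pi_gt_three
  have h1 : 1 ≤ y / (2 * ρ) := by
    rw [le_div_iff₀ (by positivity)]
    nlinarith
  refine ⟨Real.log_nonneg h1, ?_⟩
  have h2 := Real.log_le_sub_one_of_pos (by linarith : 0 < y / (2 * ρ))
  rw [div_mul_eq_mul_div, one_mul]
  linarith

theorem hasSmallIncrements_one {ρ : ℝ} (hρ : 0 < ρ) : HasSmallIncrements (fun _ => 1) ρ := by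
  have hpi := Real.pi_pos
  have ha : 0 < Real.pi * ρ := by positivity
  refine exists_abs_tsum_increment_le (B := 1 / (Real.pi * ρ)) (w := fun _ => 1) (w' := fun _ => 0) hρ
    (by positivity) (fun y _ => hasDerivAt_const y 1) (fun y hy => ?_) fun y hy => ?_
  · rw [abs_one]; exact one_le_mul_self ha hy
  · rw [abs_zero]; exact zero_le_one.trans (one_le_mul_self ha hy)

theorem hasSmallIncrements_one_div {ρ : ℝ} (hρ : 0 < ρ) :
    HasSmallIncrements (fun y => 1 / y) ρ := by
  have hpi := Real.pi_pos
  have ha : 0 < Real.pi * ρ := by positivity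
  refine exists_abs_tsum_increment_le (B := 1 / (Real.pi * ρ) ^ 2 + 1 / (Real.pi * ρ) ^ 3)
    (w := fun y => 1 / y) (w' := fun y => -(1 / y ^ 2)) hρ (by positivity) (fun y hy => ?_) (fun y hy => ?_)
    fun y hy => ?_
  · have h0 : 0 < y := ha.trans_le hy
    simpa [one_div] using hasDerivAt_inv h0.ne'
  · have h0 : 0 < y := ha.trans_le hy
    have := one_div_le_mul_self ha hy
    have h3 : 0 ≤ 1 / (Real.pi * ρ) ^ 3 * y := by positivity
    rw [abs_of_nonneg (by positivity), add_mul]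
    linarith
  · have h0 : 0 < y := ha.trans_le hy
    have := one_div_sq_le_mul_self ha hy
    have h3 : 0 ≤ 1 / (Real.pi * ρ) ^ 2 * y := by positivity
    rw [abs_neg, abs_of_nonneg (by positivity), add_mul]
    linarith

theorem hasDerivAt_log_div {ρ y : ℝ} (hρ : 0 < ρ) (hy : 0 < y) :
    HasDerivAt (fun y => Real.log (y / (2 * ρ))) (1 / y) y := by
  convert! ((hasDerivAt_id y).div_const (2 * ρ)).log (by simp only [id]; positivity) using 1
  simp only [id]
  field_simp

theorem hasSmallIncrements_log {ρ : ℝ} (hρ : 0 < ρ) :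
    HasSmallIncrements (fun y => Real.log (y / (2 * ρ))) ρ := by
  have hpi := Real.pi_pos
  have ha : 0 < Real.pi * ρ := by positivity
  refine exists_abs_tsum_increment_le (B := 1 / (2 * ρ) + 1 / (Real.pi * ρ) ^ 2)
    (w := fun y => Real.log (y / (2 * ρ))) (w' := fun y => 1 / y) hρ (by positivity)
    (fun y hy => hasDerivAt_log_div hρ (ha.trans_le hy)) (fun y hy => ?_) fun y hy => ?_
  · have h0 : 0 < y := ha.trans_le hy
    have h1 := log_div_nonneg_and_le hρ hy
    have h3 : 0 ≤ 1 / (Real.pi * ρ) ^ 2 * y := by positivity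
    rw [abs_of_nonneg h1.1, add_mul]
    linarith
  · have h0 : 0 < y := ha.trans_le hy
    have h1 := one_div_le_mul_self ha hy
    have h3 : 0 ≤ 1 / (2 * ρ) * y := by positivity
    rw [abs_of_nonneg (by positivity), add_mul]
    linarith

theorem hasSmallIncrements_log_div {ρ : ℝ} (hρ : 0 < ρ) :
    HasSmallIncrements (fun y => Real.log (y / (2 * ρ)) / y) ρ := by
  have hpi := Real.pi_pos
  have ha : 0 < Real.pi * ρ := by positivity
  refine exists_abs_tsum_increment_le
    (B := 1 / (2 * ρ) * (1 / (Real.pi * ρ)) + (1 / (Real.pi * ρ) ^ 3 +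
      1 / (2 * ρ) * (1 / (Real.pi * ρ) ^ 2)))
    (w := fun y => Real.log (y / (2 * ρ)) / y)
    (w' := fun y => 1 / y ^ 2 - Real.log (y / (2 * ρ)) / y ^ 2) hρ (by positivity)
    (fun y hy => ?_) (fun y hy => ?_) fun y hy => ?_
  · have h0 : 0 < y := ha.trans_le hy
    convert! (hasDerivAt_log_div hρ h0).fun_div (hasDerivAt_id y) h0.ne' using 1
    simp only [id]
    field_simp
  · have h0 : 0 < y := ha.trans_le hy
    have h1 := log_div_nonneg_and_le hρ hy
    have h2 : Real.log (y / (2 * ρ)) / y ≤ 1 / (2 * ρ) := by rw [div_le_iff₀ h0]; exact h1.2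
    have h3 : 1 / (2 * ρ) * 1 ≤ 1 / (2 * ρ) * (1 / (Real.pi * ρ) * y) :=
      mul_le_mul_of_nonneg_left (one_le_mul_self ha hy) (by positivity)
    have h4 : 0 ≤ (1 / (Real.pi * ρ) ^ 3 + 1 / (2 * ρ) * (1 / (Real.pi * ρ) ^ 2)) * y := by
      positivity
    rw [abs_of_nonneg (div_nonneg h1.1 h0.le), add_mul]
    linarith
  · have h0 : 0 < y := ha.trans_le hy
    have h1 := log_div_nonneg_and_le hρ hy
    have h2 : Real.log (y / (2 * ρ)) / y ^ 2 ≤ 1 / (2 * ρ) * (1 / y) := by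
      rw [div_le_iff₀ (by positivity)]
      refine h1.2.trans (le_of_eq ?_)
      field_simp
    have h3 : 1 / (2 * ρ) * (1 / y) ≤ 1 / (2 * ρ) * (1 / (Real.pi * ρ) ^ 2 * y) :=
      mul_le_mul_of_nonneg_left (one_div_le_mul_self ha hy) (by positivity)
    have h4 : 0 ≤ 1 / (2 * ρ) * (1 / (Real.pi * ρ)) * y := by positivity
    have h5 := one_div_sq_le_mul_self ha hy
    have h6 : 0 ≤ Real.log (y / (2 * ρ)) / y ^ 2 := div_nonneg h1.1 (by positivity)
    refine (abs_sub _ _).trans ?_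
    rw [abs_of_nonneg h6, abs_of_nonneg (by positivity), add_mul, add_mul]
    linarith

/-! ### Principal value and finite part for `N = 1` -/

/-- Near `0` the bound `O(y²)` on `logSinc` absorbs `1/y²`; away from `0` the weight is bounded and
`e^{-y} logSinc` is integrable, singularities included. -/
theorem integrableOn_exp_neg_mul_logSinc_div {ρ : ℝ} (hρ : 0 < ρ) :
    IntegrableOn (fun y => Real.exp (-y) * (1 / y + 1 / y ^ 2) * logSinc ρ y / 2) (Ioi 0) := by
  have hpi := Real.pi_pos
  have ha : 0 < Real.pi * ρ := by positivity
  obtain ⟨C, hC, h⟩ := exists_abs_logSinc_le hρ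
  have hm := measurable_logSinc ρ
  have i0 := integrableOn_pow_mul_exp_neg 0
  have i1 := (integrableOn_exp_neg_mul_logSinc_and_hasSum hρ).1.norm
  refine Integrable.mono' (g := fun y => C * (Real.pi * ρ + 1) * (y ^ 0 * Real.exp (-y)) +
    (1 / (Real.pi * ρ) + 1 / (Real.pi * ρ) ^ 2) * ‖Real.exp (-y) * logSinc ρ y‖)
    ((i0.const_mul _).add (i1.const_mul _)) (Measurable.aestronglyMeasurable (by fun_prop)) ?_
  filter_upwards [ae_restrict_mem measurableSet_Ioi] with y hy
  have hy : 0 < y := hy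
  have he := Real.exp_pos (-y)
  have e : ‖Real.exp (-y) * (1 / y + 1 / y ^ 2) * logSinc ρ y / 2‖ =
      Real.exp (-y) * (1 / y + 1 / y ^ 2) * |logSinc ρ y| / 2 := by
    rw [norm_div, norm_mul, Real.norm_of_nonneg (by positivity), Real.norm_eq_abs,
      Real.norm_of_nonneg two_pos.le]
  have e' : ‖Real.exp (-y) * logSinc ρ y‖ = Real.exp (-y) * |logSinc ρ y| := by
    rw [norm_mul, Real.norm_of_nonneg he.le, Real.norm_eq_abs]
  rw [e, e']
  rcases lt_or_ge y (Real.pi * ρ) with hlt | hge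
  · have h1 := (h y hy hlt).1
    have h2 : (1 / y + 1 / y ^ 2) * |logSinc ρ y| ≤ C * (Real.pi * ρ + 1) := by
      refine (mul_le_mul_of_nonneg_left h1 (by positivity)).trans ?_
      have e2 : (1 / y + 1 / y ^ 2) * (C * y ^ 2) = C * (y + 1) := by field_simp
      rw [e2]
      exact mul_le_mul_of_nonneg_left (by linarith) hC
    have h3 := mul_le_mul_of_nonneg_left h2 he.le
    have h4 : 0 ≤ (1 / (Real.pi * ρ) + 1 / (Real.pi * ρ) ^ 2) *
      (Real.exp (-y) * |logSinc ρ y|) := by positivity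
    have h5 : 0 ≤ Real.exp (-y) * ((1 / y + 1 / y ^ 2) * |logSinc ρ y|) := by positivity
    rw [pow_zero, one_mul]
    linarith
  · have h2 : 1 / y + 1 / y ^ 2 ≤ 1 / (Real.pi * ρ) + 1 / (Real.pi * ρ) ^ 2 := by gcongr
    have h3 := mul_le_mul_of_nonneg_right h2
      (by positivity : 0 ≤ Real.exp (-y) * |logSinc ρ y|)
    have h4 : 0 ≤ C * (Real.pi * ρ + 1) * (y ^ 0 * Real.exp (-y)) := by positivity
    have h5 : 0 ≤ (1 / y + 1 / y ^ 2) * (Real.exp (-y) * |logSinc ρ y|) := by positivity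
    linarith

/-- The principal value of the integral with simple poles. -/
theorem hasExpansion_logSincDeriv {ρ : ℝ} (hρ : 0 < ρ) :
    HasExpansion (fun y => Real.exp (-y) * (logSincDeriv ρ y / (2 * y))) (poles ρ) 0
      (∫ y in Ioi 0, Real.exp (-y) * (1 / y + 1 / y ^ 2) * logSinc ρ y / 2) := by
  have hpi := Real.pi_pos
  have ha : 0 < Real.pi * ρ := by positivity
  have hH := integrableOn_exp_neg_mul_logSinc_div hρ
  refine ⟨fun ε hε => (integrableOn_excised_exp_mul hρ hε).1, ?_⟩
  have s1 := hasSmallIncrements_one_div hρ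
  have s2 := hasSmallIncrements_log_div hρ
  -- The boundary sum is half of `log sin(ε/2ρ)` times the increments of `1/y`, minus those of
  -- `log(y/2ρ)/y`; both tend to zero, so no `1/ε` appears.
  have hlim := (tendsto_setIntegral_excised hρ hH).add
    (((s1.tendsto_log_mul hρ).sub (s2.tendsto hρ)).const_mul (1 / 2))
  simp only [sub_zero, mul_zero, add_zero] at hlim
  refine hlim.congr' ?_
  filter_upwards [Ioo_mem_nhdsGT ha] with ε hε
  rw [zero_div, sub_zero]
  have key := setIntegral_excised_eq (U := fun y => Real.exp (-y) * (logSinc ρ y / y) / 2)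
    (F := fun y => Real.exp (-y) * (logSincDeriv ρ y / (2 * y)))
    (H := fun y => Real.exp (-y) * (1 / y + 1 / y ^ 2) * logSinc ρ y / 2) hρ hε.1 hε.2
    (fun y hy hyp => ?_) (integrableOn_excised_exp_mul hρ hε.1).1
    (hH.mono_set (excised_subset_Ioi _ ε)) ?_ ?_
  · rw [key]
    congr 1
    symm
    have hs := (((s1.hasSum hε.1 hε.2).mul_left (Real.log (Real.sin (ε / (2 * ρ))))).sub
      (s2.hasSum hε.1 hε.2)).mul_left (1 / 2)
    rw [← hs.tsum_eq]
    refine tsum_congr fun n => ?_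
    rw [logSinc_pole_add hρ, logSinc_pole_sub hρ]
    ring
  · convert! (((hasDerivAt_neg y).exp).fun_mul
      ((hasDerivAt_logSinc hρ hy hyp).fun_div (hasDerivAt_id y) hy.ne')).div_const 2 using 1
    simp only [id]
    field_simp
    ring
  · have h1 : Tendsto (fun y : ℝ => Real.exp (-y)) (𝓝[>] 0) (𝓝 (Real.exp (-0))) :=
      (Continuous.tendsto (by fun_prop) 0).mono_left nhdsWithin_le_nhds
    simpa using (h1.mul (tendsto_logSinc_div hρ)).div_const 2
  · have hs := (((s1.summable hε.1 hε.2).mul_left (Real.log (Real.sin (ε / (2 * ρ))))).sub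
      (s2.summable hε.1 hε.2)).mul_left (1 / 2)
    refine hs.congr fun n => ?_
    rw [logSinc_pole_add hρ]
    ring

theorem tendsto_cosh_sub_one_div : Tendsto (fun ε : ℝ => (Real.cosh ε - 1) / ε) (𝓝[>] 0) (𝓝 0) := by
  have h := (hasDerivAt_iff_tendsto_slope.mp (Real.hasDerivAt_cosh 0)).mono_left
    (nhdsWithin_mono 0 fun x hx => ne_of_gt hx)
  rw [Real.sinh_zero] at h
  refine h.congr fun ε => ?_
  rw [slope_def_field, Real.cosh_zero, sub_zero]

/-- The finite part of the integral with double poles. -/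
theorem hasExpansion_logSincDeriv₂ {ρ : ℝ} (hρ : 0 < ρ) :
    HasExpansion (fun y => Real.exp (-y) * (logSincDeriv₂ ρ y / 2)) (poles ρ)
      (-∑' n, Real.exp (-pole ρ n)) ((∫ y in Ioi 0, Real.exp (-y) * logSinc ρ y) / 2) := by
  have hpi := Real.pi_pos
  have ha : 0 < Real.pi * ρ := by positivity
  set Q := ∑' n, Real.exp (-pole ρ n) with hQ
  have hQs : HasSum (fun n => Real.exp (-pole ρ n)) Q := (hasSum_exp_neg_pole hρ).summable.hasSum
  have hH : IntegrableOn (fun y => Real.exp (-y) * logSinc ρ y / 2) (Ioi 0) :=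
    (integrableOn_exp_neg_mul_logSinc_and_hasSum hρ).1.div_const 2
  refine ⟨fun ε hε => integrableOn_excised_exp_mul_logSincDeriv₂ hρ hε, ?_⟩
  have s0 := hasSmallIncrements_one hρ
  have s1 := hasSmallIncrements_one_div hρ
  have s3 := hasSmallIncrements_log hρ
  have hcosh : Tendsto (fun ε : ℝ => Real.cosh ε) (𝓝[>] 0) (𝓝 (Real.cosh 0)) :=
    (Real.continuous_cosh.tendsto 0).mono_left nhdsWithin_le_nhds
  -- The cotangents contribute `-Q cosh ε (L'(ε) + 1/ε)` with `L' = logSincDeriv`. Removing `-Q/ε`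
  -- leaves `(cosh ε - 1)/ε` and `cosh ε · L'(ε)`, which vanish in the limit.
  have hlim := ((tendsto_setIntegral_excised hρ hH).add
    ((((s0.tendsto_log_mul hρ).sub (s1.tendsto hρ)).sub (s3.tendsto hρ)).const_mul (1 / 2))).sub
    ((tendsto_cosh_sub_one_div.add (hcosh.mul (tendsto_logSincDeriv hρ))).const_mul Q)
  simp only [sub_zero, mul_zero, add_zero] at hlim
  rw [integral_div] at hlim
  refine hlim.congr' ?_
  filter_upwards [Ioo_mem_nhdsGT ha] with ε hε
  have hε0 := hε.1.ne'
  have hcot : Real.cos (ε / (2 * ρ)) / (2 * ρ * Real.sin (ε / (2 * ρ))) =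
    logSincDeriv ρ ε + 1 / ε := by rw [logSincDeriv]; ring
  -- For `L = logSinc` the derivative of `e^{-y}(L' + L)` is `e^{-y}(L'' - L)`: this primitive
  -- performs two integrations by parts at once.
  have key := setIntegral_excised_eq
    (U := fun y => Real.exp (-y) * (logSincDeriv ρ y + logSinc ρ y) / 2)
    (F := fun y => Real.exp (-y) * (logSincDeriv₂ ρ y / 2))
    (H := fun y => Real.exp (-y) * logSinc ρ y / 2) hρ hε.1 hε.2
    (fun y hy hyp => ?_) (integrableOn_excised_exp_mul_logSincDeriv₂ hρ hε.1)
    (hH.mono_set (excised_subset_Ioi _ ε)) ?_ ?_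
  · rw [key]
    have hs := ((((s0.hasSum hε.1 hε.2).mul_left (Real.log (Real.sin (ε / (2 * ρ))))).sub
      (s1.hasSum hε.1 hε.2)).sub (s3.hasSum hε.1 hε.2)).mul_left (1 / 2)
    have hs2 := hs.sub (hQs.mul_left (Real.cosh ε * (logSincDeriv ρ ε + 1 / ε)))
    have e : ∑' n, (Real.exp (-(pole ρ n - ε)) *
          (logSincDeriv ρ (pole ρ n - ε) + logSinc ρ (pole ρ n - ε)) / 2 -
        Real.exp (-(pole ρ n + ε)) *
          (logSincDeriv ρ (pole ρ n + ε) + logSinc ρ (pole ρ n + ε)) / 2) =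
        1 / 2 * (Real.log (Real.sin (ε / (2 * ρ))) * poleIncrement (fun _ => 1) ρ ε -
          poleIncrement (fun y => 1 / y) ρ ε -
          poleIncrement (fun y => Real.log (y / (2 * ρ))) ρ ε) -
        Real.cosh ε * (logSincDeriv ρ ε + 1 / ε) * Q := by
      rw [← hs2.tsum_eq]
      refine tsum_congr fun n => ?_
      rw [logSinc_pole_add hρ, logSinc_pole_sub hρ, logSincDeriv_pole_add hρ,
        logSincDeriv_pole_sub hρ, hcot, Real.cosh_eq,
        show -(pole ρ n - ε) = -pole ρ n + ε by ring,
        show -(pole ρ n + ε) = -pole ρ n + -ε by ring, Real.exp_add, Real.exp_add]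
      ring
    rw [e]
    field_simp
    ring
  · convert! (((hasDerivAt_neg y).exp).fun_mul
      ((hasDerivAt_logSincDeriv hρ hy hyp).add (hasDerivAt_logSinc hρ hy hyp))).div_const 2 using 1
    simp only [Pi.add_apply]
    ring
  · have h1 : Tendsto (fun y : ℝ => Real.exp (-y)) (𝓝[>] 0) (𝓝 (Real.exp (-0))) :=
      (Continuous.tendsto (by fun_prop) 0).mono_left nhdsWithin_le_nhds
    simpa using (h1.mul ((tendsto_logSincDeriv hρ).add (tendsto_logSinc hρ))).div_const 2
  · have hs := ((((s0.summable hε.1 hε.2).mul_left (logSincDeriv ρ ε + 1 / ε +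
      Real.log (Real.sin (ε / (2 * ρ))))).sub (s1.summable hε.1 hε.2)).sub
      (s3.summable hε.1 hε.2)).mul_left (1 / 2)
    refine hs.congr fun n => ?_
    rw [logSinc_pole_add hρ, logSincDeriv_pole_add hρ, hcot]
    ring

/-! ### Recurrence in `N` on the Stokes lines -/

theorem sub_four_mul_sq_eq (ρ y : ℝ) (n : ℕ) :
    y ^ 2 - 4 * ((n : ℝ) + 1) ^ 2 * Real.pi ^ 2 * ρ ^ 2 = y ^ 2 - pole ρ n ^ 2 := by
  rw [pole]; ring

theorem termSL_succ (K : ℕ) (ρ y : ℝ) (n : ℕ) :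
    termSL (K + 1) ρ y n = 1 / ((n : ℝ) + 1) ^ (2 * K) * (1 / (y ^ 2 - pole ρ n ^ 2)) := by
  rw [termSL, sub_four_mul_sq_eq,
    show 2 * ((K + 1 : ℕ) : ℤ) - 2 = ((2 * K : ℕ) : ℤ) by push_cast; ring, zpow_natCast,
    one_div_mul_one_div]

theorem termSqSL_succ (K : ℕ) (ρ y : ℝ) (n : ℕ) :
    termSqSL (K + 1) ρ y n =
      1 / ((n : ℝ) + 1) ^ (2 * K) * (((n : ℝ) + 1) ^ 2 / (y ^ 2 - pole ρ n ^ 2) ^ 2) := by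
  have h : (n : ℝ) + 1 ≠ 0 := by positivity
  rw [termSqSL, sub_four_mul_sq_eq,
    show 2 * ((K + 1 : ℕ) : ℤ) - 4 = ((2 * K : ℕ) : ℤ) - ((2 : ℕ) : ℤ) by push_cast; ring,
    zpow_sub₀ h, zpow_natCast, zpow_natCast]
  rw [div_mul_div_comm, one_mul, div_mul_eq_mul_div, one_div_div]

theorem abs_one_div_pow_mul_le (K n : ℕ) (x : ℝ) :
    ‖1 / ((n : ℝ) + 1) ^ (2 * K) * x‖ ≤ ‖x‖ := by
  rw [norm_mul]
  refine mul_le_of_le_one_left (norm_nonneg _) ?_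
  have h : (1 : ℝ) ≤ ((n : ℝ) + 1) ^ (2 * K) := one_le_pow₀ (by simp)
  rw [Real.norm_of_nonneg (by positivity)]
  exact (div_le_one (by positivity)).mpr h

theorem summable_termSL {ρ y : ℝ} (K : ℕ) (hρ : 0 < ρ) (hy : 0 < y) (hyp : y ∉ poles ρ) :
    Summable (termSL (K + 1) ρ y) := by
  refine (summable_one_div_sub_sq hρ hy hyp).norm.of_norm_bounded fun n => ?_
  rw [termSL_succ]
  exact abs_one_div_pow_mul_le K n _

theorem summable_termSqSL {ρ y : ℝ} (K : ℕ) (hρ : 0 < ρ) (hy : 0 < y) (hyp : y ∉ poles ρ) :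
    Summable (termSqSL (K + 1) ρ y) := by
  refine (summable_sq_div_sub_sq_sq hρ hy hyp).norm.of_norm_bounded fun n => ?_
  rw [termSqSL_succ]
  exact abs_one_div_pow_mul_le K n _

theorem integrandSL_succ (K : ℕ) (ρ y : ℝ) :
    integrandSL (K + 1) ρ y = y ^ (2 * K) * Real.exp (-y) * ∑' n, termSL (K + 1) ρ y n := by
  rw [integrandSL, show 2 * ((K + 1 : ℕ) : ℤ) - 2 = ((2 * K : ℕ) : ℤ) by push_cast; ring,
    zpow_natCast]

theorem integrandSqSL_succ (K : ℕ) (ρ y : ℝ) :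
    integrandSqSL (K + 1) ρ y = y ^ (2 * K) * Real.exp (-y) * ∑' n, termSqSL (K + 1) ρ y n := by
  rw [integrandSqSL, show 2 * ((K + 1 : ℕ) : ℤ) - 2 = ((2 * K : ℕ) : ℤ) by push_cast; ring,
    zpow_natCast]

theorem integrandSL_one {ρ y : ℝ} (hρ : 0 < ρ) (hy : 0 < y) (hyp : y ∉ poles ρ) :
    integrandSL 1 ρ y = Real.exp (-y) * (logSincDeriv ρ y / (2 * y)) := by
  rw [integrandSL_succ 0]
  simp only [termSL_succ 0, mul_zero, pow_zero, div_one, one_mul]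
  rw [tsum_one_div_sub_sq hρ hy hyp]

theorem integrandSqSL_one {ρ y : ℝ} (hρ : 0 < ρ) (hy : 0 < y) (hyp : y ∉ poles ρ) :
    integrandSqSL 1 ρ y = Real.exp (-y) *
      (-(logSincDeriv ρ y / y + logSincDeriv₂ ρ y) / (4 * (2 * Real.pi * ρ) ^ 2)) := by
  rw [integrandSqSL_succ 0]
  simp only [termSqSL_succ 0, mul_zero, pow_zero, div_one, one_mul]
  rw [tsum_sq_div_sub_sq_sq hρ hy hyp]

/-- The values `ζ(2K + 2)` as sums of real series. -/
noncomputable def zetaEven (K : ℕ) : ℝ := ∑' n : ℕ, 1 / ((n : ℝ) + 1) ^ (2 * K + 2)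

theorem summable_zetaEven (K : ℕ) : Summable fun n : ℕ => 1 / ((n : ℝ) + 1) ^ (2 * K + 2) := by
  refine (summable_const_div_sq 1).of_norm_bounded fun n => ?_
  rw [Real.norm_of_nonneg (by positivity)]
  have h : (1 : ℝ) ≤ (n : ℝ) + 1 := by simp
  exact one_div_le_one_div_of_le (by positivity) (pow_le_pow_right₀ h (by omega))

theorem ofReal_zetaEven (K : ℕ) :
    (zetaEven K : ℂ) = riemannZeta (2 * ((K + 1 : ℕ) : ℂ)) := by
  rw [zetaEven, Complex.ofReal_tsum, ← (hasSum_zeta_even K).tsum_eq]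
  refine tsum_congr fun n => ?_
  push_cast
  rfl

/-- As in the sectors, but with `y² = (y² - p²) + p²`, so the signs are positive. -/
theorem integrandSL_add_two {ρ y : ℝ} (K : ℕ) (hρ : 0 < ρ) (hy : 0 < y) (hyp : y ∉ poles ρ) :
    integrandSL (K + 2) ρ y = zetaEven K * (y ^ (2 * K) * Real.exp (-y)) +
      (2 * Real.pi * ρ) ^ 2 * integrandSL (K + 1) ρ y := by
  have e : y ^ 2 * ∑' n, termSL (K + 2) ρ y n =
      zetaEven K + (2 * Real.pi * ρ) ^ 2 * ∑' n, termSL (K + 1) ρ y n := by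
    rw [zetaEven, ← tsum_mul_left, ← tsum_mul_left,
      ← (summable_zetaEven K).tsum_add ((summable_termSL K hρ hy hyp).mul_left _)]
    refine tsum_congr fun n => ?_
    rw [termSL_succ (K + 1), termSL_succ K]
    have h1 := sub_sq_ne_zero hρ hy hyp n
    have h2 : y ^ 2 = (y ^ 2 - pole ρ n ^ 2) + (2 * Real.pi * ρ) ^ 2 * ((n : ℝ) + 1) ^ 2 := by
      rw [pole]; ring
    have h3 : (n : ℝ) + 1 ≠ 0 := by positivity
    generalize y ^ 2 - pole ρ n ^ 2 = D at *
    rw [h2]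
    field_simp
    ring
  rw [integrandSL_succ (K + 1), integrandSL_succ K,
    show y ^ (2 * (K + 1)) * Real.exp (-y) * ∑' n, termSL (K + 1 + 1) ρ y n =
      y ^ (2 * K) * Real.exp (-y) * (y ^ 2 * ∑' n, termSL (K + 2) ρ y n) by ring, e]
  ring

/-- The same splitting with squared denominators. The coefficient `1 *` fits the shape of
`HasExpansion.linearCombination`. -/
theorem integrandSqSL_add_two {ρ y : ℝ} (K : ℕ) (hρ : 0 < ρ) (hy : 0 < y) (hyp : y ∉ poles ρ) :
    integrandSqSL (K + 2) ρ y = 1 * integrandSL (K + 1) ρ y +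
      (2 * Real.pi * ρ) ^ 2 * integrandSqSL (K + 1) ρ y := by
  have e : y ^ 2 * ∑' n, termSqSL (K + 2) ρ y n =
      (∑' n, termSL (K + 1) ρ y n) + (2 * Real.pi * ρ) ^ 2 * ∑' n, termSqSL (K + 1) ρ y n := by
    rw [← tsum_mul_left, ← tsum_mul_left, ← (summable_termSL K hρ hy hyp).tsum_add
      ((summable_termSqSL K hρ hy hyp).mul_left _)]
    refine tsum_congr fun n => ?_
    rw [termSqSL_succ (K + 1), termSL_succ K, termSqSL_succ K]
    have h1 := sub_sq_ne_zero hρ hy hyp n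
    have h2 : y ^ 2 = (y ^ 2 - pole ρ n ^ 2) + (2 * Real.pi * ρ) ^ 2 * ((n : ℝ) + 1) ^ 2 := by
      rw [pole]; ring
    have h3 : (n : ℝ) + 1 ≠ 0 := by positivity
    generalize y ^ 2 - pole ρ n ^ 2 = D at *
    rw [h2]
    field_simp
    ring
  rw [integrandSqSL_succ (K + 1), integrandSL_succ K, integrandSqSL_succ K,
    show y ^ (2 * (K + 1)) * Real.exp (-y) * ∑' n, termSqSL (K + 1 + 1) ρ y n =
      y ^ (2 * K) * Real.exp (-y) * (y ^ 2 * ∑' n, termSqSL (K + 2) ρ y n) by ring, e]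
  ring

theorem remainderPsiSL_succ (K : ℕ) {z : ℂ} (hz : z ≠ 0) (I J : ℝ) :
    remainderPsiSL (K + 1) z I J =
      ((1 - 2 * (K : ℂ)) * 2 * I + 4 * (2 * (Real.pi : ℂ) * (‖z‖ : ℂ)) ^ 2 * J) /
        (2 * (Real.pi : ℂ) * (‖z‖ : ℂ)) ^ (2 * K) := by
  have hd : 2 * (Real.pi : ℂ) * (‖z‖ : ℂ) ≠ 0 := by
    have h1 := Complex.ofReal_ne_zero.mpr Real.pi_ne_zero
    have h2 := Complex.ofReal_ne_zero.mpr (norm_ne_zero_iff.mpr hz)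
    exact mul_ne_zero (mul_ne_zero two_ne_zero h1) h2
  rw [remainderPsiSL, remainderSL,
    show 2 * ((K + 1 : ℕ) : ℤ) - 2 = ((2 * K : ℕ) : ℤ) by push_cast; ring,
    show 2 * ((K + 1 : ℕ) : ℤ) - 4 = ((2 * K : ℕ) : ℤ) - ((2 : ℕ) : ℤ) by push_cast; ring,
    zpow_sub₀ hd, zpow_natCast, zpow_natCast]
  generalize 2 * (Real.pi : ℂ) * (‖z‖ : ℂ) = d at *
  push_cast
  field_simp
  ring

/-- The values of the two integrals on a Stokes line, with the remainder they give. -/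
theorem exists_hasExpansion {ρ : ℝ} (hρ : 0 < ρ) {z : ℂ} (hz : z ^ 2 = -(ρ : ℂ) ^ 2)
    (hzn : ‖z‖ = ρ) (K : ℕ) :
    ∃ I A J : ℝ, HasExpansion (integrandSL (K + 1) ρ) (poles ρ) 0 I ∧
      HasExpansion (integrandSqSL (K + 1) ρ) (poles ρ) A J ∧
      remainderPsiSL (K + 1) z I J - truncatedSeries (K + 1) z =
        -((∫ y in Ioi (0 : ℝ), Real.exp (-y) * logSinc ρ y : ℝ) : ℂ) := by
  have hpi := Real.pi_pos
  have hz0 : z ≠ 0 := by rw [← norm_pos_iff, hzn]; exact hρ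
  have hd : 2 * (Real.pi : ℂ) * (ρ : ℂ) ≠ 0 :=
    mul_ne_zero two_pi_ne_zero' (Complex.ofReal_ne_zero.mpr hρ.ne')
  induction K with
  | zero =>
    have h1 := hasExpansion_logSincDeriv hρ
    have h2 := hasExpansion_logSincDeriv₂ hρ
    have hI := h1.linearCombination 1 0 h2 (E := integrandSL 1 ρ) fun y hy hyp => by
      rw [integrandSL_one hρ hy hyp]; ring
    -- With `d = 2πρ` this gives `J = -(I + ½∫ e^{-y} logSinc) / (2d²)`, so in `2I + 4d²J` the
    -- principal value cancels and `-∫ e^{-y} logSinc` remains.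
    have hJ := h1.linearCombination (-(1 / (2 * (2 * Real.pi * ρ) ^ 2)))
      (-(1 / (2 * (2 * Real.pi * ρ) ^ 2))) h2 (E := integrandSqSL 1 ρ) fun y hy hyp => by
        rw [integrandSqSL_one hρ hy hyp]
        field_simp
        ring
    rw [mul_zero, zero_mul, zero_add] at hI
    refine ⟨_, _, _, hI, hJ, ?_⟩
    rw [remainderPsiSL_succ 0 hz0, hzn, truncatedSeries]
    simp only [zero_add, Finset.Ico_self, Finset.sum_empty, sub_zero]
    generalize (∫ y in Ioi 0, Real.exp (-y) * (1 / y + 1 / y ^ 2) * logSinc ρ y / 2) = I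
    generalize (∫ y in Ioi 0, Real.exp (-y) * logSinc ρ y) = L
    push_cast
    generalize 2 * (Real.pi : ℂ) * (ρ : ℂ) = d at *
    field_simp
    ring
  | succ K ih =>
    obtain ⟨I, A, J, hI, hJ, h⟩ := ih
    have h0 := hasExpansion_of_integrableOn hρ (integrableOn_pow_mul_exp_neg (2 * K))
    rw [integral_pow_mul_exp_neg] at h0
    have hI' := h0.linearCombination (zetaEven K) ((2 * Real.pi * ρ) ^ 2) hI
      (E := integrandSL (K + 2) ρ) fun y hy hyp => integrandSL_add_two K hρ hy hyp
    have hJ' := hI.linearCombination 1 ((2 * Real.pi * ρ) ^ 2) hJ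
      (E := integrandSqSL (K + 2) ρ) fun y hy hyp => integrandSqSL_add_two K hρ hy hyp
    rw [mul_zero, mul_zero, zero_add] at hI'
    refine ⟨_, _, _, hI', hJ', ?_⟩
    -- On a Stokes line `z² = -ρ²`; the resulting sign cancels the alternating sign of the
    -- asymptotic series.
    have hpow : (2 * (Real.pi : ℂ) * z) ^ (2 * K + 2) =
        (-1) ^ (K + 1) * (2 * (Real.pi : ℂ) * ρ) ^ (2 * K + 2) := by
      rw [show 2 * K + 2 = 2 * (K + 1) by ring, pow_mul, mul_pow _ z, hz, pow_mul, ← mul_pow]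
      congr 1
      ring
    rw [← h, truncatedSeries_succ, hpow, remainderPsiSL_succ K hz0, remainderPsiSL_succ (K + 1) hz0,
      hzn, ← ofReal_zetaEven]
    push_cast
    have hs : ((-1 : ℂ)) ^ (K + 1) ≠ 0 := pow_ne_zero _ (by norm_num)
    generalize (-1 : ℂ) ^ (K + 1) = u at *
    generalize 2 * (Real.pi : ℂ) * (ρ : ℂ) = d at *
    field_simp
    ring

/-! ### The expansion on Stokes lines and the theorem -/

theorem exp_mul_pi_div_two_mul_I {s : ℝ} (hs : s = 1 ∨ s = -1) :
    Complex.exp ((s * (Real.pi / 2) : ℝ) * Complex.I) = s * Complex.I := by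
  rcases hs with rfl | rfl
  · push_cast
    rw [one_mul, Complex.exp_pi_div_two_mul_I]; simp
  · push_cast
    rw [neg_one_mul, neg_mul, Complex.exp_neg, Complex.exp_pi_div_two_mul_I]; simp

theorem point_stokes_line (M : ℕ) {s : ℝ} (hs : s = 1 ∨ s = -1) (r : ℝ) :
    point r (s * (((M : ℝ) + 1 / 2) * Real.pi)) = (s * (-1) ^ M : ℝ) * r * Complex.I := by
  rw [point_eq_neg_one_pow_mul M hs, point,
    show s * (((M : ℝ) + 1 / 2) * Real.pi) - s * (M * Real.pi) = s * (Real.pi / 2) by ring,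
    exp_mul_pi_div_two_mul_I hs]
  push_cast
  ring

theorem log_mul_I {r σ : ℝ} (hr : 0 < r) (hσ : σ = 1 ∨ σ = -1) :
    Complex.log (σ * r * Complex.I) = Real.log r + σ * (Real.pi / 2) * Complex.I := by
  have hpi := Real.pi_pos
  have h := log_point (r := r) (φ := σ * (Real.pi / 2)) hr
    (by rcases hσ with rfl | rfl <;> linarith) (by rcases hσ with rfl | rfl <;> linarith)
  rw [point, exp_mul_pi_div_two_mul_I hσ, surfaceLog] at h
  rw [show (σ : ℂ) * r * Complex.I = r * (σ * Complex.I) by ring, h]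
  push_cast
  rfl

/-- The logarithms and the exponentially small terms on a Stokes line. -/
theorem log_add_eq_surfaceLog_add (M : ℕ) {s r : ℝ} (hs : s = 1 ∨ s = -1) (hr : 0 < r) {z : ℂ}
    (hz : z = (s * (-1) ^ M : ℝ) * r * Complex.I) (hzn : ‖z‖ = r) :
    Complex.log z + (s * (-1) ^ M : ℝ) / (Complex.exp (2 * Real.pi * r) - 1) *
        (Real.pi * Complex.I) =
      surfaceLog r (s * (((M : ℝ) + 1 / 2) * Real.pi)) + discontinuityPsiSL M s z := by
  have hσ : s * (-1) ^ M = 1 ∨ s * (-1) ^ M = -1 := by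
    rcases hs with rfl | rfl <;> rcases neg_one_pow_eq_or ℝ M with h | h <;> rw [h] <;> norm_num
  rw [hz, log_mul_I hr hσ, ← hz, surfaceLog, discontinuityPsiSL, hzn]
  -- Expresses `M` through its floor half and parity sign, so that one computation covers even and
  -- odd `M`.
  have hM : ((M : ℕ) : ℂ) = 2 * ((M / 2 : ℕ) : ℂ) + (1 - (-1) ^ M) / 2 := by
    rcases Nat.even_or_odd' M with ⟨k, rfl | rfl⟩
    · rw [pow_mul, show 2 * k / 2 = k by omega]
      push_cast
      norm_num
    · rw [pow_succ, pow_mul, show (2 * k + 1) / 2 = k by omega]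
      push_cast
      norm_num
  generalize Complex.exp (2 * Real.pi * r) - 1 = E
  push_cast
  rw [hM]
  ring

/-- Here `z = iσr` with `σ = s(-1)^M`. The regularized integrals depend on `|z|` only; `M` enters
through `σ` and the branch of the logarithm. -/
theorem digamma_stokes_line (K M : ℕ) {s r : ℝ} (hs : s = 1 ∨ s = -1) (hr : 0 < r) {z : ℂ}
    (hz : z = point r (s * (((M : ℝ) + 1 / 2) * Real.pi))) :
    ∃ I J : ℝ,
      HasPrincipalValue (integrandSL (K + 1) ‖z‖) (poles ‖z‖) I ∧
      HasFinitePart (integrandSqSL (K + 1) ‖z‖) (poles ‖z‖) J ∧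
      Complex.digamma z =
        surfaceLog r (s * (((M : ℝ) + 1 / 2) * Real.pi)) - 1 / (2 * z) -
          truncatedSeries (K + 1) z + remainderPsiSL (K + 1) z I J +
          discontinuityPsiSL M s z := by
  rw [point_stokes_line M hs] at hz
  have hσ : s * (-1) ^ M = 1 ∨ s * (-1) ^ M = -1 := by
    rcases hs with rfl | rfl <;> rcases neg_one_pow_eq_or ℝ M with h | h <;> rw [h] <;> norm_num
  have hzn : ‖z‖ = r := by
    rw [hz]
    rcases hσ with h | h <;> rw [h] <;> simp [abs_of_pos hr]
  have hz2 : z ^ 2 = -(r : ℂ) ^ 2 := by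
    rw [hz, mul_pow, mul_pow, Complex.I_sq]
    rcases hσ with h | h <;> rw [h] <;> simp
  obtain ⟨I, A, J, hI, hJ, h⟩ := exists_hasExpansion hr hz2 hzn K
  refine ⟨I, J, by rw [hzn]; exact hI.hasPrincipalValue, by rw [hzn]; exact hJ.hasFinitePart, ?_⟩
  have h1 := digamma_mul_I hr hσ
  rw [← hz] at h1
  rw [h1]
  linear_combination log_add_eq_surfaceLog_add M hs hr hz hzn - h

end StirlingDigamma

theorem theorem3p1 (N : ℕ) (hN : 1 ≤ N) (M : ℕ) (s : ℝ) (hs : s = 1 ∨ s = -1)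
    (r θ : ℝ) (hr : 0 < r) (z : ℂ) (hz : z = StirlingDigamma.point r θ) :
    -- Stokes sectors
    (((M : ℝ) - 1 / 2) * Real.pi < s * θ → s * θ < ((M : ℝ) + 1 / 2) * Real.pi →
      (∀ m : ℕ, z ≠ -(m : ℂ)) →
      (∀ y : ℝ, 0 < y → Summable (StirlingDigamma.termSS N z y)) ∧
      (∀ y : ℝ, 0 < y → Summable (StirlingDigamma.termSqSS N z y)) ∧
      IntegrableOn (StirlingDigamma.integrandSS N z) (Ioi 0) ∧
      IntegrableOn (StirlingDigamma.integrandSqSS N z) (Ioi 0) ∧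
      Complex.digamma z =
        StirlingDigamma.surfaceLog r θ - 1 / (2 * z) - StirlingDigamma.truncatedSeries N z
          + StirlingDigamma.remainderPsiSS N z + StirlingDigamma.discontinuityPsiSS M s z) ∧
    -- Stokes lines
    (θ = s * (((M : ℝ) + 1 / 2) * Real.pi) →
      (∀ y : ℝ, 0 < y → y ∉ StirlingDigamma.poles ‖z‖ →
        Summable (StirlingDigamma.termSL N ‖z‖ y)) ∧
      (∀ y : ℝ, 0 < y → y ∉ StirlingDigamma.poles ‖z‖ →
        Summable (StirlingDigamma.termSqSL N ‖z‖ y)) ∧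
      ∃ I J : ℝ,
        StirlingDigamma.HasPrincipalValue (StirlingDigamma.integrandSL N ‖z‖)
          (StirlingDigamma.poles ‖z‖) I ∧
        StirlingDigamma.HasFinitePart (StirlingDigamma.integrandSqSL N ‖z‖)
          (StirlingDigamma.poles ‖z‖) J ∧
        Complex.digamma z =
          StirlingDigamma.surfaceLog r θ - 1 / (2 * z) - StirlingDigamma.truncatedSeries N z
            + StirlingDigamma.remainderPsiSL N z I J + StirlingDigamma.discontinuityPsiSL M s z) := by
  subst hz
  obtain ⟨K, rfl⟩ : ∃ K, N = K + 1 := ⟨N - 1, by omega⟩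
  refine ⟨fun h1 h2 hne => ?_, fun hθ => ?_⟩
  · obtain ⟨hre, h⟩ := StirlingDigamma.digamma_stokes_sector hN M hs hr h1 h2
    exact ⟨fun y _ => StirlingDigamma.summable_termSS K hre y,
      fun y _ => StirlingDigamma.summable_termSqSS K hre y,
      StirlingDigamma.integrableOn_integrandSS K hre,
      StirlingDigamma.integrableOn_integrandSqSS K hre, h hne⟩
  · subst hθ
    have hρ : 0 < ‖StirlingDigamma.point r (s * (((M : ℝ) + 1 / 2) * Real.pi))‖ := by
      rw [StirlingDigamma.point, norm_mul, Complex.norm_exp_ofReal_mul_I, mul_one, norm_pos_iff]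
      exact Complex.ofReal_ne_zero.mpr hr.ne'
    exact ⟨fun y hy hyp => StirlingDigamma.summable_termSL K hρ hy hyp,
      fun y hy hyp => StirlingDigamma.summable_termSqSL K hρ hy hyp,
      StirlingDigamma.digamma_stokes_line K M hs hr rfl⟩
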